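/- Let $d\ge 2$ and let $\mathbf F_d$ be the free group on $x_1,\dots,x_d$ with generating system $S=\{x_1^{\pm1},\dots,x_d^{\pm1}\}$ and word length $|\cdot|_S$. Let $\mathrm{Iso}(\mathbf F_d)$ be the group of bijections $f$ of $\mathbf F_d$ with $|f(\gamma)^{-1}f(\delta)|_S=|\gamma^{-1}\delta|_S$ for all $\gamma,\delta$, equipped with the topology of pointwise convergence (a locally compact group), and regard $\mathbf F_d$ as a subgroup of it through left multiplication. For a finite index subgroup $\Lambda\le\mathbf F_d$, let $\mathrm{Iso}(\mathbf F_d)/\Lambda$ be the quotient of $\mathrm{Iso}(\mathbf F_d)$ by the action of $\Lambda$ by postcomposition, on which $\mathbf F_d$ acts by $\gamma\cdot[f]=[f\circ\gamma^{-1}]$, and let $m_\Lambda$ be its Haar probability measure, i.e. the image of the Haar measure of $\mathrm{Iso}(\mathbf F_d)$ restricted to a fundamental domain for $\Lambda$ and rescaled to mass one. Let $u$ be the uniform probability measure on $\mathbf F_d/\Lambda$, and let $\mathbf F_d^{ev}$ be the subgroup of elements of even word length. Two p.m.p. actions of $\mathbf F_d$ on standard probability spaces $(X,\mu)$ and $(Y,\nu)$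 are isometric orbit equivalent if there are a measure-preserving bimeasurable bijection $\Phi:X\to Y$ and a conull measurable $\mathbf F_d$-invariant set $X_0\subseteq X$ such that $\Phi(X_0)$ is $\mathbf F_d$-invariant and $d_Y(\Phi(x),\Phi(x'))=d_X(x,x')$ for all $x,x'\in X_0$. Here $d_X$ and $d_Y$ are the (possibly infinite) shortest path distances of the graphs on $X$ and on $Y$ that join each point $z$ to the points $sz$, $s\in S$. A p.m.p. action of $\mathbf F_d$ on $(X,\mu)$ is mixing if $|\mu(\gamma A\cap B)-\mu(A)\mu(B)|\to0$ as $\gamma\to\infty$ in $\mathbf F_d$, for all measurable $A,B\subseteq X$. (1) Let $\Lambda\le\mathbf F_d$ be a finite index subgroup that is not contained in $\mathbf F_d^{ev}$. Then $\mathbf F_d\curvearrowright(\mathrm{Iso}(\mathbf F_d)/\Lambda,m_\Lambda)$ and the diagonal action $\mathbf F_d\curvearrowright(\mathrm{Iso}(\mathbf F_d)/\mathbf F_d\times\mathbf F_d/\Lambda,\,m_{\mathbf F_d}\otimes u)$ are ergodic p.m.p. actions that are isometric orbit equivalent. The former is mixing and, if $\Lambda\ne\mathbf F_d$, the latter is not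 mixing. (2) Consequently mixing is not invariant under isometric orbit equivalence: there are ergodic p.m.p. actions $\mathbf F_d\curvearrowright(X,\mu)$ and $\mathbf F_d\curvearrowright(Y,\nu)$ that are isometric orbit equivalent, such that the first is not mixing and the second is mixing. -/

import Mathlib

open MeasureTheory Filter Topology ProbabilityTheory
open scoped ENNReal

noncomputable section

/-! ### Word length, the Cayley graph and its group of bijective isometries -/

/-- The word length of `γ` with respect to the generating system `S`: the least length of a word
in the letters `S` that represents `γ`. -/
def wordLength {Γ : Type*} [Group Γ] (S : Set Γ) (γ : Γ) : ℕ :=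
  sInf {n : ℕ | ∃ l : List Γ, l.length = n ∧ (∀ s ∈ l, s ∈ S) ∧ l.prod = γ}

/-- The group `Iso(Γ)` of bijections of `Γ` that preserve the word metric `|γ⁻¹ δ|`. -/
def CayleyIso {Γ : Type*} [Group Γ] (S : Set Γ) : Subgroup (Equiv.Perm Γ) where
  carrier := {f | ∀ γ δ : Γ, wordLength S ((f γ)⁻¹ * f δ) = wordLength S (γ⁻¹ * δ)}
  mul_mem' := by
    intro f g hf hg γ δ
    simp only [Set.mem_ofPred_eq, Equiv.Perm.coe_mul, Function.comp_apply] at *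
    rw [hf, hg]
  one_mem' := by intro γ δ; simp
  inv_mem' := by
    intro f hf γ δ
    have h := hf (f⁻¹ γ) (f⁻¹ δ)
    have e : ∀ x, f (f⁻¹ x) = x := f.apply_symm_apply
    rw [e, e] at h
    exact h.symm

/-- The embedding of `Γ` into `Iso(Γ)` by left multiplication. -/
def leftMulIso {Γ : Type*} [Group Γ] (S : Set Γ) : Γ →* CayleyIso S where
  toFun γ := ⟨Equiv.mulLeft γ, by intro x y; simp⟩
  map_one' := by ext x; simp
  map_mul' a b := by ext x; simp

/-- The topology of pointwise convergence on `Iso(Γ)`, where `Γ` is discrete. -/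
instance instTopologicalSpaceCayleyIso {Γ : Type*} [Group Γ] (S : Set Γ) :
    TopologicalSpace (CayleyIso S) :=
  TopologicalSpace.induced (fun (f : CayleyIso S) (γ : Γ) => (f : Equiv.Perm Γ) γ)
    (@Pi.topologicalSpace Γ (fun _ => Γ) (fun _ => ⊥))

instance instMeasurableSpaceCayleyIso {Γ : Type*} [Group Γ] (S : Set Γ) :
    MeasurableSpace (CayleyIso S) := borel _

instance instBorelSpaceCayleyIso {Γ : Type*} [Group Γ] (S : Set Γ) :
    BorelSpace (CayleyIso S) := ⟨rfl⟩

theorem cayleyIso_continuous_iff {Γ : Type*} [Group Γ] (S : Set Γ) {X : Type*} [TopologicalSpace X]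
    (F : X → CayleyIso S) :
    Continuous F ↔ ∀ γ δ : Γ, IsOpen {x | (F x : Equiv.Perm Γ) γ = δ} := by
  let _ : TopologicalSpace Γ := ⊥
  have : DiscreteTopology Γ := ⟨rfl⟩
  rw [continuous_induced_rng, continuous_pi_iff]
  refine forall_congr' fun γ => ?_
  rw [continuous_discrete_rng]
  rfl

theorem cayleyIso_isOpen {Γ : Type*} [Group Γ] (S : Set Γ) (γ δ : Γ) :
    IsOpen {f : CayleyIso S | (f : Equiv.Perm Γ) γ = δ} :=
  (cayleyIso_continuous_iff S id).1 continuous_id γ δ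

instance instIsTopologicalGroupCayleyIso {Γ : Type*} [Group Γ] (S : Set Γ) :
    IsTopologicalGroup (CayleyIso S) where
  continuous_mul := by
    rw [cayleyIso_continuous_iff]
    intro γ δ
    have h : {p : CayleyIso S × CayleyIso S |
        ((p.1 * p.2 : CayleyIso S) : Equiv.Perm Γ) γ = δ} =
        ⋃ ε : Γ, {f : CayleyIso S | (f : Equiv.Perm Γ) ε = δ} ×ˢ
          {g : CayleyIso S | (g : Equiv.Perm Γ) γ = ε} := by
      ext p; simp
    rw [h]
    exact isOpen_iUnion fun ε => (cayleyIso_isOpen S ε δ).prod (cayleyIso_isOpen S γ ε)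
  continuous_inv := by
    rw [cayleyIso_continuous_iff]
    intro γ δ
    have h : {p : CayleyIso S | ((p⁻¹ : CayleyIso S) : Equiv.Perm Γ) γ = δ} =
        {p : CayleyIso S | (p : Equiv.Perm Γ) δ = γ} := by
      ext p
      simp only [Set.mem_ofPred_eq, InvMemClass.coe_inv, Equiv.Perm.inv_eq_iff_eq]
      exact eq_comm
    rw [h]
    exact cayleyIso_isOpen S δ γ

/-- The subset `Iso₁(Γ)` of isometries that fix the identity of `Γ`. -/
def isoOne {Γ : Type*} [Group Γ] (S : Set Γ) : Set (CayleyIso S) :=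
  {f | (f : Equiv.Perm Γ) 1 = 1}

theorem wordLength_ball_finite {Γ : Type*} [Group Γ] {S : Set Γ} (hfin : S.Finite)
    (hgen : ∀ γ : Γ, ∃ l : List Γ, (∀ s ∈ l, s ∈ S) ∧ l.prod = γ) (n : ℕ) :
    {γ : Γ | wordLength S γ = n}.Finite := by
  have : Finite S := hfin
  refine ((List.finite_length_eq S n).image (fun l => (l.map Subtype.val).prod)).subset ?_
  intro γ hγ
  obtain ⟨l₀, h₀, h₁⟩ := hgen γ
  obtain ⟨l, hl, hS, hp⟩ := Nat.sInf_mem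
    (s := {n : ℕ | ∃ l : List Γ, l.length = n ∧ (∀ s ∈ l, s ∈ S) ∧ l.prod = γ})
    ⟨_, l₀, rfl, h₀, h₁⟩
  lift l to List S using hS
  refine ⟨l, ?_, hp⟩
  rw [List.length_map] at hl
  exact hl.trans hγ

theorem isoOne_isCompact {Γ : Type*} [Group Γ] {S : Set Γ} (hfin : S.Finite)
    (hgen : ∀ γ : Γ, ∃ l : List Γ, (∀ s ∈ l, s ∈ S) ∧ l.prod = γ) :
    IsCompact (isoOne S) := by
  let _ : TopologicalSpace Γ := ⊥
  have : DiscreteTopology Γ := ⟨rfl⟩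
  let e : CayleyIso S → (Γ → Γ) × (Γ → Γ) :=
    fun f => (fun γ => (f : Equiv.Perm Γ) γ, fun γ => (f : Equiv.Perm Γ).symm γ)
  have he1 : Continuous fun (f : CayleyIso S) (γ : Γ) => (f : Equiv.Perm Γ) γ :=
    continuous_induced_dom
  have he2 : Continuous fun (f : CayleyIso S) (γ : Γ) => (f : Equiv.Perm Γ).symm γ := by
    have := he1.comp (continuous_inv (G := CayleyIso S))
    exact this
  have hind : IsInducing e :=
    IsInducing.of_comp (g := Prod.fst) (he1.prodMk he2) continuous_fst ⟨rfl⟩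
  rw [hind.isCompact_iff]
  have hK : IsCompact ((Set.univ.pi fun γ : Γ => {x : Γ | wordLength S x = wordLength S γ}) ×ˢ
      (Set.univ.pi fun γ : Γ => {x : Γ | wordLength S x = wordLength S γ})) :=
    (isCompact_univ_pi fun γ => (wordLength_ball_finite hfin hgen _).isCompact).prod
      (isCompact_univ_pi fun γ => (wordLength_ball_finite hfin hgen _).isCompact)
  have him : e '' isoOne S = {p : (Γ → Γ) × (Γ → Γ) | p.1 1 = 1 ∧
      (∀ γ, p.1 (p.2 γ) = γ) ∧ (∀ γ, p.2 (p.1 γ) = γ) ∧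
      ∀ γ δ, wordLength S ((p.1 γ)⁻¹ * p.1 δ) = wordLength S (γ⁻¹ * δ)} := by
    ext p
    constructor
    · rintro ⟨f, hf, rfl⟩
      exact ⟨hf, fun γ => by simp [e], fun γ => by simp [e], f.2⟩
    · rintro ⟨h1, h2, h3, h4⟩
      exact ⟨⟨⟨p.1, p.2, h3, h2⟩, h4⟩, h1, rfl⟩
  have happ : Continuous fun q : (Γ → Γ) × Γ => q.1 q.2 := by
    rw [continuous_discrete_rng]
    intro b
    have h : ((fun q : (Γ → Γ) × Γ => q.1 q.2) ⁻¹' {b}) =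
        ⋃ c : Γ, {g : Γ → Γ | g c = b} ×ˢ {c} := by
      ext q; simp
    rw [h]
    refine isOpen_iUnion fun c => IsOpen.prod ?_ (isOpen_discrete _)
    exact (isOpen_discrete ({b} : Set Γ)).preimage (f := fun g : Γ → Γ => g c) (continuous_apply c)
  have hc1 : ∀ γ : Γ, Continuous fun p : (Γ → Γ) × (Γ → Γ) => p.1 γ :=
    fun γ => (continuous_apply γ).comp continuous_fst
  have hc2 : ∀ γ : Γ, Continuous fun p : (Γ → Γ) × (Γ → Γ) => p.2 γ :=
    fun γ => (continuous_apply γ).comp continuous_snd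
  refine hK.of_isClosed_subset ?_ ?_
  · rw [him]
    have i1 : IsClosed {p : (Γ → Γ) × (Γ → Γ) | p.1 1 = 1} :=
      isClosed_eq (hc1 1) continuous_const
    have i2 : IsClosed (⋂ γ : Γ, {p : (Γ → Γ) × (Γ → Γ) | p.1 (p.2 γ) = γ}) :=
      isClosed_iInter fun γ =>
        isClosed_eq (happ.comp (continuous_fst.prodMk (hc2 γ))) continuous_const
    have i3 : IsClosed (⋂ γ : Γ, {p : (Γ → Γ) × (Γ → Γ) | p.2 (p.1 γ) = γ}) :=
      isClosed_iInter fun γ =>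
        isClosed_eq (happ.comp (continuous_snd.prodMk (hc1 γ))) continuous_const
    have i4 : IsClosed (⋂ γ : Γ, ⋂ δ : Γ, {p : (Γ → Γ) × (Γ → Γ) |
        wordLength S ((p.1 γ)⁻¹ * p.1 δ) = wordLength S (γ⁻¹ * δ)}) := by
      refine isClosed_iInter fun γ => isClosed_iInter fun δ => ?_
      have hd : Continuous fun q : Γ × Γ => wordLength S (q.1⁻¹ * q.2) :=
        continuous_of_discreteTopology
      exact isClosed_eq (hd.comp ((hc1 γ).prodMk (hc1 δ))) continuous_const
    convert i1.inter (i2.inter (i3.inter i4)) using 1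
    ext p
    simp only [Set.mem_inter_iff, Set.mem_iInter, Set.mem_ofPred_eq]
  · rw [him]
    rintro p ⟨h1, h2, h3, h4⟩
    have h5 : ∀ γ, wordLength S (p.1 γ) = wordLength S γ := fun γ => by
      simpa [h1] using h4 1 γ
    refine ⟨fun γ _ => h5 γ, fun γ _ => ?_⟩
    have := h5 (p.2 γ)
    rw [h2] at this
    exact this.symm

/-! ### The free group -/

/-- The generating system `{x₁^{±1}, …, x_d^{±1}}` of the free group. -/
def freeGens (d : ℕ) : Set (FreeGroup (Fin d)) :=
  {g | ∃ i : Fin d, g = FreeGroup.of i ∨ g = (FreeGroup.of i)⁻¹}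

theorem freeGens_finite (d : ℕ) : (freeGens d).Finite := by
  refine ((Set.finite_range fun i : Fin d => FreeGroup.of i).union
    (Set.finite_range fun i : Fin d => (FreeGroup.of i)⁻¹)).subset ?_
  rintro g ⟨i, rfl | rfl⟩
  · exact Or.inl ⟨i, rfl⟩
  · exact Or.inr ⟨i, rfl⟩

theorem freeGens_generate (d : ℕ) (γ : FreeGroup (Fin d)) :
    ∃ l : List (FreeGroup (Fin d)), (∀ s ∈ l, s ∈ freeGens d) ∧ l.prod = γ := by
  induction γ using FreeGroup.induction_on with
  | C1 => exact ⟨[], by simp, rfl⟩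
  | of i => exact ⟨[FreeGroup.of i], by simpa using ⟨i, Or.inl rfl⟩, by simp⟩
  | inv_of i _ => exact ⟨[(FreeGroup.of i)⁻¹], by simpa using ⟨i, Or.inr rfl⟩, by simp⟩
  | mul x y hx hy =>
    obtain ⟨l, hl, rfl⟩ := hx
    obtain ⟨m, hm, rfl⟩ := hy
    refine ⟨l ++ m, ?_, by simp⟩
    intro s hs
    rcases List.mem_append.1 hs with h | h
    · exact hl s h
    · exact hm s h

/-- The parity of the word length is the homomorphism to `ℤ/2` sending each generator to `1`. -/
theorem wordLength_parity (d : ℕ) (γ : FreeGroup (Fin d)) :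
    ((wordLength (freeGens d) γ : ℕ) : ZMod 2) =
      Multiplicative.toAdd
        (FreeGroup.lift (fun _ : Fin d => Multiplicative.ofAdd (1 : ZMod 2)) γ) := by
  have key : ∀ l : List (FreeGroup (Fin d)), (∀ s ∈ l, s ∈ freeGens d) →
      Multiplicative.toAdd
        (FreeGroup.lift (fun _ : Fin d => Multiplicative.ofAdd (1 : ZMod 2)) l.prod) =
        ((l.length : ℕ) : ZMod 2) := by
    intro l
    induction l with
    | nil => intro _; simp
    | cons a l ih =>
      intro h
      have ha := h a (by simp)
      have hl := ih fun s hs => h s (by simp [hs])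
      rw [List.prod_cons, map_mul, toAdd_mul, hl, List.length_cons]
      push_cast
      rw [add_comm]
      congr 1
      obtain ⟨i, rfl | rfl⟩ := ha
      · simp
      · simp only [map_inv, FreeGroup.lift_apply_of, toAdd_inv, toAdd_ofAdd]
        decide
  obtain ⟨l₀, h₀, h₁⟩ := freeGens_generate d γ
  obtain ⟨l, hl, hS, hp⟩ := Nat.sInf_mem
    (s := {n : ℕ | ∃ l : List (FreeGroup (Fin d)), l.length = n ∧
      (∀ s ∈ l, s ∈ freeGens d) ∧ l.prod = γ}) ⟨_, l₀, rfl, h₀, h₁⟩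
  have h := key l hS
  rw [hp, hl] at h
  exact h.symm

/-- The even subgroup of the free group: the elements of even word length. -/
def evenSubgroup (d : ℕ) : Subgroup (FreeGroup (Fin d)) where
  carrier := {γ | Even (wordLength (freeGens d) γ)}
  mul_mem' := by
    intro a b ha hb
    simp only [Set.mem_ofPred_eq, ← ZMod.natCast_eq_zero_iff_even, wordLength_parity] at *
    rw [map_mul, toAdd_mul, ha, hb, add_zero]
  one_mem' := by
    simp only [Set.mem_ofPred_eq, ← ZMod.natCast_eq_zero_iff_even, wordLength_parity]
    simp
  inv_mem' := by
    intro a ha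
    simp only [Set.mem_ofPred_eq, ← ZMod.natCast_eq_zero_iff_even, wordLength_parity] at *
    rw [map_inv, toAdd_inv, ha, neg_zero]

/-- The compact open subgroup `Iso₁(F_d)`. -/
def isoOneFree (d : ℕ) : TopologicalSpace.PositiveCompacts (CayleyIso (freeGens d)) where
  carrier := isoOne (freeGens d)
  isCompact' := isoOne_isCompact (freeGens_finite d) (freeGens_generate d)
  interior_nonempty' := by
    have h : IsOpen (isoOne (freeGens d)) := cayleyIso_isOpen (freeGens d) 1 1
    rw [h.interior_eq]
    exact ⟨1, rfl⟩

/-- The Haar measure on `Iso(F_d)`, normalized so that `Iso₁(F_d)` has measure one. -/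
def haarIso (d : ℕ) : Measure (CayleyIso (freeGens d)) :=
  Measure.haarMeasure (isoOneFree d)

/-! ### The quotients `Iso(Γ)/Λ` -/

/-- `Iso(Γ)/Λ`: the quotient of `Iso(Γ)` by the action of `Λ ≤ Γ` by postcomposition, i.e.
`f` and `g` are identified iff `g = λ f` for some `λ ∈ Λ`. -/
def IsoQuot {Γ : Type*} [Group Γ] (S : Set Γ) (Λ : Subgroup Γ) : Type _ :=
  Quotient (QuotientGroup.rightRel (Λ.map (leftMulIso S)))

/-- The quotient map `Iso(Γ) → Iso(Γ)/Λ`. -/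
def IsoQuot.mk {Γ : Type*} [Group Γ] (S : Set Γ) (Λ : Subgroup Γ) (f : CayleyIso S) :
    IsoQuot S Λ :=
  Quotient.mk (QuotientGroup.rightRel (Λ.map (leftMulIso S))) f

/-- The quotient measurable structure. -/
instance instMeasurableSpaceIsoQuot {Γ : Type*} [Group Γ] (S : Set Γ) (Λ : Subgroup Γ) :
    MeasurableSpace (IsoQuot S Λ) :=
  MeasurableSpace.map (IsoQuot.mk S Λ) inferInstance

/-- `Iso(Γ)` acts on `Iso(Γ)/Λ` by precomposition by the inverse: `g • [f] = [f ∘ g⁻¹]`. -/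
instance instMulActionIsoIsoQuot {Γ : Type*} [Group Γ] (S : Set Γ) (Λ : Subgroup Γ) :
    MulAction (CayleyIso S) (IsoQuot S Λ) where
  smul g := Quotient.map (fun f => f * g⁻¹) (by
    intro a b hab
    change QuotientGroup.rightRel _ _ _
    have hab' : QuotientGroup.rightRel (Λ.map (leftMulIso S)) a b := hab
    rw [QuotientGroup.rightRel_apply] at *
    simpa [mul_assoc] using hab')
  one_smul x := by
    induction x using Quotient.inductionOn with
    | h f => exact congrArg (IsoQuot.mk S Λ) (by simp : f * (1 : CayleyIso S)⁻¹ = f)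
  mul_smul g h x := by
    induction x using Quotient.inductionOn with
    | h f =>
      exact congrArg (IsoQuot.mk S Λ) (by simp [mul_assoc] : f * (g * h)⁻¹ = f * h⁻¹ * g⁻¹)

/-- The action of `Γ` on `Iso(Γ)/Λ`, through the embedding of `Γ` into `Iso(Γ)`. -/
instance instMulActionIsoQuot {Γ : Type*} [Group Γ] (S : Set Γ) (Λ : Subgroup Γ) :
    MulAction Γ (IsoQuot S Λ) :=
  MulAction.compHom (IsoQuot S Λ) (leftMulIso S)

/-- A fundamental domain for the action of `Λ` on `Iso(Γ)` by postcomposition: the isometries `f`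
such that `f 1` lies in a fixed set of representatives of the cosets `Λγ`. -/
def isoFundamentalDomain {Γ : Type*} [Group Γ] (S : Set Γ) (Λ : Subgroup Γ) :
    Set (CayleyIso S) :=
  {f | (f : Equiv.Perm Γ) 1 ∈
    Set.range (Quotient.out : Quotient (QuotientGroup.rightRel Λ) → Γ)}

/-- The Haar probability measure on `Iso(F_d)/Λ`: the image under the quotient map of the Haar
measure restricted to a fundamental domain and rescaled to have mass one. -/
def haarQuot (d : ℕ) (Λ : Subgroup (FreeGroup (Fin d))) : Measure (IsoQuot (freeGens d) Λ) :=
  (ProbabilityTheory.cond (haarIso d) (isoFundamentalDomain (freeGens d) Λ)).map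
    (IsoQuot.mk (freeGens d) Λ)

/-- The coset space `F_d/Λ` is a discrete measurable space. -/
instance instMeasurableSpaceFreeCosets (d : ℕ) (Λ : Subgroup (FreeGroup (Fin d))) :
    MeasurableSpace (FreeGroup (Fin d) ⧸ Λ) := ⊤

/-- The uniform probability measure on the finite set `F_d/Λ`. -/
def uniformCosets (d : ℕ) (Λ : Subgroup (FreeGroup (Fin d))) :
    Measure (FreeGroup (Fin d) ⧸ Λ) :=
  uniformOn Set.univ

/-! ### Probability measure preserving actions -/

/-- `Γ ↷ (X, μ)` is a p.m.p. action on a standard probability space. -/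
structure IsPMPAction (Γ : Type*) [Group Γ] {X : Type*} [MeasurableSpace X] [MulAction Γ X]
    (μ : Measure X) : Prop where
  standardBorel : StandardBorelSpace X
  isProbability : IsProbabilityMeasure μ
  measurePreserving : ∀ γ : Γ, MeasurePreserving (fun x : X => γ • x) μ μ

/-- A p.m.p. action of a discrete group `Γ` is mixing if `|μ(γA ∩ B) - μ(A)μ(B)| → 0` as `γ → ∞`
for all measurable `A` and `B`. -/
def IsMixingAction (Γ : Type*) [Group Γ] {X : Type*} [MeasurableSpace X] [MulAction Γ X]
    (μ : Measure X) : Prop :=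
  ∀ A B : Set X, MeasurableSet A → MeasurableSet B →
    Tendsto (fun γ : Γ => |μ.real (((fun x => γ • x) '' A) ∩ B) - μ.real A * μ.real B|)
      cofinite (𝓝 0)

/-- The graph on `X` of the graphing given by the elements of `S`: distinct points `x`, `y` are
adjacent iff `y = s x` or `x = s y` for some `s ∈ S`. Its extended distance `edist` is the
shortest path distance of the graphing. -/
def graphingGraph {Γ : Type*} [Group Γ] (S : Set Γ) (X : Type*) [MulAction Γ X] :
    SimpleGraph X :=
  SimpleGraph.fromRel fun x y => ∃ s ∈ S, y = s • x

/-- A measurable set is saturated if it is the set of points at finite distance from it. -/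
def IsSaturated {X : Type*} [MeasurableSpace X] (G : SimpleGraph X) (A : Set X) : Prop :=
  MeasurableSet A ∧ A = {y | ∃ x ∈ A, G.edist x y < ⊤}

/-- The actions `Γ ↷ (X, μ)` and `Δ ↷ (Y, ν)` are isometric orbit equivalent with respect to the
generating systems `S` of `Γ` and `T` of `Δ`. -/
def IsometricOrbitEquivalent {Γ Δ : Type*} [Group Γ] [Group Δ] (S : Set Γ) (T : Set Δ)
    {X Y : Type*} [MeasurableSpace X] [MeasurableSpace Y] [MulAction Γ X] [MulAction Δ Y]
    (μ : Measure X) (ν : Measure Y) : Prop :=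
  ∃ Φ : X ≃ᵐ Y, MeasurePreserving Φ μ ν ∧
    ∃ X₀ : Set X, IsSaturated (graphingGraph S X) X₀ ∧ μ X₀ = 1 ∧
      IsSaturated (graphingGraph T Y) (Φ '' X₀) ∧
      ∀ x ∈ X₀, ∀ x' ∈ X₀,
        (graphingGraph T Y).edist (Φ x) (Φ x') = (graphingGraph S X).edist x x'

end

/-!
The isometric orbit equivalence is the map `Λ f ↦ (F_d f⁻¹ f(1), f(1)⁻¹ Λ)`, which is inversion on
the isometries that fix the identity. It sends `γ x` to `δ` times the image of `x`, where
`γ⁻¹ ↦ δ⁻¹` is an isometry of the free group that fixes the identity and depends on `x`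
(`inversionMap_smul`). So it is an isomorphism of the two graphings. It preserves the measures
because the Haar measure of `Iso(F_d)` is invariant under inversion: the group contains `F_d` as a
lattice and is therefore unimodular (`measurePreserving_inversionEquiv`).

Mixing of `Iso(F_d)/Λ` is proved with a Markov chain on the Schreier graph `F_d/Λ`, without
appealing to representation theory. Up to the choice of a coset representative, a random point of
`Iso(F_d)/Λ` is a uniformly random isometry `f`. Along a reduced word `s₁ s₂ ⋯` the edges
`(Λ f(s₁⋯sₙ), f(s₁⋯sₙ)⁻¹ f(s₁⋯sₙ₊₁))` perform a non-backtracking random walk, since an isometry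
can be changed on a branch of the tree by any isometry that fixes the rest of the tree
(`setIntegral_edgeState_iterate`). The non-backtracking operator is a contraction in `ℓ²`. When
equality holds for two steps, the value of the function on an edge depends only on the vertex at
which the edge arrives, and these values alternate between two constants along the paths in the
Schreier graph. As `Λ` contains a word of odd length, the graph is not bipartite and the function is
constant (`const_of_sum_sq_eq`). By compactness the operator contracts the functions of mean zero,
so that its iterates converge to constants uniformly (`exists_iterate_near_const`).

Events that depend on `f` near `1` and events that depend on `f` near `γ` only interact through
the edges of the geodesic from `1` to `γ`: given the state of such an edge, what happens behind it
and what happens ahead of it are independent (`exists_conditional_edgeState`), and the state of an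
edge far from `1` is asymptotically independent of what happens near `1`
(`exists_abs_measureReal_sub_le`). This gives mixing on the `π`-system of the sets that are
invariant under the pointwise stabilizer of some ball, and this `π`-system generates the `σ`-algebra
(`isoQuot_measurableSpace_eq`), which suffices (`tendsto_measureReal_inter_of_piSystem`). Mixing implies ergodicity, and ergodicity passes along
the orbit equivalence. The diagonal action has the finite factor `F_d/Λ`, hence is not mixing.
-/

/-! ### Word length and branches of the free group -/

/-- The word length of the free group with respect to its standard generating system. -/
local notation "ℓ" => wordLength (freeGens _)

section FreeGroupTree

variable {d : ℕ}

theorem wordLength_le_length {Γ : Type*} [Group Γ] {S : Set Γ} (l : List Γ)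
    (hl : ∀ s ∈ l, s ∈ S) : wordLength S l.prod ≤ l.length :=
  Nat.sInf_le ⟨l, rfl, hl, rfl⟩

theorem exists_list_wordLength (g : FreeGroup (Fin d)) :
    ∃ l : List (FreeGroup (Fin d)), l.length = ℓ g ∧ (∀ s ∈ l, s ∈ freeGens d) ∧ l.prod = g := by
  obtain ⟨l₀, h₀, h₁⟩ := freeGens_generate d g
  exact Nat.sInf_mem (s := {n : ℕ | ∃ l : List (FreeGroup (Fin d)), l.length = n ∧
      (∀ s ∈ l, s ∈ freeGens d) ∧ l.prod = g}) ⟨_, l₀, rfl, h₀, h₁⟩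

theorem mk_singleton_mem_freeGens (a : Fin d × Bool) : FreeGroup.mk [a] ∈ freeGens d := by
  obtain ⟨i, _ | _⟩ := a
  · exact ⟨i, Or.inr rfl⟩
  · exact ⟨i, Or.inl rfl⟩

theorem exists_letter {t : FreeGroup (Fin d)} (ht : t ∈ freeGens d) :
    ∃ a : Fin d × Bool, t = FreeGroup.mk [a] := by
  obtain ⟨i, rfl | rfl⟩ := ht
  · exact ⟨(i, true), rfl⟩
  · exact ⟨(i, false), rfl⟩

theorem inv_mem_freeGens {t : FreeGroup (Fin d)} (ht : t ∈ freeGens d) : t⁻¹ ∈ freeGens d := by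
  obtain ⟨i, rfl | rfl⟩ := ht
  · exact ⟨i, Or.inr rfl⟩
  · exact ⟨i, Or.inl (inv_inv _)⟩

theorem wordLength_eq_norm (g : FreeGroup (Fin d)) : ℓ g = g.norm := by
  apply le_antisymm
  · have h : ((g.toWord.map fun a => FreeGroup.mk [a]) : List (FreeGroup (Fin d))).prod = g := by
      conv_rhs => rw [← FreeGroup.mk_toWord (x := g)]
      induction g.toWord with
      | nil => rfl
      | cons a l ih => rw [List.map_cons, List.prod_cons, ih]; rfl
    have := wordLength_le_length (S := freeGens d) (g.toWord.map fun a => FreeGroup.mk [a]) (by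
      intro s hs
      obtain ⟨a, _, rfl⟩ := List.mem_map.1 hs
      exact mk_singleton_mem_freeGens a)
    rw [h, List.length_map] at this
    exact this
  · obtain ⟨l, hl, hS, rfl⟩ := exists_list_wordLength g
    rw [← hl]
    clear hl
    induction l with
    | nil => simp
    | cons a l ih =>
      obtain ⟨b, hb⟩ := exists_letter (hS a (by simp))
      have h1 : a.norm ≤ 1 := hb ▸ FreeGroup.norm_mk_le
      have h2 := FreeGroup.norm_mul_le a l.prod
      have h3 := ih fun s hs => hS s (by simp [hs])
      rw [List.prod_cons, List.length_cons]
      omega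

theorem wordLength_inv (g : FreeGroup (Fin d)) : ℓ g⁻¹ = ℓ g := by
  simp [wordLength_eq_norm]

theorem wordLength_one : ℓ (1 : FreeGroup (Fin d)) = 0 := by
  simp [wordLength_eq_norm]

theorem wordLength_eq_zero {g : FreeGroup (Fin d)} : ℓ g = 0 ↔ g = 1 := by
  simp [wordLength_eq_norm]

theorem wordLength_mul_le (g h : FreeGroup (Fin d)) : ℓ (g * h) ≤ ℓ g + ℓ h := by
  simp only [wordLength_eq_norm]
  exact FreeGroup.norm_mul_le g h

theorem wordLength_eq_one {g : FreeGroup (Fin d)} : ℓ g = 1 ↔ g ∈ freeGens d := by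
  rw [wordLength_eq_norm]
  constructor
  · intro h
    obtain ⟨a, ha⟩ := List.length_eq_one_iff.1 h
    rw [← FreeGroup.mk_toWord (x := g), ha]
    exact mk_singleton_mem_freeGens a
  · intro h
    obtain ⟨a, rfl⟩ := exists_letter h
    rfl

/-- The branch of the Cayley tree at the neighbour `t` of the identity: the elements that are
closer to `t` than to the identity, that is, whose reduced word begins with `t`. -/
def branch (t : FreeGroup (Fin d)) : Set (FreeGroup (Fin d)) :=
  {w | ℓ (t⁻¹ * w) < ℓ w}

theorem one_notMem_branch (t : FreeGroup (Fin d)) : (1 : FreeGroup (Fin d)) ∉ branch t := by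
  simp [branch, wordLength_one]

theorem self_mem_branch {t : FreeGroup (Fin d)} (ht : t ∈ freeGens d) : t ∈ branch t := by
  simp [branch, wordLength_one, wordLength_eq_one.2 ht]

theorem mem_branch_iff_toWord {a : Fin d × Bool} {w : FreeGroup (Fin d)} :
    w ∈ branch (FreeGroup.mk [a]) ↔ ∃ L, w.toWord = a :: L := by
  have hinv : (FreeGroup.mk [a])⁻¹ = FreeGroup.mk [(a.1, !a.2)] := rfl
  constructor
  · intro h
    by_contra hne
    have hred : FreeGroup.IsReduced ((a.1, !a.2) :: w.toWord) := by
      have hw := FreeGroup.isReduced_toWord (x := w)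
      cases hL : w.toWord with
      | nil => exact FreeGroup.IsReduced.singleton
      | cons b L =>
        rw [hL] at hw
        refine List.IsChain.cons_cons ?_ hw
        intro hab
        by_contra hb
        apply hne
        refine ⟨L, ?_⟩
        rw [hL]
        congr 1
        refine Prod.ext hab.symm ?_
        revert hb
        cases a.2 <;> cases b.2 <;> simp
    have h2 : ((FreeGroup.mk [a])⁻¹ * w).toWord = (a.1, !a.2) :: w.toWord := by
      rw [hinv]
      conv_lhs => rw [← FreeGroup.mk_toWord (x := w)]
      rw [FreeGroup.mul_mk, FreeGroup.toWord_mk]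
      exact hred.reduce_eq
    have h' : ℓ ((FreeGroup.mk [a])⁻¹ * w) < ℓ w := h
    rw [wordLength_eq_norm, wordLength_eq_norm, FreeGroup.norm, FreeGroup.norm, h2,
      List.length_cons] at h'
    omega
  · rintro ⟨L, hL⟩
    have h1 : (FreeGroup.mk [a])⁻¹ * w = FreeGroup.mk L := by
      rw [inv_mul_eq_iff_eq_mul, FreeGroup.mul_mk, ← FreeGroup.mk_toWord (x := w), hL]
      rfl
    change ℓ ((FreeGroup.mk [a])⁻¹ * w) < ℓ w
    rw [h1, wordLength_eq_norm, wordLength_eq_norm]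
    refine lt_of_le_of_lt FreeGroup.norm_mk_le ?_
    rw [FreeGroup.norm, hL]
    simp

theorem exists_mem_branch {w : FreeGroup (Fin d)} (hw : w ≠ 1) :
    ∃ t ∈ freeGens d, w ∈ branch t := by
  cases hL : w.toWord with
  | nil => exact absurd (FreeGroup.toWord_eq_nil_iff.1 hL) hw
  | cons a L => exact ⟨_, mk_singleton_mem_freeGens a, mem_branch_iff_toWord.2 ⟨L, hL⟩⟩

/-- Geodesics between different branches of the Cayley tree pass through the identity. -/
theorem wordLength_inv_mul_of_branch_ne {t t' v w : FreeGroup (Fin d)} (ht : t ∈ freeGens d)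
    (ht' : t' ∈ freeGens d) (hne : t ≠ t') (hv : v ∈ branch t) (hw : w ∈ branch t') :
    ℓ (v⁻¹ * w) = ℓ v + ℓ w := by
  obtain ⟨a, rfl⟩ := exists_letter ht
  obtain ⟨b, rfl⟩ := exists_letter ht'
  obtain ⟨L, hL⟩ := mem_branch_iff_toWord.1 hv
  obtain ⟨M, hM⟩ := mem_branch_iff_toWord.1 hw
  have hab : a ≠ b := fun h => hne (by rw [h])
  have hred : FreeGroup.IsReduced (v⁻¹.toWord ++ w.toWord) := by
    refine List.isChain_append.2 ⟨FreeGroup.isReduced_toWord, FreeGroup.isReduced_toWord, ?_⟩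
    intro x hx y hy hxy
    rw [FreeGroup.toWord_inv, hL] at hx
    rw [hM] at hy
    simp [FreeGroup.invRev] at hx hy
    subst hx hy
    by_contra hc
    apply hab
    refine Prod.ext hxy ?_
    revert hc
    cases a.2 <;> cases b.2 <;> simp
  have h : (v⁻¹ * w).toWord = v⁻¹.toWord ++ w.toWord := by
    rw [FreeGroup.toWord_mul, hred.reduce_eq]
  rw [← wordLength_inv v]
  simp only [wordLength_eq_norm, FreeGroup.norm, h, List.length_append]

theorem branch_unique {t t' w : FreeGroup (Fin d)} (ht : t ∈ freeGens d) (ht' : t' ∈ freeGens d)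
    (h : w ∈ branch t) (h' : w ∈ branch t') : t = t' := by
  by_contra hne
  have := wordLength_inv_mul_of_branch_ne ht ht' hne h h'
  rw [inv_mul_cancel, wordLength_one] at this
  have hw : w = 1 := wordLength_eq_zero.1 (by omega)
  exact one_notMem_branch t (hw ▸ h)

theorem wordLength_inv_mul_of_notMem_branch {t v w : FreeGroup (Fin d)} (ht : t ∈ freeGens d)
    (hv : v ∈ branch t) (hw : w ∉ branch t) : ℓ (v⁻¹ * w) = ℓ v + ℓ w := by
  by_cases h1 : w = 1
  · simp [h1, wordLength_inv, wordLength_one]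
  · obtain ⟨t', ht', hw'⟩ := exists_mem_branch h1
    exact wordLength_inv_mul_of_branch_ne ht ht' (fun h => hw (h ▸ hw')) hv hw'

theorem wordLength_of_mem_branch {t w : FreeGroup (Fin d)} (ht : t ∈ freeGens d)
    (hw : w ∈ branch t) : ℓ w = ℓ (t⁻¹ * w) + 1 := by
  have h1 : ℓ (t⁻¹ * w) < ℓ w := hw
  have h2 := wordLength_mul_le t (t⁻¹ * w)
  rw [mul_inv_cancel_left, wordLength_eq_one.2 ht] at h2
  omega

/-- Removing the first letter of a reduced word leaves a word that does not begin with its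
inverse. -/
theorem inv_mul_notMem_branch {t w : FreeGroup (Fin d)} (hw : w ∈ branch t) :
    t⁻¹ * w ∉ branch t⁻¹ := by
  have h1 : ℓ (t⁻¹ * w) < ℓ w := hw
  intro h
  have h2 : ℓ ((t⁻¹)⁻¹ * (t⁻¹ * w)) < ℓ (t⁻¹ * w) := h
  rw [inv_inv, mul_inv_cancel_left] at h2
  omega

theorem freeGroup_fin_infinite (hd : 2 ≤ d) : Infinite (FreeGroup (Fin d)) := by
  have : Nonempty (Fin d) := ⟨⟨0, by omega⟩⟩
  infer_instance

end FreeGroupTree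

/-! ### Isometries of the Cayley tree -/

section TreeIsometries

variable {d : ℕ}

theorem cayleyIso_wordLength {k : CayleyIso (freeGens d)} (hk : k ∈ isoOne (freeGens d))
    (w : FreeGroup (Fin d)) : ℓ ((k : Equiv.Perm _) w) = ℓ w := by
  have h := k.2 1 w
  have hk' : (k : Equiv.Perm (FreeGroup (Fin d))) 1 = 1 := hk
  rw [hk'] at h
  simpa using h

theorem isoOne_map_branch {k : CayleyIso (freeGens d)} (hk : k ∈ isoOne (freeGens d))
    (t w : FreeGroup (Fin d)) :
    (k : Equiv.Perm _) w ∈ branch ((k : Equiv.Perm _) t) ↔ w ∈ branch t := by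
  change ℓ _ < ℓ _ ↔ ℓ _ < ℓ _
  rw [k.2 t w, cayleyIso_wordLength hk]

theorem cayleyIso_inv_mul_mem (f : CayleyIso (freeGens d)) (v : FreeGroup (Fin d))
    {t : FreeGroup (Fin d)} (ht : t ∈ freeGens d) :
    ((f : Equiv.Perm _) v)⁻¹ * (f : Equiv.Perm _) (v * t) ∈ freeGens d := by
  rw [← wordLength_eq_one, f.2, inv_mul_cancel_left, wordLength_eq_one.2 ht]

/-- The isometry that agrees with `k` on a union of branches permuted by `k` and that fixes all
other points. -/
theorem exists_glue {k : CayleyIso (freeGens d)} (hk : k ∈ isoOne (freeGens d))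
    (C : Set (FreeGroup (Fin d))) (hC : C ⊆ freeGens d)
    (hkC : ∀ t ∈ freeGens d, (k : Equiv.Perm _) t ∈ C ↔ t ∈ C) :
    ∃ g ∈ isoOne (freeGens d),
      (∀ t ∈ C, ∀ w ∈ branch t, (g : Equiv.Perm _) w = (k : Equiv.Perm _) w) ∧
      ∀ w, (∀ t ∈ C, w ∉ branch t) → (g : Equiv.Perm _) w = w := by
  classical
  let p : FreeGroup (Fin d) → Prop := fun w => ∃ t ∈ C, w ∈ branch t
  have hgen : ∀ t, (k : Equiv.Perm _) t ∈ freeGens d ↔ t ∈ freeGens d := fun t => by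
    rw [← wordLength_eq_one, ← wordLength_eq_one, cayleyIso_wordLength hk]
  have hp : ∀ w, p ((k : Equiv.Perm _) w) ↔ p w := by
    intro w
    constructor
    · rintro ⟨t, ht, hw⟩
      obtain ⟨s, rfl⟩ := (k : Equiv.Perm _).surjective t
      exact ⟨s, (hkC s ((hgen s).1 (hC ht))).1 ht, (isoOne_map_branch hk s w).1 hw⟩
    · rintro ⟨t, ht, hw⟩
      exact ⟨_, (hkC t (hC ht)).2 ht, (isoOne_map_branch hk t w).2 hw⟩
  have hsep : ∀ v w, p v → ¬ p w → ℓ (v⁻¹ * w) = ℓ v + ℓ w := by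
    rintro v w ⟨t, ht, hv⟩ hw
    exact wordLength_inv_mul_of_notMem_branch (hC ht) hv fun h => hw ⟨t, ht, h⟩
  let g : Equiv.Perm (FreeGroup (Fin d)) :=
    Equiv.Perm.ofSubtype ((k : Equiv.Perm (FreeGroup (Fin d))).subtypePerm hp)
  have hg1 : ∀ w, p w → g w = (k : Equiv.Perm _) w := fun w hw => by
    rw [Equiv.Perm.ofSubtype_apply_of_mem _ hw]
    rfl
  have hg2 : ∀ w, ¬ p w → g w = w := fun w hw => Equiv.Perm.ofSubtype_apply_of_not_mem _ hw
  have hcross : ∀ v w, p v → ¬ p w → ℓ ((g v)⁻¹ * g w) = ℓ (v⁻¹ * w) := by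
    intro v w hv hw
    rw [hg1 v hv, hg2 w hw, hsep _ _ ((hp v).2 hv) hw, hsep _ _ hv hw, cayleyIso_wordLength hk]
  have hg : g ∈ CayleyIso (freeGens d) := by
    intro v w
    by_cases hv : p v <;> by_cases hw : p w
    · rw [hg1 v hv, hg1 w hw, k.2]
    · exact hcross v w hv hw
    · rw [← wordLength_inv, mul_inv_rev, inv_inv, hcross w v hw hv, ← wordLength_inv, mul_inv_rev,
        inv_inv]
    · rw [hg2 v hv, hg2 w hw]
  have hp1 : ¬ p 1 := by
    rintro ⟨t, _, h⟩
    exact one_notMem_branch t h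
  refine ⟨⟨g, hg⟩, hg2 1 hp1, fun t ht w hw => hg1 w ⟨t, ht, hw⟩, fun w hw => hg2 w ?_⟩
  rintro ⟨t, ht, h⟩
  exact hw t ht h

/-- An involutive endomorphism that permutes the generators is an isometry. -/
theorem exists_isoOne_of_involutive (α : FreeGroup (Fin d) →* FreeGroup (Fin d))
    (hα : ∀ s ∈ freeGens d, α s ∈ freeGens d) (hinv : ∀ w, α (α w) = w) :
    ∃ k ∈ isoOne (freeGens d), ∀ w, (k : Equiv.Perm _) w = α w := by
  have hle : ∀ w, ℓ (α w) ≤ ℓ w := by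
    intro w
    obtain ⟨l, hl, hS, rfl⟩ := exists_list_wordLength w
    rw [← hl, map_list_prod]
    refine (wordLength_le_length _ ?_).trans_eq (List.length_map _)
    intro s hs
    obtain ⟨a, ha, rfl⟩ := List.mem_map.1 hs
    exact hα a (hS a ha)
  have heq : ∀ w, ℓ (α w) = ℓ w := fun w =>
    le_antisymm (hle w) (by simpa [hinv] using hle (α w))
  refine ⟨⟨⟨α, α, hinv, hinv⟩, fun v w => ?_⟩, map_one α, fun w => rfl⟩
  change ℓ ((α v)⁻¹ * α w) = _
  rw [← map_inv, ← map_mul, heq]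

/-- Any two generators are exchanged by an isometry that is an automorphism of the free group. -/
theorem exists_isoOne_exchange {t t' : FreeGroup (Fin d)} (ht : t ∈ freeGens d)
    (ht' : t' ∈ freeGens d) :
    ∃ k ∈ isoOne (freeGens d), (k : Equiv.Perm _) t = t' ∧ (k : Equiv.Perm _) t' = t := by
  classical
  obtain ⟨⟨i, b⟩, rfl⟩ := exists_letter ht
  obtain ⟨⟨j, c⟩, rfl⟩ := exists_letter ht'
  -- The letters `(i, ·)` and `(j, ·)` are exchanged, with a change of sign iff `b ≠ c`.
  let θ : Fin d × Bool → Fin d × Bool := fun a =>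
    if a.1 = i ∨ a.1 = j then (Equiv.swap i j a.1, a.2 ^^ (b ^^ c)) else a
  have hθ : ∀ a, θ (θ a) = a := by
    rintro ⟨m, e⟩
    by_cases h : m = i ∨ m = j
    · have h' : Equiv.swap i j m = i ∨ Equiv.swap i j m = j := by
        rcases h with rfl | rfl <;> simp
      simp [θ, h, h']
    · simp [θ, h]
  have hθn : ∀ m e, θ (m, !e) = ((θ (m, e)).1, !(θ (m, e)).2) := by
    intro m e
    by_cases h : m = i ∨ m = j <;> simp [θ, h]
  let α : FreeGroup (Fin d) →* FreeGroup (Fin d) :=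
    FreeGroup.lift fun m => FreeGroup.mk [θ (m, true)]
  have hα : ∀ a, α (FreeGroup.mk [a]) = FreeGroup.mk [θ a] := by
    rintro ⟨m, _ | _⟩
    · have : (FreeGroup.mk [(m, false)] : FreeGroup (Fin d)) = (FreeGroup.of m)⁻¹ := rfl
      rw [this, map_inv, FreeGroup.lift_apply_of, show false = !true from rfl, hθn]
      rfl
    · exact FreeGroup.lift_apply_of
  have hαS : ∀ s ∈ freeGens d, α s ∈ freeGens d := by
    intro s hs
    obtain ⟨a, rfl⟩ := exists_letter hs
    rw [hα]
    exact mk_singleton_mem_freeGens _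
  have hαα : ∀ w, α (α w) = w := by
    have : α.comp α = MonoidHom.id _ := by
      ext m
      change α (α (FreeGroup.mk [(m, true)])) = FreeGroup.mk [(m, true)]
      rw [hα, hα, hθ]
    exact fun w => DFunLike.congr_fun this w
  obtain ⟨k, hk, hkα⟩ := exists_isoOne_of_involutive α hαS hαα
  refine ⟨k, hk, ?_, ?_⟩
  · rw [hkα, hα]
    simp [θ]
  · rw [hkα, hα]
    simp [θ]
    rw [Bool.xor_comm b c, ← Bool.xor_assoc, Bool.xor_self, Bool.false_xor]

/-- The pointwise stabilizer of a set in `Iso(F_d)`. -/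
def isoFix (A : Set (FreeGroup (Fin d))) : Subgroup (CayleyIso (freeGens d)) where
  carrier := {k | ∀ w ∈ A, (k : Equiv.Perm _) w = w}
  mul_mem' := by
    intro a b ha hb w hw
    simp [hb w hw, ha w hw]
  one_mem' := fun w _ => rfl
  inv_mem' := by
    intro a ha w hw
    exact (Equiv.Perm.inv_eq_iff_eq).2 (ha w hw).symm

theorem isoFix_anti {A B : Set (FreeGroup (Fin d))} (h : A ⊆ B) : isoFix B ≤ isoFix A :=
  fun _ hk w hw => hk w (h hw)

/-- The stabilizer of the half-tree behind an edge is transitive on the next edges: a generator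
different from `t` is moved to any other by an isometry that fixes the branch at `t`. -/
theorem exists_isoFix_branch_exchange {t r r' : FreeGroup (Fin d)} (ht : t ∈ freeGens d)
    (hr : r ∈ freeGens d) (hr' : r' ∈ freeGens d) (hrt : r ≠ t) (hrt' : r' ≠ t) :
    ∃ k ∈ isoFix (insert 1 (branch t)), (k : Equiv.Perm _) r = r' := by
  obtain ⟨k, hk, h1, h2⟩ := exists_isoOne_exchange hr hr'
  have hsub : ({r, r'} : Set (FreeGroup (Fin d))) ⊆ freeGens d := by
    rintro x (rfl | rfl) <;> assumption
  obtain ⟨g, hg, hgC, hgfix⟩ := exists_glue hk {r, r'} hsub (by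
    intro s _
    simp only [Set.mem_insert_iff, Set.mem_singleton_iff]
    have hinj := (k : Equiv.Perm (FreeGroup (Fin d))).injective
    constructor
    · rintro (h | h)
      · exact Or.inr (hinj (h.trans h2.symm))
      · exact Or.inl (hinj (h.trans h1.symm))
    · rintro (rfl | rfl)
      · exact Or.inr h1
      · exact Or.inl h2)
  refine ⟨g, ?_, ?_⟩
  · rintro w (rfl | hw)
    · exact hg
    · refine hgfix w ?_
      rintro s (rfl | rfl) hs
      · exact hrt (branch_unique hr ht hs hw)
      · exact hrt' (branch_unique hr' ht hs hw)
  · rw [hgC r (by simp) r (self_mem_branch hr), h1]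

/-- The stabilizer of an edge is the product of the stabilizers of the two half-trees that it
bounds. -/
theorem exists_mul_eq_of_isoFix_edge {t : FreeGroup (Fin d)} (ht : t ∈ freeGens d)
    {k : CayleyIso (freeGens d)} (hk : k ∈ isoFix {1, t}) :
    ∃ a ∈ isoFix (insert 1 (branch t)), ∃ b ∈ isoFix (insert t (branch t)ᶜ), k = a * b := by
  have hk1 : k ∈ isoOne (freeGens d) := hk 1 (by simp)
  have hkt : (k : Equiv.Perm _) t = t := hk t (by simp)
  obtain ⟨b, hb, hbC, hbfix⟩ := exists_glue hk1 {t} (by simpa using ht) (by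
    intro s _
    simp only [Set.mem_singleton_iff]
    exact ⟨fun h => (k : Equiv.Perm (FreeGroup (Fin d))).injective (h.trans hkt.symm),
      fun h => h ▸ hkt⟩)
  have hbb : b ∈ isoFix (insert t (branch t)ᶜ) := by
    rintro w (rfl | hw)
    · rw [hbC w rfl w (self_mem_branch ht), hkt]
    · exact hbfix w (by simpa using hw)
  refine ⟨k * b⁻¹, ?_, b, hbb, by simp⟩
  rintro w (rfl | hw)
  · have h1 : (b⁻¹ : CayleyIso (freeGens d)) ∈ isoFix (insert t (branch t)ᶜ) := inv_mem hbb
    have h2 := h1 1 (Or.inr (one_notMem_branch t))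
    change (k : Equiv.Perm _)
      (((b⁻¹ : CayleyIso (freeGens d)) : Equiv.Perm (FreeGroup (Fin d))) 1) = 1
    rw [h2]
    exact hk1
  · obtain ⟨v, rfl⟩ := (b : Equiv.Perm _).surjective w
    have hv : v ∈ branch t := by
      rw [← isoOne_map_branch hb t v, hbb t (by simp)]
      exact hw
    change (k : Equiv.Perm _) ((b : Equiv.Perm _).symm ((b : Equiv.Perm _) v)) = _
    rw [Equiv.symm_apply_apply, hbC t rfl v hv]

end TreeIsometries

/-! ### The non-backtracking Markov operator -/

section NonBacktracking

variable {Y S : Type*} [Fintype S]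

/-- The non-backtracking Markov operator on the functions on the pairs `(c, τ)` of a vertex `c` of
a regular graph and an edge `τ` issuing from it. The permutation `e` sends an edge to the same edge
seen from its other end. The operator averages over the edges at `c` other than `τ`. -/
noncomputable def nonBacktracking (e : Y × S ≃ Y × S) (q : Y × S → ℝ) (v : Y × S) : ℝ :=
  (∑ ρ, q (e (v.1, ρ)) - q (e v)) / (Fintype.card S - 1)

variable (e : Y × S ≃ Y × S)

theorem nonBacktracking_sub_const (hS : 1 < Fintype.card S) (q : Y × S → ℝ) (κ : ℝ) :
    nonBacktracking e (fun v => q v - κ) = fun v => nonBacktracking e q v - κ := by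
  have hS' : (1 : ℝ) < Fintype.card S := by exact_mod_cast hS
  have : (Fintype.card S : ℝ) - 1 ≠ 0 := by linarith
  funext v
  simp only [nonBacktracking, Finset.sum_sub_distrib, Finset.sum_const, Finset.card_univ,
    nsmul_eq_mul]
  field_simp
  ring

theorem nonBacktracking_mul_const (q : Y × S → ℝ) (a : ℝ) :
    nonBacktracking e (fun v => q v * a) = fun v => nonBacktracking e q v * a := by
  funext v
  simp only [nonBacktracking, ← Finset.sum_mul]
  ring

theorem nonBacktracking_iterate_sub_const (hS : 1 < Fintype.card S) (q : Y × S → ℝ) (κ : ℝ)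
    (N : ℕ) : (nonBacktracking e)^[N] (fun v => q v - κ) =
      fun v => (nonBacktracking e)^[N] q v - κ := by
  induction N generalizing q with
  | zero => rfl
  | succ N ih =>
    rw [Function.iterate_succ_apply, nonBacktracking_sub_const e hS, ih,
      Function.iterate_succ_apply]

theorem continuous_nonBacktracking : Continuous (nonBacktracking e) := by
  refine continuous_pi fun v => ?_
  unfold nonBacktracking
  fun_prop

variable [Fintype Y]

theorem sum_nonBacktracking (hS : 1 < Fintype.card S) (q : Y × S → ℝ) :
    ∑ v, nonBacktracking e q v = ∑ v, q v := by
  have hS' : (1 : ℝ) < Fintype.card S := by exact_mod_cast hS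
  have h0 : (Fintype.card S : ℝ) - 1 ≠ 0 := by linarith
  have h1 : ∑ v : Y × S, ∑ ρ, q (e (v.1, ρ)) = Fintype.card S * ∑ v, q v := by
    rw [Fintype.sum_prod_type]
    simp only [Finset.sum_const, Finset.card_univ, nsmul_eq_mul, ← Finset.mul_sum]
    rw [← Fintype.sum_prod_type (fun v : Y × S => q (e v)), Equiv.sum_comp e q]
  simp only [nonBacktracking]
  rw [← Finset.sum_div, Finset.sum_sub_distrib, h1, Equiv.sum_comp e q]
  field_simp

/-- The defect of the energy under the non-backtracking operator is the sum of the variances of the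
function over the edges at a vertex. -/
theorem sum_sq_nonBacktracking (hS : 1 < Fintype.card S) (q : Y × S → ℝ) :
    ∑ v, nonBacktracking e q v ^ 2 = ∑ v, q v ^ 2 -
      (Fintype.card S - 2) / (Fintype.card S - 1) ^ 2 *
        ∑ c, (Fintype.card S * ∑ ρ, q (e (c, ρ)) ^ 2 - (∑ ρ, q (e (c, ρ))) ^ 2) := by
  have hS' : (1 : ℝ) < Fintype.card S := by exact_mod_cast hS
  have h0 : (Fintype.card S : ℝ) - 1 ≠ 0 := by linarith
  rw [← Equiv.sum_comp e (fun v => q v ^ 2), Fintype.sum_prod_type, Fintype.sum_prod_type,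
    Finset.mul_sum, ← Finset.sum_sub_distrib]
  refine Finset.sum_congr rfl fun c _ => ?_
  have h2 : ∀ τ, nonBacktracking e q (c, τ) ^ 2 =
      ((∑ ρ, q (e (c, ρ))) ^ 2 - 2 * (∑ ρ, q (e (c, ρ))) * q (e (c, τ)) + q (e (c, τ)) ^ 2) /
        (Fintype.card S - 1) ^ 2 := fun τ => by
    simp only [nonBacktracking]
    rw [div_pow]
    ring
  simp only [h2]
  rw [← Finset.sum_div, Finset.sum_add_distrib, Finset.sum_sub_distrib, ← Finset.mul_sum,
    Finset.sum_const, Finset.card_univ, nsmul_eq_mul]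
  field_simp
  ring

theorem card_mul_sum_sq_sub_sq_sum (r : S → ℝ) :
    2 * (Fintype.card S * ∑ ρ, r ρ ^ 2 - (∑ ρ, r ρ) ^ 2) = ∑ ρ, ∑ σ, (r ρ - r σ) ^ 2 := by
  simp only [sub_sq, Finset.sum_add_distrib, Finset.sum_sub_distrib, Finset.sum_const,
    Finset.card_univ, nsmul_eq_mul, ← Finset.mul_sum, ← Finset.sum_mul]
  ring

theorem sum_sq_nonBacktracking_le (hS : 2 < Fintype.card S) (q : Y × S → ℝ) :
    ∑ v, nonBacktracking e q v ^ 2 ≤ ∑ v, q v ^ 2 := by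
  have hS' : (2 : ℝ) < Fintype.card S := by exact_mod_cast hS
  rw [sum_sq_nonBacktracking e (by omega)]
  refine sub_le_self _ (mul_nonneg (by have := hS'; apply div_nonneg <;> nlinarith) ?_)
  refine Finset.sum_nonneg fun c _ => ?_
  have h := card_mul_sum_sq_sub_sq_sum fun ρ => q (e (c, ρ))
  have h2 : 0 ≤ ∑ ρ, ∑ σ, (q (e (c, ρ)) - q (e (c, σ))) ^ 2 :=
    Finset.sum_nonneg fun _ _ => Finset.sum_nonneg fun _ _ => sq_nonneg _
  linarith

/-- If the operator preserves the energy of a function, then the function is constant on the edges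
arriving at a given vertex. -/
theorem eq_of_sum_sq_nonBacktracking_eq (hS : 2 < Fintype.card S) {q : Y × S → ℝ}
    (h : ∑ v, nonBacktracking e q v ^ 2 = ∑ v, q v ^ 2) (c : Y) (ρ σ : S) :
    q (e (c, ρ)) = q (e (c, σ)) := by
  have hS' : (2 : ℝ) < Fintype.card S := by exact_mod_cast hS
  rw [sum_sq_nonBacktracking e (by omega)] at h
  have hpos : 0 < ((Fintype.card S : ℝ) - 2) / (Fintype.card S - 1) ^ 2 := by
    apply div_pos
    · linarith
    · have : (0 : ℝ) < Fintype.card S - 1 := by linarith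
      positivity
  have h0 : ∑ c, (Fintype.card S * ∑ ρ, q (e (c, ρ)) ^ 2 - (∑ ρ, q (e (c, ρ))) ^ 2) = 0 := by
    have := sub_eq_self.1 h
    exact (mul_eq_zero.1 this).resolve_left hpos.ne'
  have hn : ∀ c, ∑ ρ, ∑ σ, (q (e (c, ρ)) - q (e (c, σ))) ^ 2 = 0 := by
    intro c
    have hc := (Finset.sum_eq_zero_iff_of_nonneg (fun c _ => by
      have h := card_mul_sum_sq_sub_sq_sum fun ρ => q (e (c, ρ))
      have h2 : 0 ≤ ∑ ρ, ∑ σ, (q (e (c, ρ)) - q (e (c, σ))) ^ 2 :=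
        Finset.sum_nonneg fun _ _ => Finset.sum_nonneg fun _ _ => sq_nonneg _
      linarith)).1 h0 c (Finset.mem_univ c)
    rw [← card_mul_sum_sq_sub_sq_sum fun ρ => q (e (c, ρ)), hc, mul_zero]
  have h1 := (Finset.sum_eq_zero_iff_of_nonneg (fun ρ _ =>
    Finset.sum_nonneg fun σ _ => sq_nonneg _)).1 (hn c) ρ (Finset.mem_univ ρ)
  have h2 := (Finset.sum_eq_zero_iff_of_nonneg (fun σ _ => sq_nonneg _)).1 h1 σ (Finset.mem_univ σ)
  exact sub_eq_zero.1 (pow_eq_zero_iff two_ne_zero |>.1 h2)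

/-- If two steps of the operator preserve the energy of constants only, then they contract the
functions of mean zero, by compactness of the unit sphere. -/
theorem exists_contraction (hS : 2 < Fintype.card S)
    (hconst : ∀ q : Y × S → ℝ, ∑ v, nonBacktracking e (nonBacktracking e q) v ^ 2 = ∑ v, q v ^ 2 →
      ∀ v w, q v = q w) :
    ∃ c : ℝ, 0 ≤ c ∧ c < 1 ∧ ∀ q : Y × S → ℝ, ∑ v, q v = 0 →
      ∑ v, nonBacktracking e (nonBacktracking e q) v ^ 2 ≤ c * ∑ v, q v ^ 2 := by
  let K : Set (Y × S → ℝ) := {q | ∑ v, q v = 0 ∧ ∑ v, q v ^ 2 = 1}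
  have hK : IsCompact K := by
    refine (isCompact_univ_pi fun _ : Y × S =>
      isCompact_Icc (a := (-1 : ℝ)) (b := 1)).of_isClosed_subset ?_ ?_
    · exact (isClosed_eq (by fun_prop) continuous_const).inter
        (isClosed_eq (by fun_prop) continuous_const)
    · rintro q ⟨_, hq⟩ v _
      have : q v ^ 2 ≤ 1 := hq ▸ Finset.single_le_sum (f := fun v => q v ^ 2)
        (fun v _ => sq_nonneg _) (Finset.mem_univ v)
      exact abs_le.1 ((sq_le_one_iff_abs_le_one _).1 this)
  have hscale : ∀ c : ℝ, (∀ q ∈ K, ∑ v, nonBacktracking e (nonBacktracking e q) v ^ 2 ≤ c) →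
      ∀ q : Y × S → ℝ, ∑ v, q v = 0 →
      ∑ v, nonBacktracking e (nonBacktracking e q) v ^ 2 ≤ c * ∑ v, q v ^ 2 := by
    intro c hc q hq
    have hn : 0 ≤ ∑ v, q v ^ 2 := Finset.sum_nonneg fun v _ => sq_nonneg _
    rcases hn.eq_or_lt with h0 | hpos
    · have h1 := sum_sq_nonBacktracking_le e hS q
      have h2 := sum_sq_nonBacktracking_le e hS (nonBacktracking e q)
      rw [← h0] at h1 ⊢
      linarith
    · have hs := Real.sq_sqrt hn
      have hs0 : 0 < √(∑ v, q v ^ 2) := Real.sqrt_pos.2 hpos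
      have h1 := hc (fun v => q v * (√(∑ v, q v ^ 2))⁻¹) ⟨by rw [← Finset.sum_mul, hq, zero_mul], by
        simp only [mul_pow, ← Finset.sum_mul, inv_pow, hs]
        exact mul_inv_cancel₀ hpos.ne'⟩
      simp only [nonBacktracking_mul_const, mul_pow, ← Finset.sum_mul, inv_pow, hs] at h1
      rwa [← div_eq_mul_inv, div_le_iff₀ hpos] at h1
  rcases K.eq_empty_or_nonempty with hE | hne
  · exact ⟨0, le_rfl, one_pos, hscale 0 fun q hq => by simp [hE] at hq⟩
  · have hcont : Continuous fun q : Y × S → ℝ =>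
        ∑ v, nonBacktracking e (nonBacktracking e q) v ^ 2 := by
      have h := (continuous_nonBacktracking e).comp (continuous_nonBacktracking e)
      exact continuous_finsetSum _ fun v _ => ((continuous_apply v).comp h).pow 2
    obtain ⟨q₀, hq₀, hmax⟩ := hK.exists_isMaxOn hne hcont.continuousOn
    refine ⟨_, Finset.sum_nonneg fun v _ => sq_nonneg _, ?_, hscale _ fun q hq => hmax hq⟩
    have hle : ∑ v, nonBacktracking e (nonBacktracking e q₀) v ^ 2 ≤ 1 := by
      have h1 := sum_sq_nonBacktracking_le e hS q₀
      have h2 := sum_sq_nonBacktracking_le e hS (nonBacktracking e q₀)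
      linarith [hq₀.2]
    refine lt_of_le_of_ne hle fun heq => ?_
    have hc := hconst q₀ (heq.trans hq₀.2.symm)
    have h0 : ∀ v, q₀ v = 0 := by
      intro v
      have h1 := hq₀.1
      rw [Finset.sum_congr rfl fun w _ => hc w v, Finset.sum_const, nsmul_eq_mul] at h1
      refine (mul_eq_zero.1 h1).resolve_left ?_
      have : Nonempty (Y × S) := ⟨v⟩
      exact_mod_cast Fintype.card_ne_zero
    have := hq₀.2
    simp [h0] at this

theorem sum_sq_iterate_le (hS : 2 < Fintype.card S) {c : ℝ} (hc0 : 0 ≤ c)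
    (hc : ∀ q : Y × S → ℝ, ∑ v, q v = 0 →
      ∑ v, nonBacktracking e (nonBacktracking e q) v ^ 2 ≤ c * ∑ v, q v ^ 2)
    (N : ℕ) (q : Y × S → ℝ) (hq : ∑ v, q v = 0) :
    ∑ v, (nonBacktracking e)^[N] q v ^ 2 ≤ c ^ (N / 2) * ∑ v, q v ^ 2 := by
  induction N using Nat.strong_induction_on generalizing q with
  | _ N ih =>
    match N with
    | 0 => simp
    | 1 => simpa using sum_sq_nonBacktracking_le e hS q
    | N + 2 =>
      have h0 : ∑ v, nonBacktracking e (nonBacktracking e q) v = 0 := by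
        rw [sum_nonBacktracking e (by omega), sum_nonBacktracking e (by omega), hq]
      have h1 := ih N (by omega) _ h0
      have h2 : (N + 2) / 2 = N / 2 + 1 := by omega
      rw [Function.iterate_succ_apply, Function.iterate_succ_apply, h2, pow_succ, mul_assoc]
      exact h1.trans (mul_le_mul_of_nonneg_left (hc q hq) (pow_nonneg hc0 _))

/-- The iterates of the operator converge to constants, uniformly over the functions with values in
the unit interval. -/
theorem exists_iterate_near_const (hS : 2 < Fintype.card S)
    (hconst : ∀ q : Y × S → ℝ, ∑ v, nonBacktracking e (nonBacktracking e q) v ^ 2 = ∑ v, q v ^ 2 →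
      ∀ v w, q v = q w) {ε : ℝ} (hε : 0 < ε) :
    ∃ N₀ : ℕ, ∀ N ≥ N₀, ∀ q : Y × S → ℝ, (∀ v, 0 ≤ q v ∧ q v ≤ 1) →
      ∃ κ : ℝ, ∀ v, |(nonBacktracking e)^[N] q v - κ| ≤ ε := by
  obtain ⟨c, hc0, hc1, hc⟩ := exists_contraction e hS hconst
  have hlim : Tendsto (fun N : ℕ => c ^ (N / 2) * Fintype.card (Y × S)) atTop (𝓝 0) := by
    have h1 : Tendsto (fun N : ℕ => N / 2) atTop atTop :=
      Nat.tendsto_div_const_atTop two_ne_zero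
    simpa using ((tendsto_pow_atTop_nhds_zero_of_lt_one hc0 hc1).comp h1).mul_const
      (Fintype.card (Y × S) : ℝ)
  obtain ⟨N₀, hN₀⟩ := eventually_atTop.1 (hlim.eventually (gt_mem_nhds (pow_pos hε 2)))
  refine ⟨N₀, fun N hN q hq => ?_⟩
  rcases isEmpty_or_nonempty (Y × S) with hV | hV
  · exact ⟨0, fun v => hV.elim v⟩
  have hcard : (0 : ℝ) < Fintype.card (Y × S) := by exact_mod_cast Fintype.card_pos
  set κ : ℝ := (∑ v, q v) / Fintype.card (Y × S) with hκ
  have hκ0 : 0 ≤ κ := div_nonneg (Finset.sum_nonneg fun v _ => (hq v).1) hcard.le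
  have hκ1 : κ ≤ 1 := by
    rw [hκ, div_le_one hcard]
    calc ∑ v, q v ≤ ∑ _v : Y × S, (1 : ℝ) := Finset.sum_le_sum fun v _ => (hq v).2
      _ = _ := by simp
  have hmean : ∑ v, (q v - κ) = 0 := by
    rw [Finset.sum_sub_distrib, Finset.sum_const, Finset.card_univ, nsmul_eq_mul, hκ]
    field_simp
    ring
  have h1 := sum_sq_iterate_le e hS hc0 hc N _ hmean
  rw [nonBacktracking_iterate_sub_const e (by omega)] at h1
  have h2 : ∑ v, (q v - κ) ^ 2 ≤ Fintype.card (Y × S) := by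
    calc ∑ v, (q v - κ) ^ 2 ≤ ∑ _v : Y × S, (1 : ℝ) := Finset.sum_le_sum fun v _ => by
          rw [sq_le_one_iff_abs_le_one, abs_le]
          constructor <;> linarith [(hq v).1, (hq v).2]
      _ = _ := by simp
  refine ⟨κ, fun v => abs_le_of_sq_le_sq ?_ hε.le⟩
  calc ((nonBacktracking e)^[N] q v - κ) ^ 2
      ≤ ∑ v, ((nonBacktracking e)^[N] q v - κ) ^ 2 :=
        Finset.single_le_sum (f := fun v => ((nonBacktracking e)^[N] q v - κ) ^ 2)
          (fun v _ => sq_nonneg _) (Finset.mem_univ v)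
    _ ≤ _ := h1
    _ ≤ c ^ (N / 2) * Fintype.card (Y × S) := mul_le_mul_of_nonneg_left h2 (pow_nonneg hc0 _)
    _ ≤ ε ^ 2 := (hN₀ N hN).le

end NonBacktracking

section SchreierGraph

variable {d : ℕ}

noncomputable instance instFintypeFreeGens (d : ℕ) : Fintype (freeGens d) :=
  (freeGens_finite d).fintype

theorem two_lt_card_freeGens (hd : 2 ≤ d) : 2 < Fintype.card (freeGens d) := by
  have hinj : Function.Injective fun a : Fin d × Bool =>
      (⟨FreeGroup.mk [a], mk_singleton_mem_freeGens a⟩ : freeGens d) := by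
    intro a b h
    have h' : (FreeGroup.mk [a]).toWord = (FreeGroup.mk [b]).toWord :=
      congrArg (fun s : freeGens d => (s : FreeGroup (Fin d)).toWord) h
    simpa [FreeGroup.toWord_mk, FreeGroup.reduce_singleton] using h'
  have h : Fintype.card (Fin d × Bool) ≤ Fintype.card (freeGens d) :=
    Fintype.card_le_of_injective _ hinj
  simp only [Fintype.card_prod, Fintype.card_fin, Fintype.card_bool] at h
  omega

/-- The reversal of the oriented edges of the Schreier graph of an action of the free group: the
edge from `c` to `ρ⁻¹ c`, seen from its other end. -/
def edgeReversal {Y : Type*} [MulAction (FreeGroup (Fin d)) Y] :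
    Y × freeGens d ≃ Y × freeGens d :=
  Function.Involutive.toPerm
    (fun v => ((v.2 : FreeGroup (Fin d))⁻¹ • v.1, ⟨_, inv_mem_freeGens v.2.2⟩)) (fun v => by simp)

theorem edgeReversal_apply {Y : Type*} [MulAction (FreeGroup (Fin d)) Y] (c : Y)
    (ρ : freeGens d) : edgeReversal (c, ρ) =
      ((ρ : FreeGroup (Fin d))⁻¹ • c, ⟨(ρ : FreeGroup (Fin d))⁻¹, inv_mem_freeGens ρ.2⟩) := rfl

/-- On a connected Schreier graph that is not bipartite, two steps of the non-backtracking operator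
preserve the energy of constants only. -/
theorem const_of_sum_sq_eq (hd : 2 ≤ d) {Λ : Subgroup (FreeGroup (Fin d))}
    [Fintype (FreeGroup (Fin d) ⧸ Λ)] (hΛ : ¬ Λ ≤ evenSubgroup d)
    (q : (FreeGroup (Fin d) ⧸ Λ) × freeGens d → ℝ)
    (hq : ∑ v, nonBacktracking edgeReversal (nonBacktracking edgeReversal q) v ^ 2 =
      ∑ v, q v ^ 2) (v w) : q v = q w := by
  have hS := two_lt_card_freeGens hd
  have hle1 := sum_sq_nonBacktracking_le edgeReversal hS q
  have hle2 := sum_sq_nonBacktracking_le edgeReversal hS (nonBacktracking edgeReversal q)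
  have h1 := eq_of_sum_sq_nonBacktracking_eq edgeReversal hS (q := q) (by linarith)
  have h2 := eq_of_sum_sq_nonBacktracking_eq edgeReversal hS
    (q := nonBacktracking edgeReversal q) (by linarith)
  have hne : Nonempty (freeGens d) := ⟨v.2⟩
  let s₀ : freeGens d := v.2
  -- `κ` and `κ'` are the values of `q` and of its image on the edges arriving at a vertex.
  let κ : FreeGroup (Fin d) ⧸ Λ → ℝ := fun c => q (edgeReversal (c, s₀))
  have hκ : ∀ c ρ, q (edgeReversal (c, ρ)) = κ c := fun c ρ => h1 c ρ s₀
  have hS' : (2 : ℝ) < Fintype.card (freeGens d) := by exact_mod_cast hS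
  have hP : ∀ c τ, nonBacktracking edgeReversal q (c, τ) = κ c := by
    intro c τ
    have h0 : (Fintype.card (freeGens d) : ℝ) - 1 ≠ 0 := by linarith
    simp only [nonBacktracking, hκ, Finset.sum_const, Finset.card_univ, nsmul_eq_mul]
    field_simp
  let κ' : FreeGroup (Fin d) ⧸ Λ → ℝ := fun c => κ ((s₀ : FreeGroup (Fin d))⁻¹ • c)
  have hκ' : ∀ c, ∀ s ∈ freeGens d, κ (s • c) = κ' c := by
    intro c s hs
    have h3 := h2 c ⟨s⁻¹, inv_mem_freeGens hs⟩ s₀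
    simpa only [edgeReversal_apply, hP, inv_inv] using h3
  have hκκ : ∀ c, ∀ s ∈ freeGens d, κ' (s • c) = κ c := by
    intro c s hs
    rw [← hκ' (s • c) s⁻¹ (inv_mem_freeGens hs), inv_smul_smul]
  have hword : ∀ (l : List (FreeGroup (Fin d))), (∀ s ∈ l, s ∈ freeGens d) → ∀ c,
      (Even l.length → κ (l.prod • c) = κ c ∧ κ' (l.prod • c) = κ' c) ∧
      (¬ Even l.length → κ (l.prod • c) = κ' c ∧ κ' (l.prod • c) = κ c) := by
    intro l
    induction l with
    | nil => intro _ c; simp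
    | cons a l ih =>
      intro hl c
      have ha := hl a (by simp)
      obtain ⟨i1, i2⟩ := ih (fun s hs => hl s (by simp [hs])) c
      rw [List.prod_cons, mul_smul, hκ' _ a ha, hκκ _ a ha, List.length_cons, Nat.even_add_one]
      exact ⟨fun h => ⟨(i2 h).2, (i2 h).1⟩, fun h => ⟨(i1 (not_not.1 h)).2, (i1 (not_not.1 h)).1⟩⟩
  obtain ⟨g, hgΛ, hg⟩ := Set.not_subset.1 hΛ
  let c₀ : FreeGroup (Fin d) ⧸ Λ := ((1 : FreeGroup (Fin d)) : FreeGroup (Fin d) ⧸ Λ)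
  have hgc : g • c₀ = c₀ := by
    change ((g * 1 : FreeGroup (Fin d)) : FreeGroup (Fin d) ⧸ Λ) = _
    rw [QuotientGroup.eq]
    simpa using hgΛ
  have hodd : κ' c₀ = κ c₀ := by
    obtain ⟨l, hl, hS, rfl⟩ := exists_list_wordLength g
    have hne : ¬ Even l.length := by rw [hl]; exact hg
    have := ((hword l hS c₀).2 hne).1
    rw [hgc] at this
    exact this.symm
  have hall : ∀ c, κ c = κ c₀ := by
    intro c
    obtain ⟨h, rfl⟩ := QuotientGroup.mk_surjective c
    obtain ⟨l, hl, hS⟩ := freeGens_generate d h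
    have hc : ((h : FreeGroup (Fin d)) : FreeGroup (Fin d) ⧸ Λ) = l.prod • c₀ := by
      rw [hS]
      change _ = ((h * 1 : FreeGroup (Fin d)) : FreeGroup (Fin d) ⧸ Λ)
      rw [mul_one]
    rw [hc]
    by_cases he : Even l.length
    · exact ((hword l hl c₀).1 he).1
    · rw [((hword l hl c₀).2 he).1, hodd]
  have hq0 : ∀ v, q v = κ c₀ := by
    intro v
    obtain ⟨⟨c, ρ⟩, rfl⟩ := (edgeReversal (Y := FreeGroup (Fin d) ⧸ Λ)).surjective v
    rw [hκ, hall]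
  rw [hq0, hq0]

end SchreierGraph

/-! ### Topology and Haar measure of the isometry group -/

section IsoTopology

variable {Γ : Type*} [Group Γ] (S : Set Γ)

theorem cayleyIso_isOpen_mem (γ : Γ) (A : Set Γ) :
    IsOpen {f : CayleyIso S | (f : Equiv.Perm Γ) γ ∈ A} := by
  have : {f : CayleyIso S | (f : Equiv.Perm Γ) γ ∈ A} =
      ⋃ δ ∈ A, {f : CayleyIso S | (f : Equiv.Perm Γ) γ = δ} := by
    ext f; simp
  rw [this]
  exact isOpen_biUnion fun δ _ => cayleyIso_isOpen S γ δ

/-- A map that depends continuously on `f` once the value `f γ` is fixed is continuous. -/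
theorem continuous_of_continuous_eval {X : Type*} [TopologicalSpace X] (γ : Γ)
    (F : Γ → CayleyIso S → X) (hF : ∀ δ, Continuous (F δ)) :
    Continuous fun f : CayleyIso S => F ((f : Equiv.Perm Γ) γ) f := by
  refine continuous_iff_continuousAt.2 fun f => ?_
  have hev : F ((f : Equiv.Perm Γ) γ) =ᶠ[𝓝 f] fun g => F ((g : Equiv.Perm Γ) γ) g := by
    filter_upwards [(cayleyIso_isOpen S γ ((f : Equiv.Perm Γ) γ)).mem_nhds rfl] with g hg
    have hg' : (g : Equiv.Perm Γ) γ = (f : Equiv.Perm Γ) γ := hg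
    rw [hg']
  exact (hF _).continuousAt.congr hev

theorem cayleyIso_topology_eq_generateFrom : instTopologicalSpaceCayleyIso S =
    TopologicalSpace.generateFrom
      {U | ∃ γ δ : Γ, U = {f : CayleyIso S | (f : Equiv.Perm Γ) γ = δ}} := by
  apply le_antisymm
  · refine le_generateFrom ?_
    rintro _ ⟨γ, δ, rfl⟩
    exact cayleyIso_isOpen S γ δ
  · have h := (@cayleyIso_continuous_iff Γ _ S (CayleyIso S) (TopologicalSpace.generateFrom
      {U | ∃ γ δ : Γ, U = {f : CayleyIso S | (f : Equiv.Perm Γ) γ = δ}}) id).2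
      fun γ δ => TopologicalSpace.isOpen_generateFrom_of_mem ⟨γ, δ, rfl⟩
    exact continuous_id_iff_le.1 h

instance instSecondCountableCayleyIso [Countable Γ] :
    SecondCountableTopology (CayleyIso S) := by
  refine ⟨⟨{U | ∃ γ δ : Γ, U = {f : CayleyIso S | (f : Equiv.Perm Γ) γ = δ}}, ?_,
    cayleyIso_topology_eq_generateFrom S⟩⟩
  have : {U | ∃ γ δ : Γ, U = {f : CayleyIso S | (f : Equiv.Perm Γ) γ = δ}} =
      Set.range fun p : Γ × Γ => {f : CayleyIso S | (f : Equiv.Perm Γ) p.1 = p.2} := by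
    ext U
    simp [eq_comm]
  rw [this]
  exact Set.countable_range _

theorem cayleyIso_measurableSpace_eq [Countable Γ] :
    instMeasurableSpaceCayleyIso S = MeasurableSpace.generateFrom
      {U | ∃ γ δ : Γ, U = {f : CayleyIso S | (f : Equiv.Perm Γ) γ = δ}} :=
  borel_eq_generateFrom_of_subbasis (cayleyIso_topology_eq_generateFrom S)

instance instPolishCayleyIso [Countable Γ] : PolishSpace (CayleyIso S) := by
  let _ : TopologicalSpace Γ := ⊥
  have : DiscreteTopology Γ := ⟨rfl⟩
  have : TopologicalSpace.IsCompletelyMetrizableSpace Γ := by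
    let _ : UniformSpace Γ := ⊥
    infer_instance
  have : SecondCountableTopology ((Γ → Γ) × (Γ → Γ)) := inferInstance
  have : TopologicalSpace.IsCompletelyMetrizableSpace ((Γ → Γ) × (Γ → Γ)) := inferInstance
  have : PolishSpace ((Γ → Γ) × (Γ → Γ)) := ⟨⟩
  let e : CayleyIso S → (Γ → Γ) × (Γ → Γ) :=
    fun f => (fun γ => (f : Equiv.Perm Γ) γ, fun γ => (f : Equiv.Perm Γ).symm γ)
  have he1 : Continuous fun (f : CayleyIso S) (γ : Γ) => (f : Equiv.Perm Γ) γ :=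
    continuous_induced_dom
  have he2 : Continuous fun (f : CayleyIso S) (γ : Γ) => (f : Equiv.Perm Γ).symm γ :=
    he1.comp (continuous_inv (G := CayleyIso S))
  have hind : IsInducing e :=
    IsInducing.of_comp (g := Prod.fst) (he1.prodMk he2) continuous_fst ⟨rfl⟩
  have hinj : Function.Injective e := fun f g h => by
    refine Subtype.ext (Equiv.ext fun γ => ?_)
    exact congrFun (congrArg Prod.fst h) γ
  have happ : Continuous fun q : (Γ → Γ) × Γ => q.1 q.2 := by
    rw [continuous_discrete_rng]
    intro b
    have h : ((fun q : (Γ → Γ) × Γ => q.1 q.2) ⁻¹' {b}) =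
        ⋃ c : Γ, {g : Γ → Γ | g c = b} ×ˢ {c} := by
      ext q; simp
    rw [h]
    refine isOpen_iUnion fun c => IsOpen.prod ?_ (isOpen_discrete _)
    exact (isOpen_discrete ({b} : Set Γ)).preimage (f := fun g : Γ → Γ => g c) (continuous_apply c)
  have hc1 : ∀ γ : Γ, Continuous fun p : (Γ → Γ) × (Γ → Γ) => p.1 γ :=
    fun γ => (continuous_apply γ).comp continuous_fst
  have hc2 : ∀ γ : Γ, Continuous fun p : (Γ → Γ) × (Γ → Γ) => p.2 γ :=
    fun γ => (continuous_apply γ).comp continuous_snd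
  have hran : Set.range e = (⋂ γ : Γ, {p : (Γ → Γ) × (Γ → Γ) | p.1 (p.2 γ) = γ}) ∩
      ((⋂ γ : Γ, {p : (Γ → Γ) × (Γ → Γ) | p.2 (p.1 γ) = γ}) ∩
      ⋂ γ : Γ, ⋂ δ : Γ, {p : (Γ → Γ) × (Γ → Γ) |
        wordLength S ((p.1 γ)⁻¹ * p.1 δ) = wordLength S (γ⁻¹ * δ)}) := by
    ext p
    simp only [Set.mem_inter_iff, Set.mem_iInter, Set.mem_ofPred_eq]
    constructor
    · rintro ⟨f, rfl⟩
      exact ⟨fun γ => by simp [e], fun γ => by simp [e], f.2⟩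
    · rintro ⟨h2, h3, h4⟩
      exact ⟨⟨⟨p.1, p.2, h3, h2⟩, h4⟩, rfl⟩
  have hclosed : IsClosed (Set.range e) := by
    rw [hran]
    refine IsClosed.inter (isClosed_iInter fun γ => ?_) (IsClosed.inter
      (isClosed_iInter fun γ => ?_) (isClosed_iInter fun γ => isClosed_iInter fun δ => ?_))
    · exact isClosed_eq (happ.comp (continuous_fst.prodMk (hc2 γ))) continuous_const
    · exact isClosed_eq (happ.comp (continuous_snd.prodMk (hc1 γ))) continuous_const
    · have hd : Continuous fun q : Γ × Γ => wordLength S (q.1⁻¹ * q.2) :=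
        continuous_of_discreteTopology
      exact isClosed_eq (hd.comp ((hc1 γ).prodMk (hc1 δ))) continuous_const
  exact (⟨⟨hind, hinj⟩, hclosed⟩ : IsClosedEmbedding e).polishSpace

theorem leftMulIso_mul_apply (γ : Γ) (f : CayleyIso S) (δ : Γ) :
    ((leftMulIso S γ * f : CayleyIso S) : Equiv.Perm Γ) δ = γ * (f : Equiv.Perm Γ) δ := rfl

theorem leftMulIso_injective : Function.Injective (leftMulIso S) := by
  intro a b h
  have := congrArg (fun f : CayleyIso S => (f : Equiv.Perm Γ) 1) h
  simpa [leftMulIso] using this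

end IsoTopology

section Haar

variable {d : ℕ}

local notation "𝔽" => FreeGroup (Fin d)
local notation "𝔾" => CayleyIso (freeGens d)
local notation "λₗ" => leftMulIso (freeGens d)

instance instIsMulLeftInvariantHaarIso : (haarIso d).IsMulLeftInvariant := by
  unfold haarIso; infer_instance

instance instSigmaFiniteHaarIso : SigmaFinite (haarIso d) := by
  unfold haarIso; infer_instance

theorem haarIso_isoOne : haarIso d {f | (f : Equiv.Perm 𝔽) 1 = 1} = 1 :=
  Measure.haarMeasure_self

instance instCountableMap (Λ : Subgroup 𝔽) : Countable (Λ.map λₗ) :=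
  (Set.countable_range λₗ).mono (Set.image_subset_range _ _) |>.to_subtype

/-- A criterion for fundamental domains of the postcomposition action of a subgroup of the free
group. -/
theorem isFundamentalDomain_of_existsUnique (Λ : Subgroup 𝔽) {A : Set 𝔾} (hA : MeasurableSet A)
    (hex : ∀ f : 𝔾, ∃! g : 𝔽, g ∈ Λ ∧ λₗ g * f ∈ A) :
    IsFundamentalDomain (Λ.map λₗ) A (haarIso d) := by
  refine IsFundamentalDomain.mk' hA.nullMeasurableSet fun f => ?_
  obtain ⟨g, ⟨hgΛ, hgA⟩, hu⟩ := hex f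
  refine ⟨⟨λₗ g, g, hgΛ, rfl⟩, hgA, ?_⟩
  rintro ⟨_, g', hg'Λ, rfl⟩ hg'
  exact Subtype.ext (congrArg λₗ (hu g' ⟨hg'Λ, hg'⟩))

theorem isFundamentalDomain_eval_eq (γ δ : 𝔽) :
    IsFundamentalDomain ((⊤ : Subgroup 𝔽).map λₗ) {f : 𝔾 | (f : Equiv.Perm 𝔽) γ = δ}
      (haarIso d) := by
  refine isFundamentalDomain_of_existsUnique ⊤ (cayleyIso_isOpen _ γ δ).measurableSet fun f => ?_
  refine ⟨δ * ((f : Equiv.Perm 𝔽) γ)⁻¹, ⟨trivial, ?_⟩, ?_⟩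
  · change δ * ((f : Equiv.Perm 𝔽) γ)⁻¹ * (f : Equiv.Perm 𝔽) γ = δ
    simp
  · rintro g ⟨-, hg⟩
    have hg' : g * (f : Equiv.Perm 𝔽) γ = δ := hg
    rw [← hg', mul_inv_cancel_right]

theorem haarIso_eval_eq (γ δ : 𝔽) : haarIso d {f | (f : Equiv.Perm 𝔽) γ = δ} = 1 := by
  rw [(isFundamentalDomain_eval_eq γ δ).measure_eq (isFundamentalDomain_eval_eq 1 1),
    haarIso_isoOne]

theorem eq_haarIso (μ : Measure 𝔾) [SigmaFinite μ] [μ.IsMulLeftInvariant]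
    (h : μ {f | (f : Equiv.Perm 𝔽) 1 = 1} = 1) : μ = haarIso d := by
  have h1 := Measure.haarMeasure_unique μ (isoOneFree d)
  have h2 : μ (isoOneFree d : Set 𝔾) = 1 := h
  rw [h2, one_smul] at h1
  exact h1

/-- The isometry group is unimodular, because the free group is a lattice in it: the translates of
the stabilizer of the identity are fundamental domains of the same action, so that they have the
same measure. -/
instance instIsMulRightInvariantHaarIso : (haarIso d).IsMulRightInvariant := by
  refine ⟨fun g => ?_⟩
  have : SigmaFinite ((haarIso d).map (· * g)) :=
    (MeasurableEquiv.mulRight g).sigmaFinite_map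
  refine eq_haarIso _ ?_
  rw [Measure.map_apply (measurable_mul_const g) (cayleyIso_isOpen _ 1 1).measurableSet]
  exact haarIso_eval_eq ((g : Equiv.Perm 𝔽) 1) 1

instance instIsInvInvariantHaarIso : (haarIso d).IsInvInvariant := by
  refine ⟨?_⟩
  have : SigmaFinite (haarIso d).inv := (MeasurableEquiv.inv 𝔾).sigmaFinite_map
  refine eq_haarIso _ ?_
  rw [Measure.inv_apply]
  have : ({f : 𝔾 | (f : Equiv.Perm 𝔽) 1 = 1})⁻¹ = {f : 𝔾 | (f : Equiv.Perm 𝔽) 1 = 1} := by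
    ext f
    change (f : Equiv.Perm 𝔽).symm 1 = 1 ↔ (f : Equiv.Perm 𝔽) 1 = 1
    rw [Equiv.symm_apply_eq]
    exact eq_comm
  rw [this, haarIso_isoOne]

end Haar

/-! ### The quotient space and its Haar probability measure -/

section Quotient

variable {d : ℕ}

local notation "𝔽" => FreeGroup (Fin d)
local notation "𝔾" => CayleyIso (freeGens d)
local notation "λₗ" => leftMulIso (freeGens d)

variable (Λ : Subgroup (FreeGroup (Fin d)))

theorem isoQuot_mk_surjective : Function.Surjective (IsoQuot.mk (freeGens d) Λ) :=
  Quotient.mk_surjective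

theorem isoQuot_mk_eq_iff {f g : 𝔾} :
    IsoQuot.mk (freeGens d) Λ f = IsoQuot.mk (freeGens d) Λ g ↔ ∃ γ ∈ Λ, g = λₗ γ * f := by
  refine Quotient.eq.trans ?_
  rw [QuotientGroup.rightRel_apply, Subgroup.mem_map]
  refine exists_congr fun γ => and_congr_right fun _ => ?_
  rw [eq_mul_inv_iff_mul_eq, eq_comm]

theorem isoQuot_mk_leftMul {γ : 𝔽} (hγ : γ ∈ Λ) (f : 𝔾) :
    IsoQuot.mk (freeGens d) Λ (λₗ γ * f) = IsoQuot.mk (freeGens d) Λ f :=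
  ((isoQuot_mk_eq_iff Λ).2 ⟨γ, hγ, rfl⟩).symm

theorem isoQuot_smul_mk (g f : 𝔾) :
    g • IsoQuot.mk (freeGens d) Λ f = IsoQuot.mk (freeGens d) Λ (f * g⁻¹) := rfl

theorem isoQuot_free_smul (γ : 𝔽) (x : IsoQuot (freeGens d) Λ) : γ • x = λₗ γ • x := rfl

theorem measurable_isoQuot_mk : Measurable (IsoQuot.mk (freeGens d) Λ) :=
  fun _ h => h

theorem measurable_isoQuot_iff {Z : Type*} [MeasurableSpace Z] {φ : IsoQuot (freeGens d) Λ → Z} :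
    Measurable φ ↔ Measurable fun f => φ (IsoQuot.mk (freeGens d) Λ f) := Iff.rfl

theorem measurable_isoQuot_smul (g : 𝔾) : Measurable fun x : IsoQuot (freeGens d) Λ => g • x := by
  rw [measurable_isoQuot_iff]
  exact (measurable_isoQuot_mk Λ).comp (measurable_mul_const g⁻¹)

theorem measurableSet_isoQuot_smul (g : 𝔾) {E : Set (IsoQuot (freeGens d) Λ)}
    (hE : MeasurableSet E) : MeasurableSet ((fun x => g • x) ⁻¹' E) :=
  measurable_isoQuot_smul Λ g hE

/-- The representative of the coset `Λ γ` chosen by the fundamental domain. -/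
noncomputable def cosetRep (γ : 𝔽) : 𝔽 := (Quotient.mk (QuotientGroup.rightRel Λ) γ).out

theorem cosetRep_mul_inv_mem (γ : 𝔽) : cosetRep Λ γ * γ⁻¹ ∈ Λ := by
  have h : QuotientGroup.rightRel Λ γ (cosetRep Λ γ) :=
    Quotient.exact (Quotient.out_eq (Quotient.mk (QuotientGroup.rightRel Λ) γ)).symm
  exact QuotientGroup.rightRel_apply.1 h

theorem cosetRep_mul {g : 𝔽} (hg : g ∈ Λ) (γ : 𝔽) : cosetRep Λ (g * γ) = cosetRep Λ γ := by
  unfold cosetRep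
  congr 1
  refine Quotient.sound ?_
  change QuotientGroup.rightRel Λ _ _
  rw [QuotientGroup.rightRel_apply]
  simpa using inv_mem hg

theorem mem_isoFundamentalDomain {f : 𝔾} : f ∈ isoFundamentalDomain (freeGens d) Λ ↔
    cosetRep Λ ((f : Equiv.Perm 𝔽) 1) = (f : Equiv.Perm 𝔽) 1 := by
  constructor
  · rintro ⟨c, hc⟩
    rw [← hc, cosetRep, Quotient.out_eq]
  · intro h
    exact ⟨_, h⟩

theorem measurableSet_isoFundamentalDomain :
    MeasurableSet (isoFundamentalDomain (freeGens d) Λ) :=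
  (cayleyIso_isOpen_mem _ 1 _).measurableSet

theorem isFundamentalDomain_isoFundamentalDomain :
    IsFundamentalDomain (Λ.map λₗ) (isoFundamentalDomain (freeGens d) Λ) (haarIso d) := by
  refine isFundamentalDomain_of_existsUnique Λ (measurableSet_isoFundamentalDomain Λ) fun f => ?_
  refine ⟨cosetRep Λ ((f : Equiv.Perm 𝔽) 1) * ((f : Equiv.Perm 𝔽) 1)⁻¹,
    ⟨cosetRep_mul_inv_mem Λ _, ?_⟩, ?_⟩
  · rw [mem_isoFundamentalDomain, leftMulIso_mul_apply, cosetRep_mul Λ (cosetRep_mul_inv_mem Λ _),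
      inv_mul_cancel_right]
  · rintro g ⟨hg, hgA⟩
    rw [mem_isoFundamentalDomain, leftMulIso_mul_apply, cosetRep_mul Λ hg] at hgA
    rw [hgA, mul_inv_cancel_right]

/-- The section of the quotient map with values in the fundamental domain. -/
noncomputable def isoSection : IsoQuot (freeGens d) Λ → 𝔾 :=
  Quotient.lift (fun f : 𝔾 =>
    λₗ (cosetRep Λ ((f : Equiv.Perm 𝔽) 1) * ((f : Equiv.Perm 𝔽) 1)⁻¹) * f) (by
      intro f g h
      obtain ⟨γ, hγ, rfl⟩ := (isoQuot_mk_eq_iff Λ).1 (Quotient.sound h)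
      simp only [leftMulIso_mul_apply, cosetRep_mul Λ hγ]
      rw [← mul_assoc, ← map_mul]
      simp [mul_assoc])

theorem isoSection_mk (f : 𝔾) : isoSection Λ (IsoQuot.mk (freeGens d) Λ f) =
    λₗ (cosetRep Λ ((f : Equiv.Perm 𝔽) 1) * ((f : Equiv.Perm 𝔽) 1)⁻¹) * f := rfl

theorem mk_isoSection (x : IsoQuot (freeGens d) Λ) :
    IsoQuot.mk (freeGens d) Λ (isoSection Λ x) = x := by
  obtain ⟨f, rfl⟩ := isoQuot_mk_surjective Λ x
  rw [isoSection_mk, isoQuot_mk_leftMul Λ (cosetRep_mul_inv_mem Λ _)]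

theorem isoSection_mk_of_mem {f : 𝔾} (hf : f ∈ isoFundamentalDomain (freeGens d) Λ) :
    isoSection Λ (IsoQuot.mk (freeGens d) Λ f) = f := by
  rw [isoSection_mk, (mem_isoFundamentalDomain Λ).1 hf, mul_inv_cancel, map_one, one_mul]

theorem isoSection_mem (x : IsoQuot (freeGens d) Λ) :
    isoSection Λ x ∈ isoFundamentalDomain (freeGens d) Λ := by
  obtain ⟨f, rfl⟩ := isoQuot_mk_surjective Λ x
  rw [isoSection_mk, mem_isoFundamentalDomain, leftMulIso_mul_apply,
    cosetRep_mul Λ (cosetRep_mul_inv_mem Λ _), inv_mul_cancel_right]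

theorem isoSection_smul {k : 𝔾} (hk : k ∈ isoOne (freeGens d)) (x : IsoQuot (freeGens d) Λ) :
    isoSection Λ (k • x) = isoSection Λ x * k⁻¹ := by
  obtain ⟨f, rfl⟩ := isoQuot_mk_surjective Λ x
  have h1 : (((k⁻¹ : 𝔾) : Equiv.Perm 𝔽)) 1 = 1 := by
    change (k : Equiv.Perm 𝔽).symm 1 = 1
    rw [Equiv.symm_apply_eq]
    exact (show (k : Equiv.Perm 𝔽) 1 = 1 from hk).symm
  have h2 : ((f * k⁻¹ : 𝔾) : Equiv.Perm 𝔽) 1 = (f : Equiv.Perm 𝔽) 1 := by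
    change (f : Equiv.Perm 𝔽) (((k⁻¹ : 𝔾) : Equiv.Perm 𝔽) 1) = _
    rw [h1]
  rw [isoQuot_smul_mk, isoSection_mk, isoSection_mk, h2, mul_assoc]

theorem measurable_isoSection : Measurable (isoSection Λ) := by
  rw [measurable_isoQuot_iff]
  exact (continuous_of_continuous_eval _ 1
    (fun δ f => λₗ (cosetRep Λ δ * δ⁻¹) * f) fun δ => continuous_const_mul _).measurable

theorem isoQuot_measurableSpace_eq_comap : instMeasurableSpaceIsoQuot (freeGens d) Λ =
    (instMeasurableSpaceCayleyIso (freeGens d)).comap (isoSection Λ) := by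
  refine le_antisymm (fun E hE => ⟨IsoQuot.mk (freeGens d) Λ ⁻¹' E, hE, ?_⟩)
    (measurable_isoSection Λ).comap_le
  ext x
  simp [mk_isoSection]

/-- The quotient is standard, because the section identifies it with a clopen subset of the Polish
space of isometries. -/
instance instStandardBorelIsoQuot : StandardBorelSpace (IsoQuot (freeGens d) Λ) := by
  let τ : TopologicalSpace (IsoQuot (freeGens d) Λ) :=
    (instTopologicalSpaceCayleyIso (freeGens d)).induced (isoSection Λ)
  have hran : Set.range (isoSection Λ) = isoFundamentalDomain (freeGens d) Λ := by
    ext f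
    exact ⟨by rintro ⟨x, rfl⟩; exact isoSection_mem Λ x,
      fun hf => ⟨_, isoSection_mk_of_mem Λ hf⟩⟩
  have hclosed : IsClosed (Set.range (isoSection Λ)) := by
    rw [hran, ← isOpen_compl_iff]
    exact cayleyIso_isOpen_mem _ 1 (Set.range Quotient.out)ᶜ
  have hemb : IsClosedEmbedding (isoSection Λ) :=
    ⟨⟨⟨rfl⟩, Function.LeftInverse.injective (mk_isoSection Λ)⟩, hclosed⟩
  have : BorelSpace (IsoQuot (freeGens d) Λ) := by
    refine ⟨?_⟩
    rw [isoQuot_measurableSpace_eq_comap]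
    exact borel_comap.symm
  exact ⟨τ, this, hemb.polishSpace⟩

/-- The measurable structure of the quotient is generated by the sets that are invariant under the
stabilizer of a ball. -/
theorem isoQuot_measurableSpace_eq : instMeasurableSpaceIsoQuot (freeGens d) Λ =
    MeasurableSpace.generateFrom {A | MeasurableSet A ∧ ∃ n : ℕ, ∀ k ∈ isoFix {w : 𝔽 | ℓ w ≤ n},
      ∀ x ∈ A, k • x ∈ A} := by
  apply le_antisymm
  · have h := isoQuot_measurableSpace_eq_comap Λ
    rw [cayleyIso_measurableSpace_eq, MeasurableSpace.comap_generateFrom] at h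
    refine h.le.trans (MeasurableSpace.generateFrom_mono ?_)
    rintro _ ⟨_, ⟨γ, δ, rfl⟩, rfl⟩
    refine ⟨measurable_isoSection Λ (cayleyIso_isOpen _ γ δ).measurableSet, ℓ γ, ?_⟩
    intro k hk x hx
    have hk1 : k ∈ isoOne (freeGens d) := hk 1 (by simp [wordLength_one])
    have hkγ := (inv_mem hk : k⁻¹ ∈ isoFix {w : 𝔽 | ℓ w ≤ ℓ γ}) γ (le_refl (ℓ γ))
    have hx' : (isoSection Λ x : Equiv.Perm 𝔽) γ = δ := hx
    change (isoSection Λ (k • x) : Equiv.Perm 𝔽) γ = δ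
    rw [isoSection_smul Λ hk1]
    change (isoSection Λ x : Equiv.Perm 𝔽) (((k⁻¹ : 𝔾) : Equiv.Perm 𝔽) γ) = δ
    rw [hkγ, hx']
  · exact MeasurableSpace.generateFrom_le fun A hA => hA.1

theorem disjoint_eval_eq {γ δ δ' : 𝔽} (h : δ ≠ δ') :
    Disjoint {f : 𝔾 | (f : Equiv.Perm 𝔽) γ = δ} {f : 𝔾 | (f : Equiv.Perm 𝔽) γ = δ'} :=
  Set.disjoint_left.2 fun _ hf hf' => h (hf.symm.trans hf')

/-- The Haar measure restricted to the fundamental domain is a sum of copies of the Haar measure of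
the stabilizer of the identity. -/
theorem haarIso_inter_isoFundamentalDomain [Fintype (Quotient (QuotientGroup.rightRel Λ))]
    {E : Set 𝔾} (hE : MeasurableSet E) :
    haarIso d (isoFundamentalDomain (freeGens d) Λ ∩ E) =
      ∑ c : Quotient (QuotientGroup.rightRel Λ),
        haarIso d ({f | (f : Equiv.Perm 𝔽) 1 = 1} ∩ {f | λₗ c.out * f ∈ E}) := by
  have h1 : isoFundamentalDomain (freeGens d) Λ ∩ E =
      ⋃ c : Quotient (QuotientGroup.rightRel Λ), {f : 𝔾 | (f : Equiv.Perm 𝔽) 1 = c.out} ∩ E := by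
    ext f
    simp only [isoFundamentalDomain, Set.mem_inter_iff, Set.mem_iUnion, Set.mem_ofPred_eq,
      Set.mem_range, exists_and_right]
    simp only [eq_comm]
  have hinj : Function.Injective (Quotient.out : Quotient (QuotientGroup.rightRel Λ) → 𝔽) :=
    Quotient.out_injective
  rw [h1, measure_iUnion (fun c c' hc =>
    (disjoint_eval_eq (hinj.ne hc)).mono Set.inter_subset_left Set.inter_subset_left)
    (fun c => (cayleyIso_isOpen _ _ _).measurableSet.inter hE), tsum_fintype]
  refine Finset.sum_congr rfl fun c _ => ?_
  rw [← measure_preimage_mul (haarIso d) (λₗ c.out)]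
  congr 1
  ext f
  simp only [Set.mem_preimage, Set.mem_inter_iff, Set.mem_ofPred_eq, leftMulIso_mul_apply,
    mul_eq_left]

variable [Λ.FiniteIndex]

instance instFiniteRightCosets : Finite (Quotient (QuotientGroup.rightRel Λ)) :=
  Finite.of_equiv _ (QuotientGroup.quotientRightRelEquivQuotientLeftRel Λ).symm

theorem haarIso_isoFundamentalDomain :
    haarIso d (isoFundamentalDomain (freeGens d) Λ) = Λ.index := by
  classical
  have := Fintype.ofFinite (Quotient (QuotientGroup.rightRel Λ))
  have h := haarIso_inter_isoFundamentalDomain Λ MeasurableSet.univ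
  simp only [Set.inter_univ, Set.mem_univ, Set.ofPred_true, haarIso_isoOne, Finset.sum_const,
    Finset.card_univ, nsmul_eq_mul, mul_one] at h
  rw [h, Subgroup.index, ← Nat.card_congr (QuotientGroup.quotientRightRelEquivQuotientLeftRel Λ),
    Nat.card_eq_fintype_card]

theorem haarQuot_apply {E : Set (IsoQuot (freeGens d) Λ)} (hE : MeasurableSet E) :
    haarQuot d Λ E = (Λ.index : ℝ≥0∞)⁻¹ * haarIso d (isoFundamentalDomain (freeGens d) Λ ∩
      IsoQuot.mk (freeGens d) Λ ⁻¹' E) := by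
  rw [haarQuot, Measure.map_apply (measurable_isoQuot_mk Λ) hE,
    cond_apply (measurableSet_isoFundamentalDomain Λ), haarIso_isoFundamentalDomain]

instance instIsProbabilityMeasureHaarQuot : IsProbabilityMeasure (haarQuot d Λ) := by
  have : IsProbabilityMeasure
      (ProbabilityTheory.cond (haarIso d) (isoFundamentalDomain (freeGens d) Λ)) := by
    refine cond_isProbabilityMeasure_of_finite ?_ ?_ <;> rw [haarIso_isoFundamentalDomain]
    · exact_mod_cast Subgroup.FiniteIndex.index_ne_zero
    · exact ENNReal.natCast_ne_top _
  exact Measure.isProbabilityMeasure_map (measurable_isoQuot_mk Λ).aemeasurable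

/-- The Haar probability measure of the quotient is invariant under the whole isometry group: the
image of a fundamental domain under a right translation is a fundamental domain. -/
theorem measurePreserving_isoQuot_smul (g : 𝔾) :
    MeasurePreserving (fun x : IsoQuot (freeGens d) Λ => g • x) (haarQuot d Λ) (haarQuot d Λ) := by
  refine ⟨measurable_isoQuot_smul Λ g, ?_⟩
  ext E hE
  rw [Measure.map_apply (measurable_isoQuot_smul Λ g) hE, haarQuot_apply Λ hE,
    haarQuot_apply Λ (measurable_isoQuot_smul Λ g hE)]
  congr 1
  set D := isoFundamentalDomain (freeGens d) Λ
  have hD : MeasurableSet ((· * g) ⁻¹' D) :=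
    measurable_mul_const g (measurableSet_isoFundamentalDomain Λ)
  have hfd : IsFundamentalDomain (Λ.map λₗ) ((· * g) ⁻¹' D) (haarIso d) := by
    refine isFundamentalDomain_of_existsUnique Λ hD fun f => ?_
    have hex : ∃! γ : 𝔽, γ ∈ Λ ∧ λₗ γ * (f * g) ∈ D := by
      obtain ⟨k, hk, hku⟩ : ∃! k : Λ.map λₗ, k • (f * g) ∈ D := by
        have hs := isoSection_mem Λ (IsoQuot.mk (freeGens d) Λ (f * g))
        rw [isoSection_mk] at hs
        refine ⟨⟨_, _, cosetRep_mul_inv_mem Λ _, rfl⟩, hs, ?_⟩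
        rintro ⟨_, γ, hγ, rfl⟩ h
        have h' : λₗ γ * (f * g) ∈ D := h
        rw [mem_isoFundamentalDomain, leftMulIso_mul_apply, cosetRep_mul Λ hγ] at h'
        refine Subtype.ext ?_
        change λₗ γ = λₗ _
        rw [h', mul_inv_cancel_right]
      obtain ⟨γ, hγ, hγk⟩ := k.2
      refine ⟨γ, ⟨hγ, ?_⟩, ?_⟩
      · rw [hγk]; exact hk
      · rintro γ' ⟨hγ', h'⟩
        apply leftMulIso_injective (freeGens d)
        rw [hγk]
        exact congrArg Subtype.val (hku ⟨λₗ γ', γ', hγ', rfl⟩ h')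
    simpa only [Set.mem_preimage, mul_assoc] using hex
  have hpre : IsoQuot.mk (freeGens d) Λ ⁻¹' ((fun x => g • x) ⁻¹' E) =
      (· * g⁻¹) ⁻¹' (IsoQuot.mk (freeGens d) Λ ⁻¹' E) := rfl
  rw [hpre, ← measure_preimage_mul_right (haarIso d) g]
  have hset : (· * g) ⁻¹' (D ∩ (· * g⁻¹) ⁻¹' (IsoQuot.mk (freeGens d) Λ ⁻¹' E)) =
      IsoQuot.mk (freeGens d) Λ ⁻¹' E ∩ (· * g) ⁻¹' D := by
    ext f
    simp [and_comm]
  rw [hset, hfd.measure_set_eq (isFundamentalDomain_isoFundamentalDomain Λ)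
    (measurable_isoQuot_mk Λ hE), Set.inter_comm]
  rintro ⟨_, γ, hγ, rfl⟩
  ext f
  change IsoQuot.mk (freeGens d) Λ (λₗ γ * f) ∈ E ↔ _
  rw [isoQuot_mk_leftMul Λ hγ]
  rfl

end Quotient

/-! ### Mixing -/

section GeneralMixing

variable {ι X : Type*} [mX : MeasurableSpace X] {μ : Measure X} [IsProbabilityMeasure μ]

/-- Asymptotic independence under a family of measure preserving maps can be checked on a
generating π-system. -/
theorem tendsto_measureReal_inter_of_piSystem {l : Filter ι} {φ : ι → X → X}
    (hφ : ∀ i, MeasurePreserving (φ i) μ μ) {C : Set (Set X)}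
    (hgen : mX = MeasurableSpace.generateFrom C) (hC : IsPiSystem C)
    (h : ∀ A ∈ C, ∀ B ∈ C,
      Tendsto (fun i => μ.real (φ i ⁻¹' A ∩ B)) l (𝓝 (μ.real A * μ.real B)))
    {A B : Set X} (hA : MeasurableSet A) (hB : MeasurableSet B) :
    Tendsto (fun i => μ.real (φ i ⁻¹' A ∩ B)) l (𝓝 (μ.real A * μ.real B)) := by
  have hCm : ∀ A ∈ C, MeasurableSet A := fun A hA => by
    rw [hgen]; exact MeasurableSpace.measurableSet_generateFrom hA
  have hreal : ∀ i, ∀ A, MeasurableSet A → μ.real (φ i ⁻¹' A) = μ.real A := fun i A hA => by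
    rw [measureReal_def, (hφ i).measure_preimage hA.nullMeasurableSet, measureReal_def]
  have hsum : ∀ f : ℕ → Set X, Pairwise (Function.onFun Disjoint f) → (∀ i, MeasurableSet (f i)) →
      HasSum (fun n => μ.real (f n)) (μ.real (⋃ n, f n)) := by
    intro f hf hm
    simp only [measureReal_def, measure_iUnion hf hm]
    rw [ENNReal.tsum_toReal_eq fun n => measure_ne_top μ _]
    exact ENNReal.hasSum_toReal (by rw [← measure_iUnion hf hm]; exact measure_ne_top μ _)
  have step1 : ∀ B ∈ C, ∀ A, MeasurableSet A →
      Tendsto (fun i => μ.real (φ i ⁻¹' A ∩ B)) l (𝓝 (μ.real A * μ.real B)) := by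
    intro B hB A hA
    induction A, hA using MeasurableSpace.induction_on_inter hgen hC with
    | empty => simpa using tendsto_const_nhds
    | basic A hA => exact h A hA B hB
    | compl A hA ih =>
      have h1 : ∀ i, μ.real (φ i ⁻¹' Aᶜ ∩ B) = μ.real B - μ.real (φ i ⁻¹' A ∩ B) := fun i => by
        have := measureReal_inter_add_sdiff (μ := μ) (s := B) ((hφ i).measurable hA)
        rw [Set.inter_comm] at this
        rw [Set.preimage_compl, Set.inter_comm, ← Set.sdiff_eq]
        linarith
      simp only [h1]
      rw [probReal_compl_eq_one_sub hA, sub_mul, one_mul]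
      exact tendsto_const_nhds.sub ih
    | iUnion f hf hm ih =>
      have h1 : ∀ i, μ.real (φ i ⁻¹' (⋃ n, f n) ∩ B) = ∑' n, μ.real (φ i ⁻¹' (f n) ∩ B) := by
        intro i
        rw [Set.preimage_iUnion, Set.iUnion_inter]
        refine (hsum _ ?_ fun n => ((hφ i).measurable (hm n)).inter (hCm B hB)).tsum_eq.symm
        intro n n' hn
        exact ((hf hn).preimage _).mono Set.inter_subset_left Set.inter_subset_left
      simp only [h1]
      rw [← (hsum f hf hm).tsum_eq, ← tsum_mul_right]
      refine tendsto_tsum_of_dominated_convergence (hsum f hf hm).summable ih ?_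
      refine Eventually.of_forall fun i n => ?_
      rw [Real.norm_of_nonneg measureReal_nonneg, ← hreal i _ (hm n)]
      exact measureReal_mono Set.inter_subset_left
  induction B, hB using MeasurableSpace.induction_on_inter hgen hC with
  | empty => simpa using tendsto_const_nhds
  | basic B hB => exact step1 B hB A hA
  | compl B hB ih =>
    have h1 : ∀ i, μ.real (φ i ⁻¹' A ∩ Bᶜ) = μ.real A - μ.real (φ i ⁻¹' A ∩ B) := fun i => by
      have := measureReal_inter_add_sdiff (μ := μ) (s := φ i ⁻¹' A) hB
      rw [hreal i A hA] at this
      rw [← Set.sdiff_eq]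
      linarith
    simp only [h1]
    rw [probReal_compl_eq_one_sub hB, mul_sub, mul_one]
    exact tendsto_const_nhds.sub ih
  | iUnion f hf hm ih =>
    have h1 : ∀ i, μ.real (φ i ⁻¹' A ∩ ⋃ n, f n) = ∑' n, μ.real (φ i ⁻¹' A ∩ f n) := by
      intro i
      rw [Set.inter_iUnion]
      refine (hsum _ ?_ fun n => ((hφ i).measurable hA).inter (hm n)).tsum_eq.symm
      intro n n' hn
      exact (hf hn).mono Set.inter_subset_right Set.inter_subset_right
    simp only [h1]
    rw [← (hsum f hf hm).tsum_eq, ← tsum_mul_left]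
    refine tendsto_tsum_of_dominated_convergence (hsum f hf hm).summable ih ?_
    refine Eventually.of_forall fun i n => ?_
    rw [Real.norm_of_nonneg measureReal_nonneg]
    exact measureReal_mono Set.inter_subset_right

theorem image_smul_eq_preimage_inv {Γ X : Type*} [Group Γ] [MulAction Γ X] (γ : Γ) (A : Set X) :
    (fun x => γ • x) '' A = (fun x => γ⁻¹ • x) ⁻¹' A :=
  congrFun (Set.image_eq_preimage_of_inverse (inv_smul_smul γ) (smul_inv_smul γ)) A

theorem ErgodicSMul.of_isMixingAction {Γ : Type*} [Group Γ] [Infinite Γ] [MulAction Γ X]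
    (hμ : ∀ γ : Γ, MeasurePreserving (fun x : X => γ • x) μ μ) (h : IsMixingAction Γ μ) :
    ErgodicSMul Γ X μ := by
  refine { measure_preimage_smul := fun γ A hA => (hμ γ).measure_preimage hA.nullMeasurableSet,
           aeconst_of_forall_preimage_smul_ae_eq := fun {A} hA hinv => ?_ }
  have h1 := h A A hA hA
  have h2 : ∀ γ : Γ, μ.real (((fun x => γ • x) '' A) ∩ A) = μ.real A := fun γ => by
    rw [image_smul_eq_preimage_inv]
    refine measureReal_congr ?_
    simpa using (hinv γ⁻¹).inter (ae_eq_refl A)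
  simp only [h2] at h1
  have h3 := abs_eq_zero.1 (tendsto_nhds_unique tendsto_const_nhds h1)
  have h4 : μ.real A * (1 - μ.real A) = 0 := by linarith
  rw [eventuallyConst_set']
  rcases mul_eq_zero.1 h4 with h5 | h5
  · left
    exact ae_eq_empty.2 ((measureReal_eq_zero_iff).1 h5)
  · right
    refine ae_eq_univ.2 ?_
    rw [prob_compl_eq_zero_iff hA]
    have : μ.real A = 1 := by linarith
    rw [measureReal_def] at this
    exact (ENNReal.toReal_eq_one_iff _).1 this

end GeneralMixing

section CayleyTree

variable {d : ℕ}

theorem exists_mul_eq_of_le_wordLength (γ : FreeGroup (Fin d)) {j : ℕ} (hj : j ≤ ℓ γ) :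
    ∃ u v, γ = u * v ∧ ℓ u = j ∧ ℓ v = ℓ γ - j := by
  obtain ⟨l, hl, hS, hp⟩ := exists_list_wordLength γ
  have h1 := wordLength_le_length (l.take j) fun s hs => hS s (List.mem_of_mem_take hs)
  have h2 := wordLength_le_length (l.drop j) fun s hs => hS s (List.mem_of_mem_drop hs)
  have h3 : γ = (l.take j).prod * (l.drop j).prod := by rw [List.prod_take_mul_prod_drop, hp]
  have h4 := wordLength_mul_le (l.take j).prod (l.drop j).prod
  rw [← h3] at h4
  rw [List.length_take] at h1
  rw [List.length_drop] at h2
  have h5 := min_le_left j l.length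
  exact ⟨_, _, h3, by omega, by omega⟩

theorem notMem_branch_of_wordLength_mul {g h t : FreeGroup (Fin d)}
    (hgh : ℓ (g * h) = ℓ g + ℓ h) (hg : g⁻¹ ∈ branch t) : h ∉ branch t := by
  intro hh
  have h1 : ℓ (t⁻¹ * g⁻¹) < ℓ g⁻¹ := hg
  have h2 : ℓ (t⁻¹ * h) < ℓ h := hh
  have h3 := wordLength_mul_le (t⁻¹ * g⁻¹)⁻¹ (t⁻¹ * h)
  have h4 : (t⁻¹ * g⁻¹)⁻¹ * (t⁻¹ * h) = g * h := by group
  rw [h4, wordLength_inv, hgh] at h3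
  rw [wordLength_inv] at h1
  omega

/-- Translating the half-tree behind an edge along a geodesic keeps it behind the geodesic. -/
theorem inv_mul_mem_branch {w t τ v : FreeGroup (Fin d)} (ht : t ∈ freeGens d)
    (hτ : τ ∈ freeGens d) (hwt : w ∉ branch t) (hwτ : w⁻¹ ∈ branch τ)
    (hv : v ∈ insert 1 (branch t)) : w⁻¹ * v ∈ branch τ := by
  rcases hv with rfl | hv
  · rwa [mul_one]
  by_contra hne
  have h1 := wordLength_inv_mul_of_notMem_branch ht hv hwt
  have h2 := wordLength_inv_mul_of_notMem_branch hτ hwτ hne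
  rw [inv_inv, mul_inv_cancel_left, wordLength_inv] at h2
  rw [← wordLength_inv, mul_inv_rev, inv_inv] at h1
  have h3 : w = 1 := wordLength_eq_zero.1 (by omega)
  rw [h3, inv_one] at hwτ
  exact one_notMem_branch τ hwτ

theorem conj_mem_isoFix {A B : Set (FreeGroup (Fin d))} {z : FreeGroup (Fin d)}
    {k : CayleyIso (freeGens d)} (hk : k ∈ isoFix B) (h : ∀ v ∈ A, z⁻¹ * v ∈ B) :
    leftMulIso (freeGens d) z * k * (leftMulIso (freeGens d) z)⁻¹ ∈ isoFix A := by
  intro v hv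
  rw [← map_inv]
  change z * (k : Equiv.Perm (FreeGroup (Fin d))) (z⁻¹ * v) = v
  rw [hk _ (h v hv), mul_inv_cancel_left]

theorem conj_mem_isoFix_branch {w t τ : FreeGroup (Fin d)} (ht : t ∈ freeGens d)
    (hτ : τ ∈ freeGens d) (hwt : w ∉ branch t) (hwτ : w⁻¹ ∈ branch τ)
    {k : CayleyIso (freeGens d)} (hk : k ∈ isoFix (insert 1 (branch τ))) :
    leftMulIso (freeGens d) w * k * (leftMulIso (freeGens d) w)⁻¹ ∈
      isoFix (insert 1 (branch t)) :=
  conj_mem_isoFix hk fun _ hv => Or.inr (inv_mul_mem_branch ht hτ hwt hwτ hv)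

theorem isoFix_mul_comm {t : FreeGroup (Fin d)} (ht : t ∈ freeGens d)
    {a b : CayleyIso (freeGens d)} (ha : a ∈ isoFix (insert 1 (branch t)))
    (hb : b ∈ isoFix (insert t (branch t)ᶜ)) : a * b = b * a := by
  have ha1 : a ∈ isoOne (freeGens d) := ha 1 (Or.inl rfl)
  have hb1 : b ∈ isoOne (freeGens d) := hb 1 (Or.inr (one_notMem_branch t))
  have hat := ha t (Or.inr (self_mem_branch ht))
  have hbt := hb t (Or.inl rfl)
  refine Subtype.ext (Equiv.ext fun w => ?_)
  change (a : Equiv.Perm (FreeGroup (Fin d))) ((b : Equiv.Perm (FreeGroup (Fin d))) w) =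
    (b : Equiv.Perm (FreeGroup (Fin d))) ((a : Equiv.Perm (FreeGroup (Fin d))) w)
  by_cases hw : w ∈ branch t
  · have h1 : (b : Equiv.Perm (FreeGroup (Fin d))) w ∈ branch t := by
      rw [← isoOne_map_branch hb1, hbt] at hw
      exact hw
    rw [ha w (Or.inr hw), ha _ (Or.inr h1)]
  · have h1 : (a : Equiv.Perm (FreeGroup (Fin d))) w ∉ branch t := by
      rw [← isoOne_map_branch ha1, hat] at hw
      exact hw
    rw [hb w (Or.inr hw), hb _ (Or.inr h1)]

theorem wordLength_le_finite (d n : ℕ) : {w : FreeGroup (Fin d) | ℓ w ≤ n}.Finite := by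
  have : {w : FreeGroup (Fin d) | ℓ w ≤ n} =
      ⋃ m ∈ Set.Iic n, {w : FreeGroup (Fin d) | ℓ w = m} := by
    ext w; simp
  rw [this]
  exact (Set.finite_Iic n).biUnion fun m _ =>
    wordLength_ball_finite (freeGens_finite d) (freeGens_generate d) m

end CayleyTree

section EdgeState

variable {d : ℕ}

local notation "𝔽" => FreeGroup (Fin d)
local notation "𝔾" => CayleyIso (freeGens d)
local notation "λₗ" => leftMulIso (freeGens d)

variable (Λ : Subgroup (FreeGroup (Fin d)))

/-- The state of a point `[f]` at the edge from `1` to `t`: the vertex of the Schreier graph `F_d/Λ`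
that `f` assigns to `1`, and the label of the image of the edge. The vertex is encoded as
`(f 1)⁻¹ Λ`, which depends on `Λ f` only. -/
noncomputable def edgeState (t : freeGens d) :
    IsoQuot (freeGens d) Λ → (FreeGroup (Fin d) ⧸ Λ) × freeGens d :=
  Quotient.lift (fun f : 𝔾 => (((((f : Equiv.Perm 𝔽) 1)⁻¹ : 𝔽) : 𝔽 ⧸ Λ),
    (⟨((f : Equiv.Perm 𝔽) 1)⁻¹ * (f : Equiv.Perm 𝔽) t, by
      simpa using cayleyIso_inv_mul_mem f 1 t.2⟩ : freeGens d))) (by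
    intro f g h
    obtain ⟨γ, hγ, rfl⟩ := (isoQuot_mk_eq_iff Λ).1 (Quotient.sound h)
    refine Prod.ext ?_ (Subtype.ext ?_)
    · change ((((f : Equiv.Perm 𝔽) 1)⁻¹ : 𝔽) : 𝔽 ⧸ Λ) = ((γ * (f : Equiv.Perm 𝔽) 1)⁻¹ : 𝔽)
      rw [QuotientGroup.eq]
      simpa using inv_mem hγ
    · change ((f : Equiv.Perm 𝔽) 1)⁻¹ * (f : Equiv.Perm 𝔽) t =
        (γ * (f : Equiv.Perm 𝔽) 1)⁻¹ * (γ * (f : Equiv.Perm 𝔽) t)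
      group)

theorem edgeState_mk_fst (t : freeGens d) (f : 𝔾) :
    (edgeState Λ t (IsoQuot.mk (freeGens d) Λ f)).1 = (((f : Equiv.Perm 𝔽) 1)⁻¹ : 𝔽) := rfl

theorem edgeState_mk_snd (t : freeGens d) (f : 𝔾) :
    ((edgeState Λ t (IsoQuot.mk (freeGens d) Λ f)).2 : 𝔽) =
      ((f : Equiv.Perm 𝔽) 1)⁻¹ * (f : Equiv.Perm 𝔽) t := rfl

theorem edgeState_fst_eq (t t' : freeGens d) (x : IsoQuot (freeGens d) Λ) :
    (edgeState Λ t x).1 = (edgeState Λ t' x).1 := by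
  obtain ⟨f, rfl⟩ := isoQuot_mk_surjective Λ x
  rfl

theorem measurable_comp_edgeState (t : freeGens d) (q : (FreeGroup (Fin d) ⧸ Λ) × freeGens d → ℝ) :
    Measurable fun x => q (edgeState Λ t x) := by
  rw [measurable_isoQuot_iff]
  refine (continuous_iff_continuousAt.2 fun f => ?_ : Continuous _).measurable
  refine (continuousAt_const (y := q (edgeState Λ t (IsoQuot.mk (freeGens d) Λ f)))).congr ?_
  filter_upwards [(cayleyIso_isOpen (freeGens d) 1 ((f : Equiv.Perm 𝔽) 1)).mem_nhds rfl,
    (cayleyIso_isOpen (freeGens d) t ((f : Equiv.Perm 𝔽) t)).mem_nhds rfl] with g h1 h2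
  have h1' : (g : Equiv.Perm 𝔽) 1 = (f : Equiv.Perm 𝔽) 1 := h1
  have h2' : (g : Equiv.Perm 𝔽) t = (f : Equiv.Perm 𝔽) t := h2
  congr 1
  refine Prod.ext ?_ (Subtype.ext ?_)
  · rw [edgeState_mk_fst, edgeState_mk_fst, h1']
  · rw [edgeState_mk_snd, edgeState_mk_snd, h1', h2']

/-- Isometries that fix the identity and move one edge to another move the states accordingly. -/
theorem edgeState_smul {k : 𝔾} (hk : k ∈ isoOne (freeGens d)) {r r' : freeGens d}
    (hr : (k : Equiv.Perm 𝔽) r = r') (x : IsoQuot (freeGens d) Λ) :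
    edgeState Λ r' (k • x) = edgeState Λ r x := by
  obtain ⟨f, rfl⟩ := isoQuot_mk_surjective Λ x
  have h1 : (k : Equiv.Perm 𝔽).symm 1 = 1 := by
    rw [Equiv.symm_apply_eq]
    exact (show (k : Equiv.Perm 𝔽) 1 = 1 from hk).symm
  have h2 : (k : Equiv.Perm 𝔽).symm r' = r := by rw [Equiv.symm_apply_eq, hr]
  rw [isoQuot_smul_mk]
  refine Prod.ext ?_ (Subtype.ext ?_)
  · change ((((f : Equiv.Perm 𝔽) ((k : Equiv.Perm 𝔽).symm 1))⁻¹ : 𝔽) : 𝔽 ⧸ Λ) = _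
    rw [h1]
    rfl
  · change ((f : Equiv.Perm 𝔽) ((k : Equiv.Perm 𝔽).symm 1))⁻¹ *
      (f : Equiv.Perm 𝔽) ((k : Equiv.Perm 𝔽).symm r') = _
    rw [h1, h2]
    rfl

/-- Points with the same state at an edge differ by an isometry that fixes the edge. -/
theorem exists_isoFix_edge_smul {t : freeGens d} {x y : IsoQuot (freeGens d) Λ}
    (h : edgeState Λ t x = edgeState Λ t y) : ∃ k ∈ isoFix {1, (t : 𝔽)}, y = k • x := by
  obtain ⟨f, rfl⟩ := isoQuot_mk_surjective Λ x
  obtain ⟨g, rfl⟩ := isoQuot_mk_surjective Λ y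
  have h1 := congrArg Prod.fst h
  have h2 := congrArg (fun v => (v.2 : 𝔽)) h
  rw [edgeState_mk_fst, edgeState_mk_fst, QuotientGroup.eq, inv_inv] at h1
  simp only [edgeState_mk_snd] at h2
  set γ : 𝔽 := (f : Equiv.Perm 𝔽) 1 * ((g : Equiv.Perm 𝔽) 1)⁻¹ with hγ
  have h3 : γ * (g : Equiv.Perm 𝔽) t = (f : Equiv.Perm 𝔽) t := by
    rw [hγ, mul_assoc, ← h2, mul_inv_cancel_left]
  have h4 : γ * (g : Equiv.Perm 𝔽) 1 = (f : Equiv.Perm 𝔽) 1 := by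
    rw [hγ, inv_mul_cancel_right]
  refine ⟨(λₗ γ * g)⁻¹ * f, ?_, ?_⟩
  · rintro w hw
    change ((λₗ γ * g : 𝔾) : Equiv.Perm 𝔽).symm ((f : Equiv.Perm 𝔽) w) = w
    rw [Equiv.symm_apply_eq, leftMulIso_mul_apply]
    rcases hw with rfl | rfl
    · exact h4.symm
    · exact h3.symm
  · rw [isoQuot_smul_mk, ← isoQuot_mk_leftMul Λ h1 g]
    congr 1
    group

/-- Crossing an edge reverses its state. -/
theorem edgeState_inv_smul (r : freeGens d) (x : IsoQuot (freeGens d) Λ) :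
    edgeState Λ ⟨(r : 𝔽)⁻¹, inv_mem_freeGens r.2⟩ ((r : 𝔽)⁻¹ • x) =
      edgeReversal (edgeState Λ r x) := by
  obtain ⟨f, rfl⟩ := isoQuot_mk_surjective Λ x
  have hx : (r : 𝔽)⁻¹ • IsoQuot.mk (freeGens d) Λ f = IsoQuot.mk (freeGens d) Λ (f * λₗ r) := by
    rw [isoQuot_free_smul, isoQuot_smul_mk, map_inv, inv_inv]
  rw [hx]
  refine Prod.ext ?_ (Subtype.ext ?_)
  · change ((((f : Equiv.Perm 𝔽) (r * 1))⁻¹ : 𝔽) : 𝔽 ⧸ Λ) =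
      (((((f : Equiv.Perm 𝔽) 1)⁻¹ * (f : Equiv.Perm 𝔽) r)⁻¹ * ((f : Equiv.Perm 𝔽) 1)⁻¹ : 𝔽) : 𝔽 ⧸ Λ)
    rw [mul_one]
    congr 1
    group
  · change ((f : Equiv.Perm 𝔽) (r * 1))⁻¹ * (f : Equiv.Perm 𝔽) (r * (r : 𝔽)⁻¹) =
      (((f : Equiv.Perm 𝔽) 1)⁻¹ * (f : Equiv.Perm 𝔽) r)⁻¹
    rw [mul_one, mul_inv_cancel]
    group

/-- The non-backtracking average of a function of the state at `t` is the average of its values on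
the states at the other edges, because an isometry permutes the edges at a vertex. -/
theorem nonBacktracking_edgeState (q : (FreeGroup (Fin d) ⧸ Λ) × freeGens d → ℝ) (t : freeGens d)
    (x : IsoQuot (freeGens d) Λ) [DecidableEq (freeGens d)] :
    nonBacktracking edgeReversal q (edgeState Λ t x) =
      (∑ r ∈ Finset.univ.erase t, q (edgeReversal (edgeState Λ r x))) /
        (Fintype.card (freeGens d) - 1) := by
  have hinj : Function.Injective fun r : freeGens d => (edgeState Λ r x).2 := by
    intro r r' h
    obtain ⟨f, rfl⟩ := isoQuot_mk_surjective Λ x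
    have h' := congrArg (fun s : freeGens d => (s : 𝔽)) h
    simp only [edgeState_mk_snd] at h'
    exact Subtype.ext ((f : Equiv.Perm 𝔽).injective (mul_left_cancel h'))
  have hbij : Function.Bijective fun r : freeGens d => (edgeState Λ r x).2 :=
    Finite.injective_iff_bijective.1 hinj
  have hsum : ∑ ρ, q (edgeReversal ((edgeState Λ t x).1, ρ)) =
      ∑ r, q (edgeReversal (edgeState Λ r x)) := by
    refine (Function.Bijective.sum_comp hbij
      (fun ρ => q (edgeReversal ((edgeState Λ t x).1, ρ)))).symm.trans ?_
    refine Finset.sum_congr rfl fun r _ => ?_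
    rw [edgeState_fst_eq Λ t r]
  rw [nonBacktracking, hsum, ← Finset.add_sum_erase _ _ (Finset.mem_univ t), add_sub_cancel_left]

variable [Λ.FiniteIndex]

theorem setIntegral_isoQuot_smul (g : 𝔾) (E : Set (IsoQuot (freeGens d) Λ))
    (φ : IsoQuot (freeGens d) Λ → ℝ) :
    ∫ x in (fun x => g • x) ⁻¹' E, φ (g • x) ∂(haarQuot d Λ) = ∫ x in E, φ x ∂(haarQuot d Λ) := by
  let e : IsoQuot (freeGens d) Λ ≃ᵐ IsoQuot (freeGens d) Λ :=
    { MulAction.toPerm g with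
      measurable_toFun := measurable_isoQuot_smul Λ g
      measurable_invFun := measurable_isoQuot_smul Λ g⁻¹ }
  exact (measurePreserving_isoQuot_smul Λ g).setIntegral_preimage_emb e.measurableEmbedding φ E

theorem preimage_smul_eq_of_invariant {G X : Type*} [Group G] [MulAction G X] {H : Subgroup G}
    {E : Set X} (hE : ∀ k ∈ H, ∀ x ∈ E, k • x ∈ E) {k : G} (hk : k ∈ H) :
    (fun x => k • x) ⁻¹' E = E := by
  ext x
  refine ⟨fun h => ?_, hE k hk x⟩
  have := hE k⁻¹ (inv_mem hk) _ h
  rwa [inv_smul_smul] at this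

theorem integrable_comp_edgeState (t : freeGens d)
    (q : (FreeGroup (Fin d) ⧸ Λ) × freeGens d → ℝ) (μ : Measure (IsoQuot (freeGens d) Λ))
    [IsFiniteMeasure μ] : Integrable (fun x => q (edgeState Λ t x)) μ := by
  obtain ⟨C, hC⟩ := (Set.finite_range fun v => ‖q v‖).bddAbove
  exact Integrable.of_bound (measurable_comp_edgeState Λ t q).aestronglyMeasurable C
    (Eventually.of_forall fun x => hC ⟨_, rfl⟩)

/-- The Markov property: given what happens behind the edge at `t`, the state at a further edge is
distributed according to a non-backtracking step. -/
theorem setIntegral_edgeState_step (hd : 2 ≤ d) {t r : freeGens d} (hrt : r ≠ t)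
    (q : (FreeGroup (Fin d) ⧸ Λ) × freeGens d → ℝ) {E : Set (IsoQuot (freeGens d) Λ)}
    (hE : ∀ k ∈ isoFix (insert 1 (branch (t : 𝔽))), ∀ x ∈ E, k • x ∈ E) :
    ∫ x in E, q (edgeState Λ ⟨(r : 𝔽)⁻¹, inv_mem_freeGens r.2⟩ ((r : 𝔽)⁻¹ • x)) ∂(haarQuot d Λ) =
      ∫ x in E, nonBacktracking edgeReversal q (edgeState Λ t x) ∂(haarQuot d Λ) := by
  classical
  have hS := two_lt_card_freeGens hd
  have hS' : (2 : ℝ) < Fintype.card (freeGens d) := by exact_mod_cast hS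
  have hcard : ((Finset.univ.erase t).card : ℝ) = Fintype.card (freeGens d) - 1 := by
    rw [Finset.card_erase_of_mem (Finset.mem_univ t), Finset.card_univ, Nat.cast_sub (by omega)]
    simp
  have heq : ∀ r' ∈ Finset.univ.erase t,
      ∫ x in E, q (edgeReversal (edgeState Λ r' x)) ∂(haarQuot d Λ) =
        ∫ x in E, q (edgeReversal (edgeState Λ r x)) ∂(haarQuot d Λ) := by
    intro r' hr'
    have hr't : (r' : 𝔽) ≠ t := fun h => (Finset.mem_erase.1 hr').1 (Subtype.ext h)
    obtain ⟨k, hk, hkr⟩ := exists_isoFix_branch_exchange t.2 r.2 r'.2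
      (fun h => hrt (Subtype.ext h)) hr't
    rw [← setIntegral_isoQuot_smul Λ k E fun x => q (edgeReversal (edgeState Λ r' x)),
      preimage_smul_eq_of_invariant hE hk]
    simp only [edgeState_smul Λ (hk 1 (Or.inl rfl)) hkr]
  simp only [nonBacktracking_edgeState, edgeState_inv_smul]
  rw [integral_div, integral_finsetSum _ fun r' _ =>
    (integrable_comp_edgeState Λ r' (fun v => q (edgeReversal v)) _), Finset.sum_congr rfl heq,
    Finset.sum_const, nsmul_eq_mul, hcard]
  have h0 : (Fintype.card (freeGens d) : ℝ) - 1 ≠ 0 := by linarith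
  field_simp

/-- Walking along the reduced word of `w` amounts to iterating the non-backtracking operator. -/
theorem setIntegral_edgeState_iterate (hd : 2 ≤ d)
    (q : (FreeGroup (Fin d) ⧸ Λ) × freeGens d → ℝ) (N : ℕ) (w : FreeGroup (Fin d))
    (hw : ℓ w = N + 1) (t τ : freeGens d) (hwt : w ∉ branch (t : FreeGroup (Fin d)))
    (hwτ : w⁻¹ ∈ branch (τ : FreeGroup (Fin d))) {E : Set (IsoQuot (freeGens d) Λ)}
    (hE : ∀ k ∈ isoFix (insert 1 (branch (t : FreeGroup (Fin d)))), ∀ x ∈ E, k • x ∈ E) :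
    ∫ x in E, q (edgeState Λ τ (w⁻¹ • x)) ∂(haarQuot d Λ) =
      ∫ x in E, (nonBacktracking edgeReversal)^[N + 1] q (edgeState Λ t x) ∂(haarQuot d Λ) := by
  induction N generalizing w t E with
  | zero =>
    have hwS : w ∈ freeGens d := wordLength_eq_one.1 hw
    have hτ : τ = ⟨w⁻¹, inv_mem_freeGens hwS⟩ := Subtype.ext
      (branch_unique τ.2 (inv_mem_freeGens hwS) hwτ (self_mem_branch (inv_mem_freeGens hwS)))
    subst hτ
    refine setIntegral_edgeState_step Λ hd (r := ⟨w, hwS⟩) ?_ q hE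
    rintro rfl
    exact hwt (self_mem_branch hwS)
  | succ N ih =>
    obtain ⟨r, hr, hwr⟩ := exists_mem_branch (w := w) (by
      rintro rfl
      rw [wordLength_one] at hw
      omega)
    have hrt : r ≠ t := by
      rintro rfl
      exact hwt hwr
    have hri := inv_mem_freeGens hr
    have hlen := wordLength_of_mem_branch hr hwr
    set w' := r⁻¹ * w with hw'
    have hww : w = r * w' := by rw [hw', mul_inv_cancel_left]
    have hw'τ : w'⁻¹ ∈ branch (τ : FreeGroup (Fin d)) := by
      by_contra hne
      have h1 := wordLength_inv_mul_of_notMem_branch τ.2 hwτ hne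
      rw [inv_inv, hww, mul_assoc, mul_inv_cancel, mul_one, wordLength_eq_one.2 hr, ← hww,
        wordLength_inv] at h1
      omega
    have hrt' : r ∉ branch (t : FreeGroup (Fin d)) := fun h =>
      hrt (branch_unique hr t.2 (self_mem_branch hr) h)
    have hE' : ∀ k ∈ isoFix (insert 1 (branch r⁻¹)), ∀ x ∈ (fun x => r • x) ⁻¹' E,
        k • x ∈ (fun x => r • x) ⁻¹' E := by
      intro k hk x hx
      have := hE _ (conj_mem_isoFix_branch t.2 hri hrt' (self_mem_branch hri) hk) _ hx
      have hx' : (λₗ r * k * (λₗ r)⁻¹) • (r • x) = r • (k • x) := by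
        rw [isoQuot_free_smul, isoQuot_free_smul, smul_smul, smul_smul, inv_mul_cancel_right]
      change r • (k • x) ∈ E
      rw [← hx']
      exact this
    have hpre : (fun x : IsoQuot (freeGens d) Λ => r⁻¹ • x) ⁻¹' ((fun x => r • x) ⁻¹' E) = E := by
      ext x
      simp
    have hstep := ih w' (by omega) ⟨r⁻¹, hri⟩ (inv_mul_notMem_branch hwr) hw'τ hE'
    have hshift := fun φ => setIntegral_isoQuot_smul Λ (λₗ r⁻¹) ((fun x => r • x) ⁻¹' E) φ
    rw [← hshift, ← hshift] at hstep
    have hpre' : (fun x : IsoQuot (freeGens d) Λ => λₗ r⁻¹ • x) ⁻¹' ((fun x => r • x) ⁻¹' E) = E :=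
      hpre
    rw [hpre'] at hstep
    rw [Function.iterate_succ_apply', ← setIntegral_edgeState_step Λ hd (r := ⟨r, hr⟩)
      (fun h => hrt (congrArg Subtype.val h)) _ hE]
    refine Eq.trans ?_ hstep
    congr 1
    funext x
    rw [hww, mul_inv_rev, mul_smul]
    rfl

end EdgeState

section HaarMixing

variable {d : ℕ}

local notation "𝔽" => FreeGroup (Fin d)
local notation "𝔾" => CayleyIso (freeGens d)
local notation "λₗ" => leftMulIso (freeGens d)

variable (Λ : Subgroup (FreeGroup (Fin d)))

/-- A set that depends on finitely many values of an isometry has finitely many translates under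
the stabilizer of the identity. -/
theorem finite_preimages_of_isoFix_ball {A : Set (IsoQuot (freeGens d) Λ)} {n : ℕ}
    (hA : ∀ k ∈ isoFix {w : FreeGroup (Fin d) | ℓ w ≤ n}, ∀ x ∈ A, k • x ∈ A)
    {Q : Subgroup (CayleyIso (freeGens d))} (hQ : ∀ k ∈ Q, k ∈ isoOne (freeGens d)) :
    {A' : Set (IsoQuot (freeGens d) Λ) | ∃ k ∈ Q, A' = (fun x => k • x) ⁻¹' A}.Finite := by
  have hfin : Finite {w : 𝔽 // ℓ w ≤ n} := (wordLength_le_finite d n).to_subtype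
  choose κ hκ hκA using fun A' : {A' : Set (IsoQuot (freeGens d) Λ) //
    ∃ k ∈ Q, A' = (fun x => k • x) ⁻¹' A} => A'.2
  let res : {A' : Set (IsoQuot (freeGens d) Λ) // ∃ k ∈ Q, A' = (fun x => k • x) ⁻¹' A} →
      {w : 𝔽 // ℓ w ≤ n} → {w : 𝔽 // ℓ w ≤ n} := fun A' w =>
    ⟨(((κ A')⁻¹ : 𝔾) : Equiv.Perm 𝔽) w, by
      rw [cayleyIso_wordLength (hQ _ (inv_mem (hκ A')))]
      exact w.2⟩
  have hsub : ∀ A' A'', res A' = res A'' → (A' : Set (IsoQuot (freeGens d) Λ)) ⊆ A'' := by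
    intro A' A'' h x hx
    rw [hκA A'] at hx
    rw [hκA A'']
    have hk : κ A'' * (κ A')⁻¹ ∈ isoFix {w : 𝔽 | ℓ w ≤ n} := by
      intro w hw
      have h1 : (((κ A')⁻¹ : 𝔾) : Equiv.Perm 𝔽) w = (((κ A'')⁻¹ : 𝔾) : Equiv.Perm 𝔽) w :=
        congrArg Subtype.val (congrFun h ⟨w, hw⟩)
      change (κ A'' : Equiv.Perm 𝔽) ((((κ A')⁻¹ : 𝔾) : Equiv.Perm 𝔽) w) = w
      rw [h1]
      exact (κ A'' : Equiv.Perm 𝔽).apply_symm_apply w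
    have := hA _ hk _ hx
    rwa [smul_smul, inv_mul_cancel_right] at this
  have hinj : Function.Injective res := fun A' A'' h =>
    Subtype.ext ((hsub A' A'' h).antisymm (hsub A'' A' h.symm))
  exact Finite.of_injective res hinj

variable [Λ.FiniteIndex]

/-- The conditional probability of an event ahead of an edge, given the behaviour behind the edge,
is a function of the state at the edge. It is obtained by averaging over the translates of the
event under the stabilizer of the half-tree behind the edge. -/
theorem exists_conditional_edgeState {t : freeGens d} {A : Set (IsoQuot (freeGens d) Λ)}
    (hAm : MeasurableSet A) {n : ℕ}
    (hA : ∀ k ∈ isoFix {w : FreeGroup (Fin d) | ℓ w ≤ n}, ∀ x ∈ A, k • x ∈ A)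
    (hAt : ∀ k ∈ isoFix (insert (t : FreeGroup (Fin d)) (branch (t : FreeGroup (Fin d)))ᶜ),
      ∀ x ∈ A, k • x ∈ A) :
    ∃ a : (FreeGroup (Fin d) ⧸ Λ) × freeGens d → ℝ, (∀ v, 0 ≤ a v ∧ a v ≤ 1) ∧
      ∀ E : Set (IsoQuot (freeGens d) Λ), MeasurableSet E →
        (∀ k ∈ isoFix (insert 1 (branch (t : FreeGroup (Fin d)))), ∀ x ∈ E, k • x ∈ E) →
        (haarQuot d Λ).real (A ∩ E) = ∫ x in E, a (edgeState Λ t x) ∂(haarQuot d Λ) := by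
  classical
  set Q := isoFix (insert 1 (branch (t : 𝔽))) with hQdef
  have hfin := finite_preimages_of_isoFix_ball Λ hA (Q := Q) fun k hk => hk 1 (Or.inl rfl)
  set O : Finset (Set (IsoQuot (freeGens d) Λ)) := hfin.toFinset with hO
  have hmemO : ∀ A', A' ∈ O ↔ ∃ k ∈ Q, A' = (fun x => k • x) ⁻¹' A := fun A' =>
    hfin.mem_toFinset
  have hOne : O.Nonempty := ⟨A, (hmemO A).2 ⟨1, one_mem Q, by simp⟩⟩
  have hOcard : (0 : ℝ) < O.card := by exact_mod_cast hOne.card_pos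
  have hOm : ∀ A' ∈ O, MeasurableSet A' := fun A' hA' => by
    obtain ⟨k, _, rfl⟩ := (hmemO A').1 hA'
    exact measurableSet_isoQuot_smul Λ k hAm
  let b : IsoQuot (freeGens d) Λ → ℝ := fun x =>
    (∑ A' ∈ O, A'.indicator (fun _ => (1 : ℝ)) x) / O.card
  have hb01 : ∀ x, 0 ≤ b x ∧ b x ≤ 1 := by
    intro x
    refine ⟨div_nonneg (Finset.sum_nonneg fun A' _ => Set.indicator_nonneg (by simp) x) hOcard.le,
      (div_le_one hOcard).2 ?_⟩
    calc ∑ A' ∈ O, A'.indicator (fun _ => (1 : ℝ)) x ≤ ∑ _A' ∈ O, (1 : ℝ) :=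
          Finset.sum_le_sum fun A' _ => Set.indicator_le_self' (by simp) x
      _ = O.card := by simp
  have hbQ : ∀ k ∈ Q, ∀ x, b (k • x) = b x := by
    intro k hk x
    have hpre : ∀ k ∈ Q, ∀ A' ∈ O, (fun x => k • x) ⁻¹' A' ∈ O := by
      intro k hk A' hA'
      obtain ⟨k', hk', rfl⟩ := (hmemO A').1 hA'
      exact (hmemO _).2 ⟨k' * k, mul_mem hk' hk, by ext x; simp [mul_smul]⟩
    change (∑ A' ∈ O, _) / _ = (∑ A' ∈ O, _) / _
    congr 1
    refine Finset.sum_nbij' (fun A' => (fun x => k • x) ⁻¹' A')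
      (fun A' => (fun x => k⁻¹ • x) ⁻¹' A') (hpre k hk) (hpre k⁻¹ (inv_mem hk)) ?_ ?_ ?_
    · intro A' _
      ext x
      simp
    · intro A' _
      ext x
      simp
    · intro A' _
      rfl
  have hbR : ∀ k ∈ isoFix (insert (t : 𝔽) (branch (t : 𝔽))ᶜ), ∀ x, b (k • x) = b x := by
    intro k hk x
    change (∑ A' ∈ O, _) / _ = (∑ A' ∈ O, _) / _
    congr 1
    refine Finset.sum_congr rfl fun A' hA' => ?_
    obtain ⟨k', hk', rfl⟩ := (hmemO A').1 hA'
    have hiff : k' • k • x ∈ A ↔ k' • x ∈ A := by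
      rw [smul_smul, isoFix_mul_comm t.2 hk' hk, mul_smul]
      exact Set.ext_iff.1 (preimage_smul_eq_of_invariant hAt hk) (k' • x)
    by_cases hx : k' • x ∈ A
    · rw [Set.indicator_of_mem (show k • x ∈ (fun x => k' • x) ⁻¹' A from hiff.2 hx),
        Set.indicator_of_mem (show x ∈ (fun x => k' • x) ⁻¹' A from hx)]
    · rw [Set.indicator_of_notMem (show k • x ∉ (fun x => k' • x) ⁻¹' A from mt hiff.1 hx),
        Set.indicator_of_notMem (show x ∉ (fun x => k' • x) ⁻¹' A from hx)]
  have hfac : ∀ x y, edgeState Λ t x = edgeState Λ t y → b x = b y := by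
    intro x y h
    obtain ⟨k, hk, rfl⟩ := exists_isoFix_edge_smul Λ h
    obtain ⟨u, hu, v, hv, rfl⟩ := exists_mul_eq_of_isoFix_edge t.2 hk
    rw [mul_smul, hbQ u hu, hbR v hv]
  let a : (𝔽 ⧸ Λ) × freeGens d → ℝ := fun v =>
    if h : ∃ x, edgeState Λ t x = v then b h.choose else 0
  have hab : ∀ x, a (edgeState Λ t x) = b x := by
    intro x
    have h : ∃ y, edgeState Λ t y = edgeState Λ t x := ⟨x, rfl⟩
    simp only [a, dif_pos h]
    exact hfac _ _ h.choose_spec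
  refine ⟨a, fun v => ?_, fun E hEm hE => ?_⟩
  · by_cases h : ∃ x, edgeState Λ t x = v
    · simp only [a, dif_pos h]
      exact hb01 _
    · simp [a, dif_neg h]
  · simp only [hab, b]
    rw [integral_div, integral_finsetSum _ fun A' hA' =>
      (integrable_const (1 : ℝ)).indicator (hOm A' hA')]
    have hterm : ∀ A' ∈ O, ∫ x in E, A'.indicator (fun _ => (1 : ℝ)) x ∂(haarQuot d Λ) =
        (haarQuot d Λ).real (A ∩ E) := by
      intro A' hA'
      rw [integral_indicator (hOm A' hA'), integral_const, smul_eq_mul, mul_one,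
        measureReal_restrict_apply MeasurableSet.univ, Set.univ_inter,
        measureReal_restrict_apply (hOm A' hA')]
      obtain ⟨k, hk, rfl⟩ := (hmemO A').1 hA'
      rw [measureReal_def, measureReal_def,
        ← (measurePreserving_isoQuot_smul Λ k).measure_preimage (hAm.inter hEm).nullMeasurableSet,
        Set.preimage_inter, preimage_smul_eq_of_invariant hE hk]
    rw [Finset.sum_congr rfl hterm, Finset.sum_const, nsmul_eq_mul,
      mul_div_cancel_left₀ _ hOcard.ne']

/-- Asymptotic independence of what happens behind and ahead of a long geodesic. -/
theorem exists_abs_measureReal_sub_le (hd : 2 ≤ d) (hΛ : ¬ Λ ≤ evenSubgroup d) {ε : ℝ}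
    (hε : 0 < ε) :
    ∃ N₀ : ℕ, ∀ (w : FreeGroup (Fin d)) (t τ : freeGens d) (n : ℕ)
      (A E : Set (IsoQuot (freeGens d) Λ)), N₀ < ℓ w → w ∉ branch (t : FreeGroup (Fin d)) →
      w⁻¹ ∈ branch (τ : FreeGroup (Fin d)) → MeasurableSet A → MeasurableSet E →
      (∀ k ∈ isoFix {w : FreeGroup (Fin d) | ℓ w ≤ n}, ∀ x ∈ A, k • x ∈ A) →
      (∀ k ∈ isoFix (insert (τ : FreeGroup (Fin d)) (branch (τ : FreeGroup (Fin d)))ᶜ),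
        ∀ x ∈ A, k • x ∈ A) →
      (∀ k ∈ isoFix (insert 1 (branch (t : FreeGroup (Fin d)))), ∀ x ∈ E, k • x ∈ E) →
      |(haarQuot d Λ).real ((fun x => w⁻¹ • x) ⁻¹' A ∩ E) -
        (haarQuot d Λ).real A * (haarQuot d Λ).real E| ≤ 2 * ε := by
  have := Fintype.ofFinite (𝔽 ⧸ Λ)
  obtain ⟨N₀, hN₀⟩ := exists_iterate_near_const (edgeReversal (Y := 𝔽 ⧸ Λ))
    (two_lt_card_freeGens hd) (const_of_sum_sq_eq hd hΛ) hε
  refine ⟨N₀, fun w t τ n A E hw hwt hwτ hAm hEm hAn hAτ hE => ?_⟩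
  obtain ⟨a, ha01, ha⟩ := exists_conditional_edgeState Λ hAm hAn hAτ
  obtain ⟨N, hN⟩ : ∃ N, ℓ w = N + 1 := ⟨ℓ w - 1, by omega⟩
  obtain ⟨κ, hκ⟩ := hN₀ (N + 1) (by omega) a ha01
  have key : ∀ E : Set (IsoQuot (freeGens d) Λ), MeasurableSet E →
      (∀ k ∈ isoFix (insert 1 (branch (t : 𝔽))), ∀ x ∈ E, k • x ∈ E) →
      |(haarQuot d Λ).real ((fun x => w⁻¹ • x) ⁻¹' A ∩ E) - κ * (haarQuot d Λ).real E| ≤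
        ε * (haarQuot d Λ).real E := by
    intro E hEm hE
    have hE' : ∀ k ∈ isoFix (insert 1 (branch (τ : 𝔽))), ∀ x ∈ (fun x => w • x) ⁻¹' E,
        k • x ∈ (fun x => w • x) ⁻¹' E := by
      intro k hk x hx
      have := hE _ (conj_mem_isoFix_branch t.2 τ.2 hwt hwτ hk) _ hx
      have hx' : (λₗ w * k * (λₗ w)⁻¹) • (w • x) = w • (k • x) := by
        rw [isoQuot_free_smul, isoQuot_free_smul, smul_smul, smul_smul, inv_mul_cancel_right]
      change w • (k • x) ∈ E
      rw [← hx']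
      exact this
    have hE'm : MeasurableSet ((fun x => w • x) ⁻¹' E) := measurableSet_isoQuot_smul Λ (λₗ w) hEm
    have hpre : (fun x : IsoQuot (freeGens d) Λ => λₗ w⁻¹ • x) ⁻¹' ((fun x => w • x) ⁻¹' E) =
        E := by
      ext x
      change w • w⁻¹ • x ∈ E ↔ x ∈ E
      rw [smul_inv_smul]
    have h1 : (haarQuot d Λ).real ((fun x => w⁻¹ • x) ⁻¹' A ∩ E) =
        ∫ x in E, (nonBacktracking edgeReversal)^[N + 1] a (edgeState Λ t x) ∂(haarQuot d Λ) := by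
      rw [← setIntegral_edgeState_iterate Λ hd a N w hN t τ hwt hwτ hE]
      have h2 := ha _ hE'm hE'
      rw [← setIntegral_isoQuot_smul Λ (λₗ w⁻¹), hpre] at h2
      refine Eq.trans ?_ h2
      rw [measureReal_def, measureReal_def,
        ← (measurePreserving_isoQuot_smul Λ (λₗ w⁻¹)).measure_preimage
          (hAm.inter hE'm).nullMeasurableSet, Set.preimage_inter, hpre]
      rfl
    have hint := integrable_comp_edgeState Λ t ((nonBacktracking edgeReversal)^[N + 1] a)
      ((haarQuot d Λ).restrict E)
    have h3 : (haarQuot d Λ).real ((fun x => w⁻¹ • x) ⁻¹' A ∩ E) - κ * (haarQuot d Λ).real E =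
        ∫ x in E, ((nonBacktracking edgeReversal)^[N + 1] a (edgeState Λ t x) - κ)
          ∂(haarQuot d Λ) := by
      rw [h1, integral_sub hint (integrable_const κ), integral_const, smul_eq_mul,
        measureReal_restrict_apply MeasurableSet.univ, Set.univ_inter, mul_comm κ]
    rw [h3, ← Real.norm_eq_abs]
    exact norm_setIntegral_le_of_norm_le_const (measure_lt_top _ _) fun x _ => hκ _
  have h1 := key E hEm hE
  have h2 := key Set.univ MeasurableSet.univ fun _ _ _ _ => trivial
  rw [Set.inter_univ, probReal_univ, mul_one, mul_one] at h2
  have h3 : (haarQuot d Λ).real ((fun x => w⁻¹ • x) ⁻¹' A) = (haarQuot d Λ).real A := by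
    rw [measureReal_def, measureReal_def]
    congr 1
    exact (measurePreserving_isoQuot_smul Λ (λₗ w⁻¹)).measure_preimage hAm.nullMeasurableSet
  rw [h3] at h2
  have hE0 : 0 ≤ (haarQuot d Λ).real E := measureReal_nonneg
  have hE1 : (haarQuot d Λ).real E ≤ 1 := measureReal_le_one
  rw [abs_le] at h1 h2 ⊢
  constructor <;> nlinarith [mul_le_mul_of_nonneg_right h2.1 hE0,
    mul_le_mul_of_nonneg_right h2.2 hE0, mul_le_mul_of_nonneg_left hE1 hε.le]

/-- Asymptotic independence of the sets that are invariant under the stabilizer of a ball: a long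
reduced word splits into a beginning and an end as long as the radius and a long middle part. -/
theorem tendsto_measureReal_inter_of_isoFix_ball (hd : 2 ≤ d) (hΛ : ¬ Λ ≤ evenSubgroup d)
    {A B : Set (IsoQuot (freeGens d) Λ)} (hAm : MeasurableSet A) (hBm : MeasurableSet B) {n : ℕ}
    (hn : 0 < n)
    (hA : ∀ k ∈ isoFix {w : FreeGroup (Fin d) | ℓ w ≤ n}, ∀ x ∈ A, k • x ∈ A)
    (hB : ∀ k ∈ isoFix {w : FreeGroup (Fin d) | ℓ w ≤ n}, ∀ x ∈ B, k • x ∈ B) :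
    Tendsto (fun γ : FreeGroup (Fin d) => (haarQuot d Λ).real ((fun x => γ⁻¹ • x) ⁻¹' A ∩ B))
      cofinite (𝓝 ((haarQuot d Λ).real A * (haarQuot d Λ).real B)) := by
  rw [Metric.tendsto_nhds]
  intro ε hε
  obtain ⟨N₀, hN₀⟩ := exists_abs_measureReal_sub_le Λ hd hΛ (ε := ε / 3) (by positivity)
  have hfin := wordLength_le_finite d (2 * n + N₀)
  refine hfin.subset fun γ hγ => ?_
  by_contra hlen
  refine hγ ?_
  have hlen' : 2 * n + N₀ < ℓ γ := not_le.1 hlen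
  obtain ⟨z, γ', rfl, hz, hγ'⟩ := exists_mul_eq_of_le_wordLength γ (j := n) (by omega)
  obtain ⟨w, y, rfl, hw, hy⟩ := exists_mul_eq_of_le_wordLength γ' (j := ℓ γ' - n) (by omega)
  have hyn : ℓ y = n := by omega
  have hzw : ℓ (z * w) = ℓ z + ℓ w := by
    have h1 := wordLength_mul_le (z * w) y
    have h2 := wordLength_mul_le z w
    rw [mul_assoc] at h1
    omega
  have hwy : ℓ (w * y) = ℓ w + ℓ y := by omega
  have hne : ∀ g : 𝔽, 0 < ℓ g → g⁻¹ ≠ 1 := by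
    intro g hg h
    rw [inv_eq_one] at h
    rw [h, wordLength_one] at hg
    omega
  obtain ⟨t, ht, hzt⟩ := exists_mem_branch (hne z (by omega))
  obtain ⟨τ, hτ, hwτ⟩ := exists_mem_branch (hne w (by omega))
  have hwt := notMem_branch_of_wordLength_mul hzw hzt
  have hyτ := notMem_branch_of_wordLength_mul hwy hwτ
  have hconj : ∀ (g : 𝔽) (k : 𝔾) (x : IsoQuot (freeGens d) Λ),
      (λₗ g * k * (λₗ g)⁻¹) • (g • x) = g • (k • x) := by
    intro g k x
    rw [isoQuot_free_smul, isoQuot_free_smul, smul_smul, smul_smul, inv_mul_cancel_right]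
  have hmeas : ∀ (g : 𝔽) (C : Set (IsoQuot (freeGens d) Λ)), MeasurableSet C →
      MeasurableSet ((fun x => g • x) ⁻¹' C) := fun g C hC =>
    measurableSet_isoQuot_smul Λ (λₗ g) hC
  have hreal : ∀ (g : 𝔽) (C : Set (IsoQuot (freeGens d) Λ)), MeasurableSet C →
      (haarQuot d Λ).real ((fun x => g • x) ⁻¹' C) = (haarQuot d Λ).real C := fun g C hC => by
    rw [measureReal_def, measureReal_def]
    congr 1
    exact (measurePreserving_isoQuot_smul Λ (λₗ g)).measure_preimage hC.nullMeasurableSet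
  have hE : ∀ k ∈ isoFix (insert 1 (branch t)), ∀ x ∈ (fun x => z • x) ⁻¹' B,
      k • x ∈ (fun x => z • x) ⁻¹' B := by
    intro k hk x hx
    change z • k • x ∈ B
    rw [← hconj]
    refine hB _ (conj_mem_isoFix hk fun v hv => ?_) _ hx
    by_contra hne
    have h1 := wordLength_inv_mul_of_notMem_branch ht hzt fun h => hne (Or.inr h)
    rw [inv_inv, mul_inv_cancel_left, wordLength_inv] at h1
    have hv' : ℓ v ≤ n := hv
    exact hne (Or.inl (wordLength_eq_zero.1 (by omega)))
  have hA1 : ∀ k ∈ isoFix {w : 𝔽 | ℓ w ≤ 2 * n}, ∀ x ∈ (fun x => y⁻¹ • x) ⁻¹' A,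
      k • x ∈ (fun x => y⁻¹ • x) ⁻¹' A := by
    intro k hk x hx
    change y⁻¹ • k • x ∈ A
    rw [← hconj]
    refine hA _ (conj_mem_isoFix hk fun v hv => ?_) _ hx
    have hv' : ℓ v ≤ n := hv
    have h1 := wordLength_mul_le y v
    rw [inv_inv]
    change ℓ (y * v) ≤ 2 * n
    omega
  have hA2 : ∀ k ∈ isoFix (insert τ (branch τ)ᶜ), ∀ x ∈ (fun x => y⁻¹ • x) ⁻¹' A,
      k • x ∈ (fun x => y⁻¹ • x) ⁻¹' A := by
    intro k hk x hx
    change y⁻¹ • k • x ∈ A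
    rw [← hconj]
    refine hA _ (conj_mem_isoFix hk fun v hv => Or.inr fun hyv => ?_) _ hx
    rw [inv_inv] at hyv
    have hv' : ℓ v ≤ n := hv
    have h1 := wordLength_inv_mul_of_notMem_branch hτ hyv hyτ
    rw [mul_inv_rev, inv_mul_cancel_right, wordLength_inv] at h1
    have h2 := wordLength_of_mem_branch hτ hyv
    omega
  have hmain := hN₀ w ⟨t, ht⟩ ⟨τ, hτ⟩ (2 * n) _ _ (by omega) hwt hwτ (hmeas y⁻¹ A hAm)
    (hmeas z B hBm) hA1 hA2 hE
  rw [hreal _ _ hAm, hreal _ _ hBm] at hmain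
  have hset : (fun x : IsoQuot (freeGens d) Λ => w⁻¹ • x) ⁻¹' ((fun x => y⁻¹ • x) ⁻¹' A) ∩
      (fun x => z • x) ⁻¹' B =
      (fun x => z • x) ⁻¹' ((fun x => (z * (w * y))⁻¹ • x) ⁻¹' A ∩ B) := by
    ext x
    simp [mul_smul]
  rw [hset, hreal _ _ ((hmeas _ A hAm).inter hBm)] at hmain
  change dist _ _ < ε
  rw [Real.dist_eq]
  refine hmain.trans_lt ?_
  linarith

theorem isMixingAction_haarQuot (hd : 2 ≤ d) (hΛ : ¬ Λ ≤ evenSubgroup d) :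
    IsMixingAction (FreeGroup (Fin d)) (haarQuot d Λ) := by
  intro A B hA hB
  simp only [image_smul_eq_preimage_inv]
  have hpi : IsPiSystem {A : Set (IsoQuot (freeGens d) Λ) | MeasurableSet A ∧
      ∃ n : ℕ, ∀ k ∈ isoFix {w : 𝔽 | ℓ w ≤ n}, ∀ x ∈ A, k • x ∈ A} := by
    rintro A ⟨hA, n, hn⟩ B ⟨hB, m, hm⟩ _
    refine ⟨hA.inter hB, max n m, fun k hk x hx => ⟨?_, ?_⟩⟩
    · exact hn k (isoFix_anti (fun w (hw : ℓ w ≤ n) => le_max_of_le_left hw) hk) x hx.1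
    · exact hm k (isoFix_anti (fun w (hw : ℓ w ≤ m) => le_max_of_le_right hw) hk) x hx.2
  have h := tendsto_measureReal_inter_of_piSystem (μ := haarQuot d Λ) (l := cofinite)
    (φ := fun (γ : 𝔽) x => γ⁻¹ • x) (fun γ => measurePreserving_isoQuot_smul Λ (λₗ γ⁻¹))
    (isoQuot_measurableSpace_eq Λ) hpi (by
      rintro A ⟨hA, n, hn⟩ B ⟨hB, m, hm⟩
      refine tendsto_measureReal_inter_of_isoFix_ball Λ hd hΛ hA hB (n := max n m + 1)
        (Nat.succ_pos _) ?_ ?_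
      · exact fun k hk => hn k (isoFix_anti (fun w (hw : ℓ w ≤ n) =>
          (le_max_of_le_left hw).trans (Nat.le_succ _)) hk)
      · exact fun k hk => hm k (isoFix_anti (fun w (hw : ℓ w ≤ m) =>
          (le_max_of_le_right hw).trans (Nat.le_succ _)) hk)) hA hB
  have h2 := (h.sub_const ((haarQuot d Λ).real A * (haarQuot d Λ).real B)).abs
  simpa using h2

end HaarMixing

/-! ### Isometric orbit equivalence -/

section OrbitEquivalence

variable {X Y : Type*} [MeasurableSpace X] [MeasurableSpace Y] {μ : Measure X} {ν : Measure Y}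

theorem edist_le_of_hom {V W : Type*} {G : SimpleGraph V} {H : SimpleGraph W} (φ : G →g H)
    (x y : V) : H.edist (φ x) (φ y) ≤ G.edist x y :=
  le_iInf fun p => (SimpleGraph.edist_le (p.map φ)).trans (by rw [SimpleGraph.Walk.length_map])

theorem isSaturated_univ (G : SimpleGraph X) : IsSaturated G Set.univ := by
  refine ⟨MeasurableSet.univ, (Set.eq_univ_of_forall fun x => ?_).symm⟩
  exact ⟨x, trivial, by rw [SimpleGraph.edist_self]; exact ENat.top_pos⟩

/-- A measure preserving isomorphism that is an isomorphism of the graphings is an isometric orbit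
equivalence. -/
theorem IsometricOrbitEquivalent.of_adj_iff {Γ Δ : Type*} [Group Γ] [Group Δ] {S : Set Γ}
    {T : Set Δ} [MulAction Γ X] [MulAction Δ Y] [IsProbabilityMeasure μ] (Φ : X ≃ᵐ Y)
    (hΦ : MeasurePreserving Φ μ ν)
    (hadj : ∀ x y, (graphingGraph T Y).Adj (Φ x) (Φ y) ↔ (graphingGraph S X).Adj x y) :
    IsometricOrbitEquivalent S T μ ν := by
  let e : graphingGraph S X ≃g graphingGraph T Y := ⟨Φ.toEquiv, fun {x y} => hadj x y⟩
  refine ⟨Φ, hΦ, Set.univ, isSaturated_univ _, measure_univ, ?_, fun x _ y _ => ?_⟩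
  · rw [Set.image_univ, Φ.surjective.range_eq]
    exact isSaturated_univ _
  · refine (edist_le_of_hom e.toHom x y).antisymm ?_
    have h := edist_le_of_hom e.symm.toHom (Φ x) (Φ y)
    have h1 : ∀ z, e.symm.toHom (Φ z) = z := fun z => e.symm_apply_apply z
    rwa [h1, h1] at h

/-- Ergodicity passes along a measure preserving isomorphism that maps orbits into orbits. -/
theorem ErgodicSMul.of_orbit_map {Γ Δ : Type*} [Group Γ] [Group Δ] [Countable Δ] [MulAction Γ X]
    [MulAction Δ Y] (hX : ErgodicSMul Γ X μ) (Φ : X ≃ᵐ Y) (hΦ : MeasurePreserving Φ μ ν)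
    (hν : ∀ δ : Δ, MeasurePreserving (fun y : Y => δ • y) ν ν)
    (horb : ∀ (γ : Γ) (x : X), ∃ δ : Δ, Φ (γ • x) = δ • Φ x) : ErgodicSMul Δ Y ν := by
  refine { measure_preimage_smul := fun δ A hA => (hν δ).measure_preimage hA.nullMeasurableSet,
           aeconst_of_forall_preimage_smul_ae_eq := fun {A} hA hinv => ?_ }
  have hall : ∀ᵐ x ∂μ, ∀ δ : Δ, (δ • Φ x ∈ A) = (Φ x ∈ A) := by
    rw [ae_all_iff]
    exact fun δ => hΦ.quasiMeasurePreserving.ae (hinv δ)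
  have hconst : EventuallyConst (Φ ⁻¹' A) (ae μ) := by
    refine hX.aeconst_of_forall_preimage_smul_ae_eq (Φ.measurable hA) fun γ => ?_
    filter_upwards [hall] with x hx
    obtain ⟨δ, hδ⟩ := horb γ x
    change (Φ (γ • x) ∈ A) = (Φ x ∈ A)
    rw [hδ, hx δ]
  rw [eventuallyConst_set'] at hconst ⊢
  refine hconst.imp (fun h => ?_) fun h => ?_
  · rw [ae_eq_empty] at h ⊢
    rwa [← hΦ.measure_preimage hA.nullMeasurableSet]
  · rw [ae_eq_univ] at h ⊢
    rwa [← hΦ.measure_preimage hA.compl.nullMeasurableSet]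

end OrbitEquivalence

section InversionEquivalence

variable {d : ℕ}

local notation "𝔽" => FreeGroup (Fin d)
local notation "𝔾" => CayleyIso (freeGens d)
local notation "λₗ" => leftMulIso (freeGens d)

variable (Λ : Subgroup (FreeGroup (Fin d)))

/-- The map `Λ f ↦ (F_d f⁻¹ f(1), f(1)⁻¹ Λ)`. On isometries that fix the identity it is the
inversion in the first coordinate. -/
noncomputable def inversionMap :
    IsoQuot (freeGens d) Λ → IsoQuot (freeGens d) (⊤ : Subgroup (FreeGroup (Fin d))) ×
      (FreeGroup (Fin d) ⧸ Λ) :=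
  Quotient.lift (fun f : 𝔾 => (IsoQuot.mk (freeGens d) ⊤ (f⁻¹ * λₗ ((f : Equiv.Perm 𝔽) 1)),
    ((((f : Equiv.Perm 𝔽) 1)⁻¹ : 𝔽) : 𝔽 ⧸ Λ))) (by
    intro f g h
    obtain ⟨γ, hγ, rfl⟩ := (isoQuot_mk_eq_iff Λ).1 (Quotient.sound h)
    refine Prod.ext ?_ ?_
    · change IsoQuot.mk _ _ _ = IsoQuot.mk _ _ ((λₗ γ * f)⁻¹ * λₗ (γ * (f : Equiv.Perm 𝔽) 1))
      rw [map_mul, mul_inv_rev, mul_assoc, inv_mul_cancel_left]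
    · change ((((f : Equiv.Perm 𝔽) 1)⁻¹ : 𝔽) : 𝔽 ⧸ Λ) = ((γ * (f : Equiv.Perm 𝔽) 1)⁻¹ : 𝔽)
      rw [QuotientGroup.eq]
      simpa using inv_mem hγ)

theorem inversionMap_mk (f : 𝔾) : inversionMap Λ (IsoQuot.mk (freeGens d) Λ f) =
    (IsoQuot.mk (freeGens d) ⊤ (f⁻¹ * λₗ ((f : Equiv.Perm 𝔽) 1)),
      ((((f : Equiv.Perm 𝔽) 1)⁻¹ : 𝔽) : 𝔽 ⧸ Λ)) := rfl

/-- The inverse of `inversionMap`: the map `(F_d h, c Λ) ↦ Λ c⁻¹ h⁻¹ h(1)`. -/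
noncomputable def inversionMapInv (p : IsoQuot (freeGens d) (⊤ : Subgroup (FreeGroup (Fin d))) ×
      (FreeGroup (Fin d) ⧸ Λ)) : IsoQuot (freeGens d) Λ :=
  Quotient.lift (fun h : 𝔾 => IsoQuot.mk (freeGens d) Λ
    (λₗ p.2.out⁻¹ * (h⁻¹ * λₗ ((h : Equiv.Perm 𝔽) 1)))) (by
      intro f g h
      obtain ⟨γ, -, rfl⟩ := (isoQuot_mk_eq_iff ⊤).1 (Quotient.sound h)
      change _ = IsoQuot.mk _ _ (_ * ((λₗ γ * f)⁻¹ * λₗ (γ * (f : Equiv.Perm 𝔽) 1)))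
      rw [map_mul, mul_inv_rev, mul_assoc f⁻¹, inv_mul_cancel_left]) p.1

theorem inversionMapInv_mk (h : 𝔾) (c : 𝔽) :
    inversionMapInv Λ (IsoQuot.mk (freeGens d) ⊤ h, (c : 𝔽 ⧸ Λ)) =
      IsoQuot.mk (freeGens d) Λ (λₗ c⁻¹ * (h⁻¹ * λₗ ((h : Equiv.Perm 𝔽) 1))) := by
  obtain ⟨μ, hμ⟩ := QuotientGroup.mk_out_eq_mul Λ c
  change IsoQuot.mk (freeGens d) Λ (λₗ (c : 𝔽 ⧸ Λ).out⁻¹ * _) = _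
  rw [hμ, mul_inv_rev, map_mul, mul_assoc, isoQuot_mk_leftMul Λ (inv_mem μ.2)]

theorem inversionMapInv_inversionMap (x : IsoQuot (freeGens d) Λ) :
    inversionMapInv Λ (inversionMap Λ x) = x := by
  obtain ⟨f, rfl⟩ := isoQuot_mk_surjective Λ x
  have h1 : ((f⁻¹ * λₗ ((f : Equiv.Perm 𝔽) 1) : 𝔾) : Equiv.Perm 𝔽) 1 = 1 := by
    change (f : Equiv.Perm 𝔽).symm ((f : Equiv.Perm 𝔽) 1 * 1) = 1
    rw [mul_one, Equiv.symm_apply_apply]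
  rw [inversionMap_mk, inversionMapInv_mk, h1]
  congr 1
  simp

theorem inversionMap_inversionMapInv (p : IsoQuot (freeGens d) (⊤ : Subgroup (FreeGroup (Fin d))) ×
      (FreeGroup (Fin d) ⧸ Λ)) : inversionMap Λ (inversionMapInv Λ p) = p := by
  obtain ⟨x, c⟩ := p
  obtain ⟨h, rfl⟩ := isoQuot_mk_surjective ⊤ x
  obtain ⟨c, rfl⟩ := QuotientGroup.mk_surjective c
  have h1 : ((λₗ c⁻¹ * (h⁻¹ * λₗ ((h : Equiv.Perm 𝔽) 1)) : 𝔾) : Equiv.Perm 𝔽) 1 = c⁻¹ := by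
    change c⁻¹ * (h : Equiv.Perm 𝔽).symm ((h : Equiv.Perm 𝔽) 1 * 1) = c⁻¹
    rw [mul_one, Equiv.symm_apply_apply, mul_one]
  rw [inversionMapInv_mk, inversionMap_mk, h1, inv_inv]
  refine Prod.ext ?_ rfl
  change IsoQuot.mk _ _ _ = IsoQuot.mk _ _ h
  rw [← isoQuot_mk_leftMul ⊤ (γ := ((h : Equiv.Perm 𝔽) 1)⁻¹) trivial h]
  congr 1
  simp only [map_inv]
  group

/-- The map sends the orbit of a point isometrically onto an orbit: the point `γ x` is sent to
`δ` times the image of `x`, where `γ⁻¹ ↦ δ⁻¹` is an isometry of the free group. -/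
theorem inversionMap_smul (f : 𝔾) (γ : 𝔽) :
    inversionMap Λ (γ • IsoQuot.mk (freeGens d) Λ f) =
      (((f : Equiv.Perm 𝔽) 1)⁻¹ * (f : Equiv.Perm 𝔽) γ⁻¹)⁻¹ •
        inversionMap Λ (IsoQuot.mk (freeGens d) Λ f) := by
  have hγ : γ • IsoQuot.mk (freeGens d) Λ f = IsoQuot.mk (freeGens d) Λ (f * λₗ γ⁻¹) := by
    rw [isoQuot_free_smul, isoQuot_smul_mk, map_inv]
  have h1 : ((f * λₗ γ⁻¹ : 𝔾) : Equiv.Perm 𝔽) 1 = (f : Equiv.Perm 𝔽) γ⁻¹ := by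
    change (f : Equiv.Perm 𝔽) (γ⁻¹ * 1) = _
    rw [mul_one]
  rw [hγ, inversionMap_mk, inversionMap_mk, h1]
  refine Prod.ext ?_ ?_
  · change _ = (_ : 𝔽) • IsoQuot.mk (freeGens d) ⊤ (f⁻¹ * λₗ ((f : Equiv.Perm 𝔽) 1))
    rw [isoQuot_free_smul, isoQuot_smul_mk,
      ← isoQuot_mk_leftMul ⊤ (γ := γ⁻¹) trivial
        ((f * λₗ γ⁻¹)⁻¹ * λₗ ((f : Equiv.Perm 𝔽) γ⁻¹))]
    simp only [map_inv, map_mul]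
    group
  · change _ = (((((f : Equiv.Perm 𝔽) 1)⁻¹ * (f : Equiv.Perm 𝔽) γ⁻¹)⁻¹ *
      ((f : Equiv.Perm 𝔽) 1)⁻¹ : 𝔽) : 𝔽 ⧸ Λ)
    group

theorem exists_inversionMap_smul (γ : 𝔽) (x : IsoQuot (freeGens d) Λ) :
    ∃ δ : 𝔽, inversionMap Λ (γ • x) = δ • inversionMap Λ x := by
  obtain ⟨f, rfl⟩ := isoQuot_mk_surjective Λ x
  exact ⟨_, inversionMap_smul Λ f γ⟩

theorem inversionMap_smul_freeGens_iff (x y : IsoQuot (freeGens d) Λ) :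
    (∃ s ∈ freeGens d, inversionMap Λ y = s • inversionMap Λ x) ↔ ∃ s ∈ freeGens d, y = s • x := by
  obtain ⟨f, rfl⟩ := isoQuot_mk_surjective Λ x
  constructor
  · rintro ⟨s, hs, h⟩
    -- The point `γ` with `f(1)⁻¹ f(γ) = s⁻¹` is a letter, because `f` is an isometry.
    obtain ⟨γ, hγ⟩ := (f : Equiv.Perm 𝔽).surjective ((f : Equiv.Perm 𝔽) 1 * s⁻¹)
    have hs' : ((f : Equiv.Perm 𝔽) 1)⁻¹ * (f : Equiv.Perm 𝔽) γ = s⁻¹ := by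
      rw [hγ, inv_mul_cancel_left]
    refine ⟨γ⁻¹, inv_mem_freeGens ?_, ?_⟩
    · have h1 := f.2 1 γ
      rw [hs', wordLength_inv, wordLength_eq_one.2 hs, inv_one, one_mul] at h1
      exact wordLength_eq_one.1 h1.symm
    · have h2 := inversionMap_smul Λ f γ⁻¹
      rw [inv_inv, hs', inv_inv, ← h] at h2
      exact (Function.LeftInverse.injective (inversionMapInv_inversionMap Λ) h2).symm
  · rintro ⟨s, hs, rfl⟩
    refine ⟨_, inv_mem_freeGens ?_, inversionMap_smul Λ f s⟩
    simpa using cayleyIso_inv_mul_mem f 1 (inv_mem_freeGens hs)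

theorem inversionMap_adj_iff (x y : IsoQuot (freeGens d) Λ) :
    (graphingGraph (freeGens d) _).Adj (inversionMap Λ x) (inversionMap Λ y) ↔
      (graphingGraph (freeGens d) _).Adj x y := by
  rw [graphingGraph, graphingGraph, SimpleGraph.fromRel_adj, SimpleGraph.fromRel_adj,
    inversionMap_smul_freeGens_iff, inversionMap_smul_freeGens_iff,
    (Function.LeftInverse.injective (inversionMapInv_inversionMap Λ)).ne_iff]

instance instDiscreteMeasurableFreeCosets : DiscreteMeasurableSpace (FreeGroup (Fin d) ⧸ Λ) :=
  ⟨fun _ => trivial⟩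

theorem measurable_inversionMap : Measurable (inversionMap Λ) := by
  rw [measurable_isoQuot_iff]
  refine Measurable.prodMk ?_ ?_
  · exact (measurable_isoQuot_mk ⊤).comp (continuous_of_continuous_eval _ 1
      (fun δ f => f⁻¹ * λₗ δ) fun δ => (continuous_mul_const _).comp continuous_inv).measurable
  · intro A _
    exact (cayleyIso_isOpen_mem (freeGens d) 1 {γ : 𝔽 | ((γ⁻¹ : 𝔽) : 𝔽 ⧸ Λ) ∈ A}).measurableSet

theorem measurable_inversionMapInv : Measurable (inversionMapInv Λ) := by
  have : Countable (𝔽 ⧸ Λ) := QuotientGroup.mk_surjective.countable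
  refine measurable_from_prod_countable_left fun c => ?_
  rw [measurable_isoQuot_iff]
  exact (measurable_isoQuot_mk Λ).comp (continuous_of_continuous_eval _ 1
    (fun δ f => λₗ c.out⁻¹ * (f⁻¹ * λₗ δ)) fun δ =>
      (continuous_const_mul _).comp ((continuous_mul_const _).comp continuous_inv)).measurable

/-- The bimeasurable bijection underlying the orbit equivalence. -/
noncomputable def inversionEquiv :
    IsoQuot (freeGens d) Λ ≃ᵐ IsoQuot (freeGens d) (⊤ : Subgroup (FreeGroup (Fin d))) ×
      (FreeGroup (Fin d) ⧸ Λ) where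
  toFun := inversionMap Λ
  invFun := inversionMapInv Λ
  left_inv := inversionMapInv_inversionMap Λ
  right_inv := inversionMap_inversionMapInv Λ
  measurable_toFun := measurable_inversionMap Λ
  measurable_invFun := measurable_inversionMapInv Λ

theorem haarQuot_top_apply {E : Set (IsoQuot (freeGens d) (⊤ : Subgroup (FreeGroup (Fin d))))}
    (hE : MeasurableSet E) : haarQuot d ⊤ E =
      haarIso d ({f | (f : Equiv.Perm 𝔽) 1 = 1} ∩ IsoQuot.mk (freeGens d) ⊤ ⁻¹' E) := by
  classical
  rw [haarQuot_apply ⊤ hE, Subgroup.index_top, Nat.cast_one, inv_one, one_mul, Set.inter_comm,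
    (isFundamentalDomain_isoFundamentalDomain ⊤).measure_set_eq
      (isFundamentalDomain_eval_eq 1 1) (measurable_isoQuot_mk ⊤ hE), Set.inter_comm]
  rintro ⟨_, γ, hγ, rfl⟩
  ext f
  change IsoQuot.mk (freeGens d) ⊤ (λₗ γ * f) ∈ E ↔ _
  rw [isoQuot_mk_leftMul ⊤ hγ]
  rfl

variable [Λ.FiniteIndex]

theorem uniformCosets_apply (t : Set (FreeGroup (Fin d) ⧸ Λ)) :
    uniformCosets d Λ t = (Λ.index : ℝ≥0∞)⁻¹ * (t.encard : ℝ≥0∞) := by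
  have := Fintype.ofFinite (𝔽 ⧸ Λ)
  rw [uniformCosets, uniformOn_univ, Measure.count_apply MeasurableSet.of_discrete, Subgroup.index,
    Nat.card_eq_fintype_card, ENNReal.div_eq_inv_mul]

instance instIsProbabilityMeasureUniformCosets : IsProbabilityMeasure (uniformCosets d Λ) := by
  unfold uniformCosets; infer_instance

theorem measurePreserving_uniformCosets (γ : 𝔽) :
    MeasurePreserving (fun c : 𝔽 ⧸ Λ => γ • c) (uniformCosets d Λ) (uniformCosets d Λ) := by
  refine ⟨measurable_of_countable _, ?_⟩
  ext t ht
  rw [Measure.map_apply (measurable_of_countable _) ht, uniformCosets_apply, uniformCosets_apply,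
    Set.encard_preimage_of_bijective (MulAction.bijective γ)]

/-- The inversion preserves the measures: the fundamental domain is a union of translates of the
stabilizer of the identity by coset representatives, and the Haar measure of the stabilizer is
invariant under inversion. -/
theorem measurePreserving_inversionEquiv :
    MeasurePreserving (inversionEquiv Λ) (haarQuot d Λ)
      ((haarQuot d ⊤).prod (uniformCosets d Λ)) := by
  classical
  refine ⟨(inversionEquiv Λ).measurable, (Measure.prod_eq fun s t hs ht => ?_).symm⟩
  have := Fintype.ofFinite (Quotient (QuotientGroup.rightRel Λ))
  have := Fintype.ofFinite (𝔽 ⧸ Λ)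
  have hst : MeasurableSet (inversionEquiv Λ ⁻¹' (s ×ˢ t)) :=
    (inversionEquiv Λ).measurable (hs.prod ht)
  rw [Measure.map_apply (inversionEquiv Λ).measurable (hs.prod ht), haarQuot_apply Λ hst,
    haarIso_inter_isoFundamentalDomain Λ (measurable_isoQuot_mk Λ hst), uniformCosets_apply,
    mul_left_comm]
  congr 1
  have hterm : ∀ c : Quotient (QuotientGroup.rightRel Λ),
      haarIso d ({f | (f : Equiv.Perm 𝔽) 1 = 1} ∩ {f | λₗ c.out * f ∈
        IsoQuot.mk (freeGens d) Λ ⁻¹' (inversionEquiv Λ ⁻¹' (s ×ˢ t))}) =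
      haarQuot d ⊤ s * t.indicator 1
        (QuotientGroup.quotientRightRelEquivQuotientLeftRel Λ c) := by
    intro c
    have hc : QuotientGroup.quotientRightRelEquivQuotientLeftRel Λ c =
        ((c.out⁻¹ : 𝔽) : 𝔽 ⧸ Λ) := by
      conv_lhs => rw [← Quotient.out_eq c]
      rfl
    have hmem : ∀ f : 𝔾, (f : Equiv.Perm 𝔽) 1 = 1 →
        (λₗ c.out * f ∈ IsoQuot.mk (freeGens d) Λ ⁻¹' (inversionEquiv Λ ⁻¹' (s ×ˢ t)) ↔
          IsoQuot.mk (freeGens d) ⊤ f⁻¹ ∈ s ∧ ((c.out⁻¹ : 𝔽) : 𝔽 ⧸ Λ) ∈ t) := by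
      intro f hf
      change inversionMap Λ (IsoQuot.mk (freeGens d) Λ (λₗ c.out * f)) ∈ s ×ˢ t ↔ _
      rw [inversionMap_mk, leftMulIso_mul_apply, hf, mul_one, mul_inv_rev, inv_mul_cancel_right]
      rfl
    rw [hc]
    by_cases hct : ((c.out⁻¹ : 𝔽) : 𝔽 ⧸ Λ) ∈ t
    · rw [Set.indicator_of_mem hct, Pi.one_apply, mul_one, haarQuot_top_apply hs,
        ← Measure.measure_inv (haarIso d)
          ({f | (f : Equiv.Perm 𝔽) 1 = 1} ∩ IsoQuot.mk (freeGens d) ⊤ ⁻¹' s)]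
      congr 1
      ext f
      have hinv : ((f⁻¹ : 𝔾) : Equiv.Perm 𝔽) 1 = 1 ↔ (f : Equiv.Perm 𝔽) 1 = 1 := by
        change (f : Equiv.Perm 𝔽).symm 1 = 1 ↔ (f : Equiv.Perm 𝔽) 1 = 1
        rw [Equiv.symm_apply_eq]
        exact eq_comm
      change ((f : Equiv.Perm 𝔽) 1 = 1 ∧ _) ↔
        (((f⁻¹ : 𝔾) : Equiv.Perm 𝔽) 1 = 1 ∧ IsoQuot.mk (freeGens d) ⊤ f⁻¹ ∈ s)
      rw [hinv]
      exact and_congr_right fun hf => (hmem f hf).trans (and_iff_left hct)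
    · rw [Set.indicator_of_notMem hct, mul_zero]
      convert measure_empty (μ := haarIso d)
      refine Set.eq_empty_of_forall_notMem fun f hf => ?_
      exact hct ((hmem f hf.1).1 hf.2).2
  rw [Finset.sum_congr rfl fun c _ => hterm c, ← Finset.mul_sum,
    Equiv.sum_comp (QuotientGroup.quotientRightRelEquivQuotientLeftRel Λ)
      (t.indicator (1 : 𝔽 ⧸ Λ → ℝ≥0∞)), ← ENNReal.tsum_set_one, tsum_subtype t fun _ => 1,
    tsum_fintype]
  rfl

theorem isPMPAction_haarQuot : IsPMPAction 𝔽 (haarQuot d Λ) :=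
  ⟨inferInstance, inferInstance, fun γ => measurePreserving_isoQuot_smul Λ (λₗ γ)⟩

theorem isPMPAction_prod : IsPMPAction 𝔽 ((haarQuot d ⊤).prod (uniformCosets d Λ)) :=
  ⟨inferInstance, inferInstance, fun γ =>
    (measurePreserving_isoQuot_smul ⊤ (λₗ γ)).prod (measurePreserving_uniformCosets Λ γ)⟩

/-- The diagonal action has a nontrivial finite factor, which an infinite subgroup acts on with a
fixed point. -/
theorem not_isMixingAction_prod (hd : 2 ≤ d) (hΛ : Λ ≠ ⊤) :
    ¬ IsMixingAction 𝔽 ((haarQuot d ⊤).prod (uniformCosets d Λ)) := by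
  intro h
  set m := (haarQuot d (⊤ : Subgroup 𝔽)).prod (uniformCosets d Λ) with hm
  let c₀ : 𝔽 ⧸ Λ := ((1 : 𝔽) : 𝔽 ⧸ Λ)
  let A : Set (IsoQuot (freeGens d) (⊤ : Subgroup 𝔽) × (𝔽 ⧸ Λ)) := Set.univ ×ˢ {c₀}
  have hA : MeasurableSet A := MeasurableSet.univ.prod (measurableSet_singleton _)
  have hmA : m.real A = (Λ.index : ℝ)⁻¹ := by
    rw [measureReal_def, hm, Measure.prod_prod, measure_univ, one_mul, uniformCosets_apply,
      Set.encard_singleton]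
    simp
  have hinf : Infinite Λ := by
    have := freeGroup_fin_infinite hd
    by_contra hfin
    rw [not_infinite_iff_finite] at hfin
    exact not_finite_iff_infinite.2 this
      (Finite.of_equiv _ (Subgroup.groupEquivQuotientProdSubgroup (s := Λ)).symm)
  have hfix : ∀ γ ∈ Λ, ((fun x => γ • x) '' A) ∩ A = A := by
    intro γ hγ
    have hc : γ⁻¹ • c₀ = c₀ := by
      change ((γ⁻¹ * 1 : 𝔽) : 𝔽 ⧸ Λ) = _
      rw [QuotientGroup.eq]
      simpa using hγ
    rw [image_smul_eq_preimage_inv, Set.inter_eq_right]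
    rintro ⟨x, c⟩ ⟨-, hx⟩
    have hx' : c = c₀ := hx
    subst hx'
    exact ⟨trivial, hc⟩
  have hlim := h A A hA hA
  have hfreq : ∃ᶠ γ : 𝔽 in cofinite, |m.real (((fun x => γ • x) '' A) ∩ A) -
      m.real A * m.real A| = |m.real A - m.real A * m.real A| := by
    rw [frequently_cofinite_iff_infinite]
    refine (Set.infinite_coe_iff.1 hinf).mono fun γ hγ => ?_
    change |_| = |_|
    rw [hfix γ hγ]
  have hzero : |m.real A - m.real A * m.real A| = 0 := by
    by_contra hne
    have hev := hlim.eventually_ne (Ne.symm hne)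
    obtain ⟨γ, h1, h2⟩ := (hfreq.and_eventually hev).exists
    exact h2 h1
  have hidx : Λ.index ≠ 1 := mt Subgroup.index_eq_one.1 hΛ
  have hidx0 : Λ.index ≠ 0 := Subgroup.FiniteIndex.index_ne_zero
  rw [abs_eq_zero, hmA] at hzero
  have h0 : (Λ.index : ℝ) ≠ 0 := by exact_mod_cast hidx0
  field_simp at hzero
  apply hidx
  have : (Λ.index : ℝ) = 1 := by linarith
  exact_mod_cast this

end InversionEquivalence

/-- The words with an even number of letters `x₁^{±1}` form a proper subgroup of finite index that
contains a generator, hence a word of odd length. -/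
theorem exists_finiteIndex_not_le_evenSubgroup {d : ℕ} (hd : 2 ≤ d) :
    ∃ Λ : Subgroup (FreeGroup (Fin d)), Λ.FiniteIndex ∧ ¬ Λ ≤ evenSubgroup d ∧ Λ ≠ ⊤ := by
  let φ : FreeGroup (Fin d) →* Multiplicative (ZMod 2) :=
    FreeGroup.lift fun i => if (i : ℕ) = 0 then Multiplicative.ofAdd 1 else 1
  refine ⟨φ.ker, inferInstance, fun h => ?_, fun h => ?_⟩
  · have h1 : FreeGroup.of (⟨1, by omega⟩ : Fin d) ∈ φ.ker := by
      simp [φ, MonoidHom.mem_ker]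
    have h2 : Even (wordLength (freeGens d) (FreeGroup.of (⟨1, by omega⟩ : Fin d))) := h h1
    rw [wordLength_eq_one.2 ⟨_, Or.inl rfl⟩] at h2
    exact Nat.not_even_one h2
  · have h1 : FreeGroup.of (⟨0, by omega⟩ : Fin d) ∈ φ.ker := h ▸ trivial
    simp only [φ, MonoidHom.mem_ker, FreeGroup.lift_apply_of, if_true] at h1
    exact absurd h1 (by decide)

/-! ### Mixing is not an invariant of isometric orbit equivalence -/

theorem ergodicSMul_haarQuot {d : ℕ} (hd : 2 ≤ d) (Λ : Subgroup (FreeGroup (Fin d)))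
    [Λ.FiniteIndex] (hΛ : ¬ Λ ≤ evenSubgroup d) :
    ErgodicSMul (FreeGroup (Fin d)) (IsoQuot (freeGens d) Λ) (haarQuot d Λ) := by
  have := freeGroup_fin_infinite hd
  exact ErgodicSMul.of_isMixingAction
    (fun γ => measurePreserving_isoQuot_smul Λ (leftMulIso (freeGens d) γ))
    (isMixingAction_haarQuot Λ hd hΛ)

theorem ergodicSMul_prod {d : ℕ} (hd : 2 ≤ d) (Λ : Subgroup (FreeGroup (Fin d)))
    [Λ.FiniteIndex] (hΛ : ¬ Λ ≤ evenSubgroup d) :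
    ErgodicSMul (FreeGroup (Fin d)) (IsoQuot (freeGens d) ⊤ × (FreeGroup (Fin d) ⧸ Λ))
      ((haarQuot d ⊤).prod (uniformCosets d Λ)) :=
  ErgodicSMul.of_orbit_map (ergodicSMul_haarQuot hd Λ hΛ) (inversionEquiv Λ)
    (measurePreserving_inversionEquiv Λ) (isPMPAction_prod Λ).measurePreserving
    (exists_inversionMap_smul Λ)

theorem isometricOrbitEquivalent_prod_haarQuot {d : ℕ} (Λ : Subgroup (FreeGroup (Fin d)))
    [Λ.FiniteIndex] :
    IsometricOrbitEquivalent (freeGens d) (freeGens d)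
      ((haarQuot d ⊤).prod (uniformCosets d Λ)) (haarQuot d Λ) := by
  refine IsometricOrbitEquivalent.of_adj_iff (inversionEquiv Λ).symm
    ((measurePreserving_inversionEquiv Λ).symm _) fun p q => ?_
  have h := inversionMap_adj_iff Λ (inversionMapInv Λ p) (inversionMapInv Λ q)
  rw [inversionMap_inversionMapInv, inversionMap_inversionMapInv] at h
  exact h.symm

theorem mainTheorem3 (d : ℕ) (hd : 2 ≤ d) :
    (∀ Λ : Subgroup (FreeGroup (Fin d)), Λ.FiniteIndex → ¬ Λ ≤ evenSubgroup d →
      -- both actions are p.m.p. and ergodic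
      IsPMPAction (FreeGroup (Fin d)) (haarQuot d Λ) ∧
      IsPMPAction (FreeGroup (Fin d)) ((haarQuot d ⊤).prod (uniformCosets d Λ)) ∧
      ErgodicSMul (FreeGroup (Fin d)) (IsoQuot (freeGens d) Λ) (haarQuot d Λ) ∧
      ErgodicSMul (FreeGroup (Fin d))
        (IsoQuot (freeGens d) ⊤ × (FreeGroup (Fin d) ⧸ Λ))
        ((haarQuot d ⊤).prod (uniformCosets d Λ)) ∧
      -- they are isometric orbit equivalent
      IsometricOrbitEquivalent (freeGens d) (freeGens d)
        (haarQuot d Λ) ((haarQuot d ⊤).prod (uniformCosets d Λ)) ∧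
      -- the former is mixing, the latter is not
      IsMixingAction (FreeGroup (Fin d)) (haarQuot d Λ) ∧
      (Λ ≠ ⊤ → ¬ IsMixingAction (FreeGroup (Fin d))
        ((haarQuot d ⊤).prod (uniformCosets d Λ)))) ∧
    -- mixing is not invariant under isometric orbit equivalence of ergodic actions
    (∃ (X Y : Type) (_ : MeasurableSpace X) (_ : MeasurableSpace Y)
      (_ : MulAction (FreeGroup (Fin d)) X) (_ : MulAction (FreeGroup (Fin d)) Y)
      (μ : Measure X) (ν : Measure Y),
      IsPMPAction (FreeGroup (Fin d)) μ ∧ IsPMPAction (FreeGroup (Fin d)) ν ∧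
      ErgodicSMul (FreeGroup (Fin d)) X μ ∧ ErgodicSMul (FreeGroup (Fin d)) Y ν ∧
      IsometricOrbitEquivalent (freeGens d) (freeGens d) μ ν ∧
      ¬ IsMixingAction (FreeGroup (Fin d)) μ ∧ IsMixingAction (FreeGroup (Fin d)) ν) := by
  refine ⟨fun Λ _ hΛ => ⟨isPMPAction_haarQuot Λ, isPMPAction_prod Λ, ergodicSMul_haarQuot hd Λ hΛ,
    ergodicSMul_prod hd Λ hΛ, IsometricOrbitEquivalent.of_adj_iff (inversionEquiv Λ)
      (measurePreserving_inversionEquiv Λ) (inversionMap_adj_iff Λ),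
    isMixingAction_haarQuot Λ hd hΛ, not_isMixingAction_prod Λ hd⟩, ?_⟩
  obtain ⟨Λ, hfin, hΛ, hne⟩ := exists_finiteIndex_not_le_evenSubgroup hd
  exact ⟨IsoQuot (freeGens d) ⊤ × (FreeGroup (Fin d) ⧸ Λ), IsoQuot (freeGens d) Λ,
    inferInstance, inferInstance, inferInstance, inferInstance,
    (haarQuot d ⊤).prod (uniformCosets d Λ), haarQuot d Λ,
    isPMPAction_prod Λ, isPMPAction_haarQuot Λ, ergodicSMul_prod hd Λ hΛ,
    ergodicSMul_haarQuot hd Λ hΛ, isometricOrbitEquivalent_prod_haarQuot Λ,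
    not_isMixingAction_prod Λ hd hne, isMixingAction_haarQuot Λ hd hΛ⟩
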